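/- Let $q$ be a power of a prime, $n\ge 1$ an odd integer and $m=\frac{q^n+1}{q+1}$. Let $\mathcal C_n=\mathbb F_{q^{2n}}(x,y,z)$ be the generalized Giulietti--Korchmáros function field, defined by $$x^q+x=y^{q+1},\qquad z^m=y^{q^2}-y,$$ where $x$ is transcendental over $\mathbb F_{q^{2n}}$. Let $Q_\infty$ be the unique pole of $z$, with normalized discrete valuation $v_{Q_\infty}$, and let $B(Q_\infty)$ be the stabilizer of $Q_\infty$ in $\mathrm{Aut}(\mathcal C_n/\mathbb F_{q^{2n}})$. It is known to consist of the automorphisms $[a,b,c,d]$ given by $$x\mapsto a^{q+1}x+ab^qy+c,\qquad y\mapsto ay+b,\qquad z\mapsto dz,$$ where $a\in\mathbb F_{q^2}^*$, $b,c\in\mathbb F_{q^2}$, $d\in\mathbb F_{q^{2n}}$, $c^q+c=b^{q+1}$ and $d^m=a$. For $\alpha,\beta\in\mathbb F_{q^2}$ with $\alpha^q+\alpha=\beta^{q+1}$ let $Q_{\alpha\beta}$ be the unique place of $\mathcal C_n$ at which $x$ and $y$ take the values $\alpha$ and $\beta$, and for $g\in B(Q_\infty)$ let $N(g)$ be the number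 of places $Q_{\alpha\beta}$ with $g(Q_{\alpha\beta})=Q_{\alpha\beta}$. For a subgroup $G\le B(Q_\infty)$ (it is necessarily finite) put $$g_0=\#\{d : [a,b,c,d]\in G \text{ for some } a,b,c\},\qquad g_w=\#\{[a,b,c,d]\in G : d=1\},$$ $$G_2=\{b : [1,b,c,d]\in G\text{ for some }c,d\},\qquad G_3=\{c : [1,0,c,d]\in G\text{ for some }d\},$$ and $\delta_1=\gcd(g_0,m)$, $\delta_2=\gcd(g_0,q^n+1)$. Let $\tau=z^{q^{n-3}}/x$ if $n\ge 3$, and $\tau=y/x$ if $n=1$. Then $$\sum_{\mathrm{id}\ne g\in G} v_{Q_\infty}(g(\tau)-\tau)=(m+g_0)g_w+(q^n+1-m)\,\#G_3-(q^n+2)$$ and $$\sum_{\mathrm{id}\ne g\in G} N(g)=q(\delta_2-\delta_1)\,\#G_2+(g_0-\delta_2)g_w+q^3(\delta_1-1).$$ -/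

import Mathlib

/-- The exponent `m = (q ^ n + 1) / (q + 1)`; the division is exact for odd `n`. -/
def GGK.m (q n : ℕ) : ℕ := (q ^ n + 1) / (q + 1)

/-- `F = K(x, y, z)` is the generalized Giulietti-Korchmaros function field `C_n` over the field
`K` with `q ^ (2 n)` elements (`q` a prime power, `n ≥ 1` odd): `x` is transcendental over `K`,
`x ^ q + x = y ^ (q + 1)` and `z ^ m = y ^ (q ^ 2) - y`. These data determine `F` together with
`x`, `y`, `z` up to isomorphism over `K`. -/
structure IsGGK (q n : ℕ) (K : Type*) {F : Type*} [Field K] [Field F] [Algebra K F]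
    (x y z : F) : Prop where
  isPrimePow : IsPrimePow q
  odd : Odd n
  card_eq : Nat.card K = q ^ (2 * n)
  transcendental : Transcendental K x
  hermitian : x ^ q + x = y ^ (q + 1)
  kummer : z ^ GGK.m q n = y ^ (q ^ 2) - y
  adjoin_eq_top : IntermediateField.adjoin K {x, y, z} = ⊤

namespace GGK

/-- The function field `C_n` exists over every field with `q ^ (2 n)` elements. -/
theorem exists_isGGK (q n : ℕ) (hq : IsPrimePow q) (hn : Odd n) (K : Type*) [Field K]
    (hK : Nat.card K = q ^ (2 * n)) :
    ∃ (L : IntermediateField K (AlgebraicClosure (RatFunc K))) (x y z : L),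
      IsGGK q n K x y z := by
  have hq0 : 0 < q := hq.pos
  have hm : GGK.m q n ≠ 0 := by
    have h1 : q ≤ q ^ n := Nat.le_self_pow (by rintro rfl; simp at hn) q
    have : 0 < (q ^ n + 1) / (q + 1) := Nat.div_pos (by omega) (by omega)
    exact this.ne'
  let X : AlgebraicClosure (RatFunc K) := algebraMap (RatFunc K) _ RatFunc.X
  obtain ⟨Y, hY⟩ := IsAlgClosed.exists_pow_nat_eq (X ^ q + X) (Nat.succ_pos q)
  obtain ⟨Z, hZ⟩ := IsAlgClosed.exists_pow_nat_eq (Y ^ (q ^ 2) - Y) (Nat.pos_of_ne_zero hm)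
  have hX : Transcendental K X :=
    (transcendental_algebraMap_iff (algebraMap (RatFunc K) _).injective).2
      RatFunc.transcendental_X
  let L := IntermediateField.adjoin K ({X, Y, Z} : Set (AlgebraicClosure (RatFunc K)))
  have hmem : ∀ w ∈ ({X, Y, Z} : Set (AlgebraicClosure (RatFunc K))), w ∈ L :=
    fun w hw => IntermediateField.subset_adjoin K _ hw
  refine ⟨L, ⟨X, hmem X (by simp)⟩, ⟨Y, hmem Y (by simp)⟩, ⟨Z, hmem Z (by simp)⟩,
    hq, hn, hK, ?_, ?_, ?_, ?_⟩
  · exact (transcendental_algebraMap_iff (algebraMap L _).injective).1 hX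
  · exact Subtype.ext hY.symm
  · exact Subtype.ext hZ
  · apply IntermediateField.map_injective L.val
    rw [IntermediateField.adjoin_map, ← AlgHom.fieldRange_eq_map, IntermediateField.fieldRange_val]
    simp [Set.image_insert_eq, L]

/-- A place of the function field `F / K`, given by its valuation ring. -/
def IsPlace (K : Type*) {F : Type*} [Field K] [Field F] [Algebra K F]
    (P : ValuationSubring F) : Prop :=
  (∀ k : K, algebraMap K F k ∈ P) ∧ P ≠ ⊤

/-- `t` is a uniformizing element of the valuation ring `P`: a nonzero generator of the
maximal ideal. -/
def IsUniformizer {F : Type*} [Field F] (P : ValuationSubring F) (t : F) : Prop :=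
  t ≠ 0 ∧ P.valuation t < 1 ∧ ∀ s : F, P.valuation s < 1 → P.valuation s ≤ P.valuation t

open Classical in
/-- The normalized discrete valuation `v_P : F → ℤ ∪ {∞}` of a place `P`: `v_P 0 = ∞`, and
`v_P f = k` if `f` is a unit of the valuation ring times the `k`-th power of a uniformizing
element. (Every place of a function field in one variable is discrete, so the last branch
does not occur there.) -/
noncomputable def ord {F : Type*} [Field F] (P : ValuationSubring F) (f : F) : WithTop ℤ :=
  if f = 0 then ⊤
  else if h : ∃ k : ℤ, ∃ t : F, IsUniformizer P t ∧ P.valuation f = P.valuation t ^ k then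
    ((h.choose : ℤ) : WithTop ℤ)
  else 0

/-- The value of `ord` does not depend on choices. -/
theorem ord_eq {F : Type*} [Field F] {P : ValuationSubring F} {f t : F} {k : ℤ}
    (ht : IsUniformizer P t) (hf : P.valuation f = P.valuation t ^ k) :
    ord P f = (k : WithTop ℤ) := by
  have hv : P.valuation t ≠ 0 := (Valuation.ne_zero_iff _).2 ht.1
  have hf0 : f ≠ 0 := by
    rintro rfl
    rw [map_zero] at hf
    exact zpow_ne_zero k hv hf.symm
  have h : ∃ k : ℤ, ∃ t : F, IsUniformizer P t ∧ P.valuation f = P.valuation t ^ k :=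
    ⟨k, t, ht, hf⟩
  rw [ord, if_neg hf0, dif_pos h]
  obtain ⟨s, hs, hsf⟩ := h.choose_spec
  have hst : P.valuation s = P.valuation t :=
    le_antisymm (ht.2.2 s hs.2.1) (hs.2.2 t ht.2.1)
  have hk : P.valuation t ^ k = P.valuation t ^ h.choose := hf.symm.trans (hst ▸ hsf)
  rw [← zpow_right_injective₀ (zero_lt_iff.2 hv) ht.2.1.ne hk]

section

variable {K F : Type*} [Field K] [Field F] [Algebra K F]

/-- `g = [a, b, c, d]`: here `a ∈ 𝔽_{q²}ˣ`, `b, c ∈ 𝔽_{q²}`, `c ^ q + c = b ^ (q + 1)`,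
`d ^ m = a`, and `g x = a ^ (q + 1) x + a b ^ q y + c`, `g y = a y + b`, `g z = d z`. The subfield
`𝔽_{q²}` of `K` is the set of all `u` with `u ^ (q ^ 2) = u`. -/
structure HasCoords (q n : ℕ) (x y z : F) (g : F ≃ₐ[K] F) (a b c d : K) : Prop where
  a_ne_zero : a ≠ 0
  a_mem : a ^ (q ^ 2) = a
  b_mem : b ^ (q ^ 2) = b
  c_mem : c ^ (q ^ 2) = c
  trace_norm : c ^ q + c = b ^ (q + 1)
  d_pow : d ^ m q n = a
  map_x : g x = algebraMap K F (a ^ (q + 1)) * x + algebraMap K F (a * b ^ q) * y + algebraMap K F c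
  map_y : g y = algebraMap K F a * y + algebraMap K F b
  map_z : g z = algebraMap K F d * z

/-- `G₀`, the image of `G` under `[a, b, c, d] ↦ d`. -/
def G0 (q n : ℕ) (x y z : F) (G : Subgroup (F ≃ₐ[K] F)) : Set K :=
  {d | ∃ g ∈ G, ∃ a b c : K, HasCoords q n x y z g a b c d}

/-- The kernel of the map `[a, b, c, d] ↦ d` on `G`; its cardinality is `g_w`. -/
def Gw (q n : ℕ) (x y z : F) (G : Subgroup (F ≃ₐ[K] F)) : Set (F ≃ₐ[K] F) :=
  {g | g ∈ G ∧ ∃ a b c : K, HasCoords q n x y z g a b c 1}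

/-- `G₂`, the set of all `b` such that `[1, b, c]` lies, for some `c`, in the image of `G` under
`[a, b, c, d] ↦ [a, b, c]`. -/
def G2 (q n : ℕ) (x y z : F) (G : Subgroup (F ≃ₐ[K] F)) : Set K :=
  {b | ∃ g ∈ G, ∃ c d : K, HasCoords q n x y z g 1 b c d}

/-- `G₃`, the set of all `c` such that `[1, 0, c]` lies in the image of `G` under
`[a, b, c, d] ↦ [a, b, c]`. -/
def G3 (q n : ℕ) (x y z : F) (G : Subgroup (F ≃ₐ[K] F)) : Set K :=
  {c | ∃ g ∈ G, ∃ d : K, HasCoords q n x y z g 1 0 c d}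

/-- `P` is one of the places `Q_{αβ}`, where `α, β ∈ 𝔽_{q²}` and `α ^ q + α = β ^ (q + 1)`:
the functions `x` and `y` take the values `α` and `β` at `P`. -/
def IsQαβ (K : Type*) [Field K] [Algebra K F] (q : ℕ) (x y : F) (P : ValuationSubring F) : Prop :=
  IsPlace K P ∧ ∃ α β : K, α ^ (q ^ 2) = α ∧ β ^ (q ^ 2) = β ∧ α ^ q + α = β ^ (q + 1) ∧
    P.valuation (x - algebraMap K F α) < 1 ∧ P.valuation (y - algebraMap K F β) < 1

/-- `N(g)`, the number of places `Q_{αβ}` fixed by `g` (that is, with `g` in the stabilizer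
of `Q_{αβ}`). -/
noncomputable def N (q : ℕ) (x y : F) (g : F ≃ₐ[K] F) : ℕ :=
  {P : ValuationSubring F | IsQαβ K q x y P ∧ g ∈ P.decompositionSubgroup K}.ncard

/-- The uniformizing element `τ` at `Q_∞`: `τ = z ^ (q ^ (n - 3)) / x` for odd `n ≥ 3`, and
`τ = y / x` in the Hermitian case `n = 1`. -/
def tau (q n : ℕ) (x y z : F) : F :=
  if n = 1 then y / x else z ^ (q ^ (n - 3)) / x

end

end GGK

/-! ### Arithmetic of `m` and of the pole orders of monomials -/

namespace GGK

/-! Everything rests on the ring R = K[x, y, z]. It is spanned by the monomials z^i y^j x^k with j <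
q² and k < q. At a pole of z, the values of z, y, x are the powers with exponents q³, qm, (q+1)m of
the inverse value of τ (`exists_delta`). These give the monomials pairwise different pole orders
(`wt_injective`), so no cancellation occurs. Hence the monomials form a basis, τ is a uniformizer, z
has only one pole, and the elements of R of bounded pole order are explicitly known.

The stabilizer of Q_∞ preserves R because R is integrally closed (`mem_coordRing_of_isIntegral`), so
that R is the intersection of the valuation rings containing it. Bounding the pole orders of g x, g
y, g z and substituting into the two defining equations forces g = [a, b, c, d]
(`exists_hasCoords`).

For the first sum, put g τ - τ over the denominator x · g x; the dominant term of the numerator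
gives order 1 if d ≠ 1, m + 1 if d = 1 and b ≠ 0, and q^n + 2 if d = 1, b = 0, c ≠ 0
(`ord_map_tau_sub`). As a sum of indicator functions this can be added up over G, with #G = g₀ g_w;
the identity, formally counted with q^n + 2, is subtracted.

For the second sum, z is a local parameter at each of its zeros, which makes Q_{αβ} exist uniquely,
so N(g) counts the fixed points of an affine map on the pairs (α, β) (`N_eq_ncard`). There are q³ or
0 of them if a = 1, q or 0 if a ≠ 1 and a^(q+1) = 1, and 1 otherwise. In terms of d, the conditions
are d^m = 1 and d^(q^n+1) = 1; as G₀ is cyclic, they hold for δ₁ and δ₂ values of d. It remains to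
count, over a given d, the elements that do have fixed points. Raising g to the power #K leaves d
unchanged and normalizes b, c: it yields exactly one [1, 0, 0, d] over each d with d^m = 1
(`exists_semisimple_of_one`), and #G₂ elements with fixed points over each d with d^m ≠ 1 =
d^(q^n+1) (`exists_isFixing`, `card_isFixing_fiber`). -/

theorem succ_mul_m {q n : ℕ} (hn : Odd n) : (q + 1) * m q n = q ^ n + 1 := by
  have h : q + 1 ∣ q ^ n + 1 := by simpa using hn.nat_add_dvd_pow_add_pow q 1
  rw [m, Nat.mul_div_cancel' h]

theorem m_pos {q n : ℕ} (hn : Odd n) : 0 < m q n := by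
  have := succ_mul_m (q := q) hn
  rcases Nat.eq_zero_or_pos (m q n) with h | h
  · simp [h] at this
  · exact h

/-- Reduce (q+1)m = q^n + 1 modulo q. The congruence m ≡ 1 makes m prime to q and equal to 1 in K.
-/
theorem exists_m_eq {q n : ℕ} (hq : 1 < q) (hn : Odd n) :
    ∃ M, m q n = q * M + 1 ∧ (q + 1) * M + 1 = q ^ (n - 1) := by
  have h := succ_mul_m (q := q) hn
  obtain ⟨k, rfl⟩ : ∃ k, n = k + 1 := ⟨n - 1, by have := hn.pos; omega⟩
  have hpos := m_pos (q := q) hn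
  obtain ⟨r, hr⟩ : ∃ r, m q (k + 1) = r + 1 := ⟨m q (k + 1) - 1, by omega⟩
  have h1 : (q + 1) * r + q = q * q ^ k := by
    rw [hr, pow_succ] at h; linarith
  have hdvd : q ∣ r := by
    have : q ∣ (q + 1) * r + q := ⟨_, h1⟩
    rw [Nat.dvd_add_left dvd_rfl] at this
    exact (Nat.Coprime.dvd_mul_left (by simp)).1 this
  obtain ⟨M, rfl⟩ := hdvd
  refine ⟨M, hr, ?_⟩
  rw [Nat.add_sub_cancel]
  have hq0 : 0 < q := by omega
  refine Nat.eq_of_mul_eq_mul_left hq0 ?_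
  linarith

theorem coprime_m {q n : ℕ} (hq : 1 < q) (hn : Odd n) : Nat.Coprime q (m q n) := by
  obtain ⟨M, hM, -⟩ := exists_m_eq hq hn
  rw [hM]
  simp

/-- The exponents `(i, j, k)` of the monomials `z ^ i * y ^ j * x ^ k` in normal form. -/
abbrev Idx (q : ℕ) : Type := ℕ × Fin (q ^ 2) × Fin q

/-- The pole order at `Q_∞` of the monomial `z ^ i * y ^ j * x ^ k`. -/
def wt (q n i j k : ℕ) : ℕ := i * q ^ 3 + j * (q * m q n) + k * ((q + 1) * m q n)

/-- Modulo q the weight is k, because (q+1)m ≡ 1. After removing k and dividing by q, the residue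
modulo q² determines j, because m is prime to q; then i is determined. -/
theorem wt_injective {q n : ℕ} (hq : 1 < q) (hn : Odd n) :
    Function.Injective fun s : Idx q => wt q n s.1 s.2.1 s.2.2 := by
  rintro ⟨i, j, k⟩ ⟨i', j', k'⟩ h
  obtain ⟨M, hM, -⟩ := exists_m_eq hq hn
  have hco := coprime_m hq hn
  have hq0 : 0 < q := by omega
  simp only [wt] at h
  have hk : (k : ℕ) = k' := by
    have h1 : (k : ℕ) ≡ k' [MOD q] := by
      have e : ∀ a b c : ℕ, a * q ^ 3 + b * (q * m q n) + c * ((q + 1) * m q n) =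
          c + q * (a * q ^ 2 + b * m q n + c * (m q n + M)) := by
        intro a b c; rw [hM]; ring
      rw [e, e] at h
      have h2 := congrArg (· % q) h
      simpa [Nat.ModEq] using h2
    exact Nat.ModEq.eq_of_lt_of_lt h1 k.2 k'.2
  rw [hk] at h
  have h2 : i * q ^ 2 + j * m q n = i' * q ^ 2 + j' * m q n := by
    refine Nat.eq_of_mul_eq_mul_left hq0 ?_
    have := Nat.add_right_cancel h
    linarith
  have hj : (j : ℕ) = j' := by
    have h3 : (j : ℕ) * m q n ≡ j' * m q n [MOD q ^ 2] := by
      have h2 := congrArg (· % (q ^ 2)) h2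
      simpa [Nat.ModEq] using h2
    exact Nat.ModEq.eq_of_lt_of_lt
      (Nat.ModEq.cancel_right_of_coprime (hco.pow_left 2) h3) j.2 j'.2
  rw [hj] at h2
  have hi : i = i' := Nat.eq_of_mul_eq_mul_right (pow_pos hq0 2) (Nat.add_right_cancel h2)
  exact Prod.ext hi (Prod.ext (Fin.ext hj) (Fin.ext hk))

/-! ### Normal forms in K[x, y, z] and its presentation -/

section Monomials

variable {K B : Type*} [Field K] [CommRing B] [Algebra K B]

/-- The monomial `z ^ i * y ^ j * x ^ k`. -/
def mono {q : ℕ} (x y z : B) (s : Idx q) : B := z ^ s.1 * y ^ (s.2.1 : ℕ) * x ^ (s.2.2 : ℕ)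

/-- The ring `K[x, y, z]`. -/
abbrev coordRing (K : Type*) {B : Type*} [Field K] [CommRing B] [Algebra K B] (x y z : B) :
    Subalgebra K B := Algebra.adjoin K {x, y, z}

theorem x_mem (x y z : B) : x ∈ coordRing K x y z := Algebra.subset_adjoin (by simp)
theorem y_mem (x y z : B) : y ∈ coordRing K x y z := Algebra.subset_adjoin (by simp)
theorem z_mem (x y z : B) : z ∈ coordRing K x y z := Algebra.subset_adjoin (by simp)

theorem map_mono {B' : Type*} [CommRing B'] [Algebra K B'] {q : ℕ} (f : B →ₐ[K] B') (x y z : B)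
    (s : Idx q) : f (mono x y z s) = mono (f x) (f y) (f z) s := by
  simp only [mono, map_mul, map_pow]

/-- The monomials in normal form span `K[x, y, z]`. -/
theorem coordRing_le_span {q N : ℕ} (hq : 1 < q) {x y z : B} (hxy : x ^ q + x = y ^ (q + 1))
    (hyz : z ^ N = y ^ (q ^ 2) - y) {r : B} (hr : r ∈ coordRing K x y z) :
    r ∈ Submodule.span K (Set.range (mono (q := q) x y z)) := by
  set S := Submodule.span K (Set.range (mono (q := q) x y z))
  have hq2 : 1 < q ^ 2 := Nat.one_lt_pow two_ne_zero hq
  have key : ∀ u : B, (∀ s : Idx q, u * mono x y z s ∈ S) → ∀ s ∈ S, u * s ∈ S := by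
    intro u hu s hs
    induction hs using Submodule.span_induction with
    | mem w hw => obtain ⟨t, rfl⟩ := hw; exact hu t
    | zero => simp
    | add a b _ _ ha hb => rw [mul_add]; exact add_mem ha hb
    | smul c a _ ha => rw [mul_smul_comm]; exact S.smul_mem c ha
  have hmono : ∀ (i j k : ℕ) (hj : j < q ^ 2) (hk : k < q), z ^ i * y ^ j * x ^ k ∈ S :=
    fun i j k hj hk => Submodule.subset_span ⟨(i, ⟨j, hj⟩, ⟨k, hk⟩), rfl⟩
  have hz : ∀ s ∈ S, z * s ∈ S := by
    refine key z ?_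
    rintro ⟨i, j, k⟩
    have : z * mono x y z (i, j, k) = z ^ (i + 1) * y ^ (j : ℕ) * x ^ (k : ℕ) := by
      simp only [mono]; ring
    rw [this]
    exact hmono _ _ _ j.2 k.2
  have hy : ∀ s ∈ S, y * s ∈ S := by
    refine key y ?_
    rintro ⟨i, j, k⟩
    have e : y * mono x y z (i, j, k) = z ^ i * y ^ ((j : ℕ) + 1) * x ^ (k : ℕ) := by
      simp only [mono]; ring
    rw [e]
    by_cases hj : (j : ℕ) + 1 < q ^ 2
    · exact hmono _ _ _ hj k.2
    · have hj' : (j : ℕ) + 1 = q ^ 2 := by have := j.2; omega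
      have : z ^ i * y ^ ((j : ℕ) + 1) * x ^ (k : ℕ) =
          z ^ i * y ^ 1 * x ^ (k : ℕ) + z ^ (i + N) * y ^ 0 * x ^ (k : ℕ) := by
        rw [hj', pow_add, hyz]; ring
      rw [this]
      exact add_mem (hmono _ _ _ hq2 k.2) (hmono _ _ _ (by omega) k.2)
  have hyp : ∀ (t : ℕ), ∀ s ∈ S, y ^ t * s ∈ S := by
    intro t
    induction t with
    | zero => intro s hs; simpa using hs
    | succ t ih => intro s hs; rw [pow_succ, mul_assoc]; exact ih _ (hy s hs)
  have hx : ∀ s ∈ S, x * s ∈ S := by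
    refine key x ?_
    rintro ⟨i, j, k⟩
    have e : x * mono x y z (i, j, k) = z ^ i * y ^ (j : ℕ) * x ^ ((k : ℕ) + 1) := by
      simp only [mono]; ring
    rw [e]
    by_cases hk : (k : ℕ) + 1 < q
    · exact hmono _ _ _ j.2 hk
    · have hk' : (k : ℕ) + 1 = q := by have := k.2; omega
      have : z ^ i * y ^ (j : ℕ) * x ^ ((k : ℕ) + 1) =
          y ^ (q + 1) * (z ^ i * y ^ (j : ℕ) * x ^ 0) - z ^ i * y ^ (j : ℕ) * x ^ 1 := by
        rw [hk', ← hxy]; ring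
      rw [this]
      exact sub_mem (hyp _ _ (hmono _ _ _ j.2 (by omega))) (hmono _ _ _ j.2 hq)
  have hmul : ∀ s ∈ S, r * s ∈ S := by
    induction hr using Algebra.adjoin_induction with
    | mem w hw =>
      rcases hw with rfl | rfl | rfl
      exacts [hx, hy, hz]
    | algebraMap c => intro s hs; rw [← Algebra.smul_def]; exact S.smul_mem c hs
    | add a b _ _ ha hb => intro s hs; rw [add_mul]; exact add_mem (ha s hs) (hb s hs)
    | mul a b _ _ ha hb => intro s hs; rw [mul_assoc]; exact ha _ (hb s hs)
  have h1 : (1 : B) ∈ S := by simpa using hmono 0 0 0 (by omega) (by omega)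
  simpa using hmul 1 h1

/-- If the monomials in normal form in `x, y, z` are linearly independent, then every solution
`(x', y', z')` of the defining equations gives a homomorphism from `K[x, y, z]`. -/
theorem exists_algHom_coordRing {B' : Type*} [CommRing B'] [Algebra K B'] {q N : ℕ} (hq : 1 < q)
    {x y z : B} (hxy : x ^ q + x = y ^ (q + 1)) (hyz : z ^ N = y ^ (q ^ 2) - y)
    (hli : LinearIndependent K (mono (q := q) x y z))
    {x' y' z' : B'} (hxy' : x' ^ q + x' = y' ^ (q + 1)) (hyz' : z' ^ N = y' ^ (q ^ 2) - y') :
    ∃ φ : coordRing K x y z →ₐ[K] B', φ ⟨x, x_mem x y z⟩ = x' ∧ φ ⟨y, y_mem x y z⟩ = y' ∧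
      φ ⟨z, z_mem x y z⟩ = z' := by
  -- The homomorphism is obtained from its graph, the subalgebra of B × B' generated by the pairs of
  -- generators. The pairs satisfy the same two equations, so normal forms span this subalgebra, and
  -- independence of the first components makes the first projection injective.
  have hmap : (coordRing K (x, x') (y, y') (z, z')).map (AlgHom.fst K B B') =
      coordRing K x y z := by
    simp only [coordRing, AlgHom.map_adjoin, Set.image_insert_eq, Set.image_singleton,
      AlgHom.fst_apply]
  have hmem : ∀ s : coordRing K (x, x') (y, y') (z, z'),
      ((AlgHom.fst K B B').comp (Subalgebra.val _)) s ∈ coordRing K x y z := by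
    intro s
    rw [← hmap]
    exact Subalgebra.mem_map.2 ⟨s, s.2, by simp⟩
  obtain ⟨π, hπ⟩ : ∃ π : coordRing K (x, x') (y, y') (z, z') →ₐ[K] coordRing K x y z,
      ∀ s, (π s : B) = (s : B × B').1 :=
    ⟨((AlgHom.fst K B B').comp (Subalgebra.val _)).codRestrict _ hmem, fun s => by
      simp only [AlgHom.coe_codRestrict, AlgHom.comp_apply, Subalgebra.val_apply,
        AlgHom.fst_apply]⟩
  have hinj : Function.Injective π := by
    rw [injective_iff_map_eq_zero]
    rintro ⟨s, hs⟩ h0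
    have h0' : s.1 = 0 := by rw [← hπ ⟨s, hs⟩, h0]; simp only [ZeroMemClass.coe_zero]
    have hs' := coordRing_le_span (N := N) hq
      (by simp only [Prod.pow_mk, Prod.mk_add_mk, hxy, hxy'])
      (by simp only [Prod.pow_mk, Prod.mk_sub_mk, hyz, hyz']) hs
    rw [Finsupp.mem_span_range_iff_exists_finsupp] at hs'
    obtain ⟨c, hcs⟩ := hs'
    have hc : Finsupp.linearCombination K (mono (q := q) x y z) c = 0 := by
      rw [← h0', ← hcs, ← AlgHom.fst_apply (R := K), map_finsuppSum,
        Finsupp.linearCombination_apply]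
      simp only [map_smul, map_mono, AlgHom.fst_apply]
    have hc0 : c = 0 := (linearIndependent_iff.1 hli) c hc
    have hs0 : s = 0 := by rw [← hcs, hc0, Finsupp.sum_zero_index]
    exact Subtype.ext hs0
  have hsurj : Function.Surjective π := by
    rintro ⟨r, hr⟩
    have hr' := hr
    rw [← hmap] at hr'
    obtain ⟨s, hs, hsr⟩ := Subalgebra.mem_map.1 hr'
    exact ⟨⟨s, hs⟩, Subtype.ext ((hπ _).trans (by simpa using hsr))⟩
  obtain ⟨e, he⟩ : ∃ e : coordRing K (x, x') (y, y') (z, z') ≃ₐ[K] coordRing K x y z,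
      ∀ s, e s = π s := ⟨AlgEquiv.ofBijective π ⟨hinj, hsurj⟩, fun s => rfl⟩
  have hsymm : ∀ (r : coordRing K x y z) (s : coordRing K (x, x') (y, y') (z, z')),
      (s : B × B').1 = r → e.symm r = s := by
    intro r s hrs
    rw [AlgEquiv.symm_apply_eq, he]
    exact Subtype.ext (hrs.symm.trans (hπ s).symm)
  refine ⟨((AlgHom.snd K B B').comp (Subalgebra.val _)).comp e.symm.toAlgHom, ?_, ?_, ?_⟩
  · simp [hsymm ⟨x, x_mem x y z⟩ ⟨(x, x'), x_mem _ _ _⟩ rfl]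
  · simp [hsymm ⟨y, y_mem x y z⟩ ⟨(y, y'), y_mem _ _ _⟩ rfl]
  · simp [hsymm ⟨z, z_mem x y z⟩ ⟨(z, z'), z_mem _ _ _⟩ rfl]

end Monomials

end GGK

/-! ### The pole of z: valuations, uniformizer and uniqueness -/

namespace GGK

variable {K F : Type*} [Field K] [Field F] [Algebra K F]

theorem _root_.IsGGK.one_lt {q n : ℕ} {x y z : F} (hF : IsGGK q n K x y z) : 1 < q :=
  hF.isPrimePow.one_lt

theorem _root_.IsGGK.finite {q n : ℕ} {x y z : F} (hF : IsGGK q n K x y z) : Finite K := by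
  refine Nat.finite_of_card_ne_zero ?_
  rw [hF.card_eq]
  exact pow_ne_zero _ (by have := hF.one_lt; omega)

theorem _root_.IsGGK.exists_charP {q n : ℕ} {x y z : F} (hF : IsGGK q n K x y z) :
    ∃ p k : ℕ, p.Prime ∧ 0 < k ∧ q = p ^ k ∧ CharP K p ∧ CharP F p := by
  obtain ⟨p, k, hp, hk, hq⟩ := hF.isPrimePow
  have hp' := hp.nat_prime
  have : Fact p.Prime := ⟨hp'⟩
  have := hF.finite
  have := Fintype.ofFinite K
  have hcard : Fintype.card K = p ^ (k * (2 * n)) := by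
    rw [← Nat.card_eq_fintype_card, hF.card_eq, ← hq, pow_mul p k]
  have : CharP K p := charP_of_card_eq_prime_pow hcard
  exact ⟨p, k, hp', hk, hq.symm, this, charP_of_injective_algebraMap (algebraMap K F).injective p⟩

theorem valuation_algebraMap_le {P : ValuationSubring F} (hP : IsPlace K P) (c : K) :
    P.valuation (algebraMap K F c) ≤ 1 :=
  (P.valuation_le_one_iff _).2 (hP.1 c)

theorem valuation_algebraMap {P : ValuationSubring F} (hP : IsPlace K P) {c : K} (hc : c ≠ 0) :
    P.valuation (algebraMap K F c) = 1 := by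
  refine le_antisymm (valuation_algebraMap_le hP c) ?_
  have h := valuation_algebraMap_le hP c⁻¹
  rw [map_inv₀, map_inv₀] at h
  have h0 : P.valuation (algebraMap K F c) ≠ 0 := by simpa using hc
  exact (inv_le_one₀ (zero_lt_iff.2 h0)).1 h

/-- At a pole of `z`, the values of `x`, `y`, `z` are powers of the inverse value of `τ`. -/
theorem exists_delta {q n : ℕ} {x y z : F} (hF : IsGGK q n K x y z)
    {P : ValuationSubring F} (hz : z ∉ P) :
    ∃ δ : P.ValueGroup, 1 < δ ∧ P.valuation (tau q n x y z) = δ⁻¹ ∧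
      P.valuation y = δ ^ (q * m q n) ∧ P.valuation x = δ ^ ((q + 1) * m q n) ∧
      P.valuation z = δ ^ (q ^ 3) := by
  set v := P.valuation
  have hq := hF.one_lt
  have hm := m_pos (q := q) hF.odd
  have hmq := succ_mul_m (q := q) hF.odd
  have hpow : ∀ {a b : P.ValueGroup} {k : ℕ}, k ≠ 0 → a ^ k = b ^ k → a = b :=
    fun hk h => (pow_left_inj₀ zero_le zero_le hk).1 h
  have hvz : 1 < v z := by
    by_contra h
    exact hz ((P.valuation_le_one_iff z).1 (not_lt.1 h))
  have hkum : v z ^ m q n = v (y ^ q ^ 2 - y) := by rw [← hF.kummer, map_pow]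
  have hvy : 1 < v y := by
    by_contra h
    rw [not_lt] at h
    have : v (y ^ q ^ 2 - y) ≤ 1 :=
      v.map_sub_le (by rw [map_pow]; exact pow_le_one₀ zero_le h) h
    exact absurd (hkum ▸ this) (not_le.2 (one_lt_pow₀ hvz hm.ne'))
  have hvzy : v z ^ m q n = v y ^ q ^ 2 := by
    rw [hkum, v.map_sub_eq_of_lt_left, map_pow]
    rw [map_pow]
    exact lt_self_pow₀ hvy (Nat.one_lt_pow two_ne_zero hq)
  have hher : v y ^ (q + 1) = v (x ^ q + x) := by rw [hF.hermitian, map_pow]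
  have hvx : 1 < v x := by
    by_contra h
    rw [not_lt] at h
    have : v (x ^ q + x) ≤ 1 :=
      v.map_add_le (by rw [map_pow]; exact pow_le_one₀ zero_le h) h
    exact absurd (hher ▸ this) (not_le.2 (one_lt_pow₀ hvy (by omega)))
  have hvxy : v x ^ q = v y ^ (q + 1) := by
    rw [hher, v.map_add_eq_of_lt_left, map_pow]
    rw [map_pow]
    exact lt_self_pow₀ hvx hq
  have hy0 : v y ≠ 0 := (zero_lt_one.trans hvy).ne'
  have hx0 : v x ≠ 0 := (zero_lt_one.trans hvx).ne'
  have hz0 : v z ≠ 0 := (zero_lt_one.trans hvz).ne'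
  -- Since v(x)^q = v(y)^(q+1), this quotient satisfies v(y) = γ^q and v(x) = γ^(q+1).
  obtain ⟨γ, hγ⟩ : ∃ γ, γ = v x / v y := ⟨_, rfl⟩
  have hγy : v y = γ ^ q := by
    rw [hγ, div_pow, hvxy, pow_succ, mul_div_cancel_left₀ _ (pow_ne_zero _ hy0)]
  have hγx : v x = γ ^ (q + 1) := by
    rw [pow_succ, ← hγy, hγ, mul_div_cancel₀ _ hy0]
  have hγ0 : γ ≠ 0 := by rw [hγ]; exact div_ne_zero hx0 hy0
  have hγz : v z ^ m q n = γ ^ q ^ 3 := by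
    rw [hvzy, hγy, ← pow_mul]; congr 1; ring
  -- For n ≥ 3 the m-th powers of v(z^(q^(n-3))) and v(x) are γ^(q^n) and γ^(q^n+1), so 1/τ supplies
  -- an m-th root of γ.
  have hδ : ((v (tau q n x y z))⁻¹) ^ m q n = γ := by
    by_cases hn : n = 1
    · subst hn
      have : m q 1 = 1 := by simp [m]
      rw [this, tau, if_pos rfl, map_div₀, pow_one, inv_div, hγ]
    · have hn3 : n - 3 + 3 = n := by
        have := hF.odd
        rcases this with ⟨k, rfl⟩
        omega
      have e : (v z ^ q ^ (n - 3)) ^ m q n = γ ^ (q ^ n) := by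
        rw [← pow_mul, mul_comm, pow_mul, hγz, ← pow_mul, ← pow_add, add_comm 3, hn3]
      rw [tau, if_neg hn, map_div₀, inv_div, map_pow, div_pow, e, hγx, ← pow_mul, hmq, pow_succ,
        mul_div_cancel_left₀ _ (pow_ne_zero _ hγ0)]
  refine ⟨(v (tau q n x y z))⁻¹, ?_, (inv_inv _).symm, ?_, ?_, ?_⟩
  · by_contra h
    rw [not_lt] at h
    have h1 : γ ≤ 1 := hδ ▸ pow_le_one₀ zero_le h
    exact absurd (hγy ▸ pow_le_one₀ zero_le h1) (not_le.2 hvy)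
  · rw [mul_comm, pow_mul, hδ, hγy]
  · rw [mul_comm, pow_mul, hδ, hγx]
  · refine hpow hm.ne' ?_
    rw [hγz, ← pow_mul, mul_comm, pow_mul, hδ]

section Infinity

variable {q n : ℕ} {x y z : F} {P : ValuationSubring F} {δ : P.ValueGroup}

theorem valuation_mono (hy : P.valuation y = δ ^ (q * m q n))
    (hx : P.valuation x = δ ^ ((q + 1) * m q n)) (hz : P.valuation z = δ ^ (q ^ 3)) (s : Idx q) :
    P.valuation (mono x y z s) = δ ^ wt q n s.1 s.2.1 s.2.2 := by
  rw [mono, map_mul, map_mul, map_pow, map_pow, map_pow, hx, hy, hz, ← pow_mul, ← pow_mul,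
    ← pow_mul, ← pow_add, ← pow_add, wt]
  congr 1
  ring

/-- Distinct monomials have distinct weights, so a single term strictly dominates the sum. -/
theorem exists_valuation_linearCombination (hF : IsGGK q n K x y z) (hP : IsPlace K P)
    (hδ : 1 < δ) (hy : P.valuation y = δ ^ (q * m q n))
    (hx : P.valuation x = δ ^ ((q + 1) * m q n)) (hz : P.valuation z = δ ^ (q ^ 3))
    {c : Idx q →₀ K} (hc : c ≠ 0) :
    ∃ t ∈ c.support,
      P.valuation (Finsupp.linearCombination K (mono x y z) c) = δ ^ wt q n t.1 t.2.1 t.2.2 ∧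
      ∀ s ∈ c.support, wt q n s.1 s.2.1 s.2.2 ≤ wt q n t.1 t.2.1 t.2.2 := by
  classical
  obtain ⟨t, ht, hmax⟩ := Finset.exists_max_image c.support (fun s => wt q n s.1 s.2.1 s.2.2)
    (Finsupp.support_nonempty_iff.2 hc)
  refine ⟨t, ht, ?_, hmax⟩
  have hval : ∀ s ∈ c.support, P.valuation (c s • mono x y z s) = δ ^ wt q n s.1 s.2.1 s.2.2 := by
    intro s hs
    rw [Algebra.smul_def, map_mul, valuation_algebraMap hP (Finsupp.mem_support_iff.1 hs), one_mul,
      valuation_mono hy hx hz]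
  rw [Finsupp.linearCombination_apply, Finsupp.sum, Valuation.map_sum_eq_of_lt (j := t) _ ht,
    hval t ht]
  · intro s hs
    rw [Finset.mem_sdiff, Finset.mem_singleton] at hs
    rw [hval s hs.1, hval t ht]
    refine pow_lt_pow_right₀ hδ (lt_of_le_of_ne (hmax s hs.1) fun h => hs.2 ?_)
    exact wt_injective hF.one_lt hF.odd h

theorem exists_linearCombination (hF : IsGGK q n K x y z) {r : F}
    (hr : r ∈ coordRing K x y z) :
    ∃ c : Idx q →₀ K, Finsupp.linearCombination K (mono x y z) c = r := by
  have := coordRing_le_span hF.one_lt hF.hermitian hF.kummer hr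
  rw [Finsupp.mem_span_range_iff_exists_finsupp] at this
  exact this

theorem linearIndependent_mono (hF : IsGGK q n K x y z) (hP : IsPlace K P) (hz : z ∉ P) :
    LinearIndependent K (mono (q := q) x y z) := by
  obtain ⟨δ, hδ, -, hvy, hvx, hvz⟩ := exists_delta hF hz
  rw [linearIndependent_iff]
  intro c hc
  by_contra h0
  obtain ⟨t, -, ht, -⟩ := exists_valuation_linearCombination hF hP hδ hvy hvx hvz h0
  rw [hc, map_zero] at ht
  exact pow_ne_zero _ (zero_lt_one.trans hδ).ne' ht.symm

theorem exists_eq_div (hF : IsGGK q n K x y z) (f : F) :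
    ∃ a ∈ coordRing K x y z, ∃ b ∈ coordRing K x y z, f = a / b := by
  have : f ∈ IntermediateField.adjoin K {x, y, z} := by rw [hF.adjoin_eq_top]; trivial
  obtain ⟨a, ha, b, hb, h⟩ := IntermediateField.mem_adjoin_iff_div.1 this
  exact ⟨a, ha, b, hb, h⟩

/-- The value at a pole of `z` of a nonzero function is a power of the value of `τ`, with an
exponent that does not depend on the pole. -/
theorem exists_valuation_eq_zpow (hF : IsGGK q n K x y z) {f : F} (hf : f ≠ 0)
    {P₀ : ValuationSubring F} (hP₀ : IsPlace K P₀) (hz₀ : z ∉ P₀) :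
    ∃ k : ℤ, ∀ P : ValuationSubring F, IsPlace K P → z ∉ P →
      P.valuation f = P.valuation (tau q n x y z) ^ k := by
  have hli := linearIndependent_mono hF hP₀ hz₀
  -- The exponent is the maximal weight in the support of the normal form of r, which does not
  -- involve P.
  have key : ∀ r ∈ coordRing K x y z, r ≠ 0 → ∃ k : ℕ, ∀ P : ValuationSubring F, IsPlace K P →
      z ∉ P → P.valuation r = (P.valuation (tau q n x y z))⁻¹ ^ k := by
    intro r hr hr0
    obtain ⟨c, hc⟩ := exists_linearCombination hF hr
    have hc0 : c ≠ 0 := by rintro rfl; exact hr0 (by rw [← hc, map_zero])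
    obtain ⟨t, ht, hmax⟩ := Finset.exists_max_image c.support
      (fun s => wt q n s.1 s.2.1 s.2.2) (Finsupp.support_nonempty_iff.2 hc0)
    refine ⟨wt q n t.1 t.2.1 t.2.2, fun P hP hz => ?_⟩
    obtain ⟨δ, hδ, hτ, hvy, hvx, hvz⟩ := exists_delta hF hz
    obtain ⟨t', ht', hv, hmax'⟩ := exists_valuation_linearCombination hF hP hδ hvy hvx hvz hc0
    rw [← hc, hv, hτ, inv_inv, le_antisymm (hmax t' ht') (hmax' t ht)]
  obtain ⟨a, ha, b, hb, rfl⟩ := exists_eq_div hF f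
  obtain ⟨k, hk⟩ := key a ha (by rintro rfl; simp at hf)
  obtain ⟨l, hl⟩ := key b hb (by rintro rfl; simp at hf)
  refine ⟨l - k, fun P hP hz => ?_⟩
  have h0 : P.valuation (tau q n x y z) ≠ 0 := by
    obtain ⟨δ, hδ, hτ, -⟩ := exists_delta hF hz
    rw [hτ]
    exact inv_ne_zero (zero_lt_one.trans hδ).ne'
  rw [map_div₀, hk P hP hz, hl P hP hz, zpow_sub₀ h0, inv_pow, inv_pow, zpow_natCast, zpow_natCast]
  field_simp

theorem valuation_tau_lt_one (hF : IsGGK q n K x y z) (hz : z ∉ P) :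
    0 < P.valuation (tau q n x y z) ∧ P.valuation (tau q n x y z) < 1 := by
  obtain ⟨δ, hδ, hτ, -⟩ := exists_delta hF hz
  have h0 := zero_lt_one.trans hδ
  rw [hτ]
  exact ⟨inv_pos.2 h0, (inv_lt_one₀ h0).2 hδ⟩

theorem isUniformizer_tau (hF : IsGGK q n K x y z) (hP : IsPlace K P) (hz : z ∉ P) :
    IsUniformizer P (tau q n x y z) := by
  obtain ⟨h0, h1⟩ := valuation_tau_lt_one hF hz
  refine ⟨fun h => by simp [h] at h0, h1, fun s hs => ?_⟩
  by_cases hs0 : s = 0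
  · simp [hs0]
  obtain ⟨k, hk⟩ := exists_valuation_eq_zpow hF hs0 hP hz
  rw [hk P hP hz] at hs ⊢
  have hk0 : 0 < k := by
    by_contra h
    exact absurd hs (not_lt.2 (one_le_zpow_of_nonpos₀ h0 h1.le (not_lt.1 h)))
  calc _ ≤ P.valuation (tau q n x y z) ^ (1 : ℤ) := zpow_le_zpow_right_of_le_one₀ h0 h1.le hk0
    _ = _ := zpow_one _

/-- Membership of f in the valuation ring depends only on the sign of an exponent that is the same
for all poles of z. -/
theorem eq_of_notMem (hF : IsGGK q n K x y z) {P P' : ValuationSubring F} (hP : IsPlace K P)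
    (hz : z ∉ P) (hP' : IsPlace K P') (hz' : z ∉ P') : P = P' := by
  ext f
  by_cases hf : f = 0
  · simp [hf]
  obtain ⟨k, hk⟩ := exists_valuation_eq_zpow hF hf hP hz
  have key : ∀ P : ValuationSubring F, IsPlace K P → z ∉ P → (f ∈ P ↔ 0 ≤ k) := by
    intro P hP hz
    obtain ⟨h0, h1⟩ := valuation_tau_lt_one hF hz
    rw [← P.valuation_le_one_iff, hk P hP hz]
    constructor
    · intro h
      by_contra hk0
      exact absurd h (not_le.2 (one_lt_zpow_of_neg₀ h0 h1 (not_le.1 hk0)))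
    · exact fun h => zpow_le_one₀ h0 h1.le h
  rw [key P hP hz, key P' hP' hz']

end Infinity

end GGK

/-! ### Integral closedness of K[x, y, z] by a Frobenius argument -/

namespace GGK

section Frobenius

variable {A : Type*} [CommRing A]

/-- `r` lies in the span of `1, z, …, z ^ (p - 1)` over the ring of `p`-th powers. -/
def IsFrobSum (p : ℕ) (z r : A) : Prop := ∃ h : ℕ → A, r = ∑ i ∈ Finset.range p, h i ^ p * z ^ i

theorem IsFrobSum.add {p : ℕ} [ExpChar A p] {z r s : A} (hr : IsFrobSum p z r)
    (hs : IsFrobSum p z s) : IsFrobSum p z (r + s) := by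
  obtain ⟨h, rfl⟩ := hr
  obtain ⟨h', rfl⟩ := hs
  refine ⟨fun i => h i + h' i, ?_⟩
  rw [← Finset.sum_add_distrib]
  exact Finset.sum_congr rfl fun i _ => by rw [add_pow_expChar]; ring

theorem isFrobSum_pow {p : ℕ} (hp : 0 < p) (z a : A) : IsFrobSum p z (a ^ p) := by
  refine ⟨fun i => if i = 0 then a else 0, ?_⟩
  rw [Finset.sum_eq_single_of_mem 0 (Finset.mem_range.2 hp)]
  · simp
  · intro i _ hi
    simp [hi, hp.ne']

theorem IsFrobSum.pow_mul {p : ℕ} {z r : A} (hr : IsFrobSum p z r) (a : A) :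
    IsFrobSum p z (a ^ p * r) := by
  obtain ⟨h, rfl⟩ := hr
  refine ⟨fun i => a * h i, ?_⟩
  rw [Finset.mul_sum]
  exact Finset.sum_congr rfl fun i _ => by ring

theorem IsFrobSum.self_mul {p : ℕ} (hp : 0 < p) {z r : A} (hr : IsFrobSum p z r) :
    IsFrobSum p z (z * r) := by
  obtain ⟨h, rfl⟩ := hr
  obtain ⟨k, rfl⟩ : ∃ k, p = k + 1 := ⟨p - 1, by omega⟩
  refine ⟨fun i => if i = 0 then h k * z else h (i - 1), ?_⟩
  rw [Finset.sum_range_succ, Finset.sum_range_succ', mul_add, Finset.mul_sum]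
  congr 1
  · exact Finset.sum_congr rfl fun i _ => by simp; ring
  · simp; ring

theorem IsFrobSum.mul {p : ℕ} (hp : 0 < p) [ExpChar A p] {z r s : A} (hr : IsFrobSum p z r)
    (hs : IsFrobSum p z s) : IsFrobSum p z (r * s) := by
  obtain ⟨h, rfl⟩ := hr
  rw [Finset.sum_mul]
  have hzero : IsFrobSum p z (0 : A) := by simpa [hp.ne'] using isFrobSum_pow hp z (0 : A)
  refine Finset.sum_induction _ (IsFrobSum p z) (fun _ _ => IsFrobSum.add) hzero ?_
  intro i hi
  rw [mul_assoc]
  refine IsFrobSum.pow_mul ?_ _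
  clear hi
  induction i with
  | zero => simpa using hs
  | succ i ih => rw [pow_succ', mul_assoc]; exact ih.self_mul hp

theorem isFrobSum_self {p : ℕ} (hp : 0 < p) (z : A) : IsFrobSum p z z := by
  simpa using (isFrobSum_pow hp z (1 : A)).self_mul hp

-- A finite field is perfect, so constants are p-th powers and exponents can be split modulo p.
open Polynomial in
theorem isFrobSum_X {K : Type*} [Field K] [Finite K] {p : ℕ} (hp : p.Prime) [CharP K p]
    (D : K[X]) : IsFrobSum p X D := by
  have : Fact p.Prime := ⟨hp⟩
  have hC : ∀ c : K, IsFrobSum p X (C c) := by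
    intro c
    obtain ⟨c', rfl⟩ := surjective_frobenius K p c
    rw [frobenius_def, C_pow]
    exact isFrobSum_pow hp.pos X _
  induction D using Polynomial.induction_on with
  | C c => exact hC c
  | add r s hr hs => exact hr.add hs
  | monomial i c h => rw [pow_succ, ← mul_assoc]; exact h.mul hp.pos (isFrobSum_self hp.pos X)

open Polynomial in
/-- If `z` is not a `p`-th power in a field of characteristic `p`, then `1, z, …, z ^ (p - 1)`
are linearly independent over the subfield of `p`-th powers. -/
theorem eq_zero_of_frobSum_eq_zero {F : Type*} [Field F] {p : ℕ} (hp : p.Prime) [CharP F p]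
    {z : F} (hz : ∀ w : F, w ^ p ≠ z) {h : ℕ → F}
    (h0 : ∑ i ∈ Finset.range p, h i ^ p * z ^ i = 0) {i : ℕ} (hi : i < p) : h i = 0 := by
  have : Fact p.Prime := ⟨hp⟩
  let E := (frobenius F p).fieldRange
  let zp : E := ⟨z ^ p, z, rfl⟩
  have hirr : Irreducible (X ^ p - C zp : E[X]) := by
    refine X_pow_sub_C_irreducible_of_prime hp ?_
    rintro ⟨_, w, rfl⟩ hw
    have hw' : (frobenius F p w) ^ p = z ^ p := congrArg Subtype.val hw
    exact hz w (frobenius_inj F p hw')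
  have hroot : aeval z (X ^ p - C zp : E[X]) = 0 := by
    simp only [map_sub, map_pow, aeval_X, aeval_C]
    exact sub_self _
  have hmin := minpoly.eq_of_irreducible_of_monic hirr hroot (monic_X_pow_sub_C zp hp.ne_zero)
  let κ : ℕ → E := fun i => ⟨frobenius F p (h i), h i, rfl⟩
  let Q : E[X] := ∑ i ∈ Finset.range p, C (κ i) * X ^ i
  have hQ0 : aeval z Q = 0 := by
    simp only [Q, map_sum, map_mul, map_pow, aeval_X, aeval_C]
    exact h0
  have hQ : Q = 0 := by
    by_contra hne
    have h1 := minpoly.degree_le_of_ne_zero E z hne hQ0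
    rw [← hmin, degree_X_pow_sub_C hp.pos] at h1
    have h2 : Q.degree < p := by
      refine (degree_sum_le _ _).trans_lt ((Finset.sup_lt_iff (WithBot.bot_lt_coe p)).2 ?_)
      intro j hj
      exact lt_of_le_of_lt (degree_C_mul_X_pow_le _ _) (Nat.cast_lt.2 (Finset.mem_range.1 hj))
    exact absurd h1 (not_le.2 h2)
  have hc : Q.coeff i = κ i := by
    simp [Q, hi]
  rw [hQ, coeff_zero] at hc
  exact pow_eq_zero_iff hp.ne_zero |>.1 (congrArg Subtype.val hc).symm

end Frobenius

open Polynomial in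
theorem isIntegral_of_pow_add_mul {A B : Type*} [CommRing A] [CommRing B] [Algebra A B]
    {t e u : B} (he : IsIntegral A e) (hu : IsIntegral A u) {N : ℕ} (hN : 1 < N)
    (h : t ^ N + e * t = u) : IsIntegral A t := by
  rcases subsingleton_or_nontrivial B with hB | hB
  · rw [Subsingleton.elim t 0]; exact isIntegral_zero
  let e' : integralClosure A B := ⟨e, he⟩
  let u' : integralClosure A B := ⟨u, hu⟩
  have hm : (X ^ N + (C e' * X - C u')).Monic := by
    refine monic_X_pow_add ?_
    refine (degree_sub_le _ _).trans_lt ?_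
    have h1 : (1 : WithBot ℕ) < N := by exact_mod_cast hN
    refine max_lt ((degree_C_mul_X_le _).trans_lt h1) (degree_C_le.trans_lt ?_)
    exact zero_lt_one.trans h1
  have : IsIntegral (integralClosure A B) t := by
    refine ⟨_, hm, ?_⟩
    rw [← aeval_def]
    simp only [map_add, map_sub, map_mul, map_pow, aeval_X, aeval_C]
    change t ^ N + (e * t - u) = 0
    rw [← h]; ring
  exact isIntegral_trans t this

variable {K F : Type*} [Field K] [Field F] [Algebra K F] {q n : ℕ} {x y z : F}

open Polynomial in
/-- `K[x, y, z]` is integral over `K[z]`. -/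
theorem isIntegral_aeval (hF : IsGGK q n K x y z) :
    (aeval (⟨z, z_mem x y z⟩ : coordRing K x y z) : K[X] →ₐ[K] _).toRingHom.IsIntegral := by
  set zR : coordRing K x y z := ⟨z, z_mem x y z⟩
  let _ : Algebra K[X] (coordRing K x y z) := (aeval zR : K[X] →ₐ[K] _).toRingHom.toAlgebra
  have hz : IsIntegral K[X] zR := by
    have : zR = algebraMap K[X] (coordRing K x y z) X := (aeval_X zR).symm
    rw [this]
    exact isIntegral_algebraMap
  have hq := hF.one_lt
  have hy : IsIntegral K[X] (⟨y, y_mem x y z⟩ : coordRing K x y z) := by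
    refine isIntegral_of_pow_add_mul (e := -1) (u := zR ^ m q n) isIntegral_one.neg (hz.pow _)
      (Nat.one_lt_pow two_ne_zero hq) (Subtype.ext ?_)
    simp [zR, hF.kummer, sub_eq_add_neg]
  have hx : IsIntegral K[X] (⟨x, x_mem x y z⟩ : coordRing K x y z) := by
    refine isIntegral_of_pow_add_mul (e := 1) isIntegral_one (hy.pow (q + 1)) hq (Subtype.ext ?_)
    simp [hF.hermitian]
  rintro ⟨r, hr⟩
  change IsIntegral K[X] _
  induction hr using Algebra.adjoin_induction with
  | mem w hw =>
    rcases hw with rfl | rfl | rfl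
    exacts [hx, hy, hz]
  | algebraMap c =>
    have : (⟨algebraMap K F c, Subalgebra.algebraMap_mem _ c⟩ : coordRing K x y z) =
      algebraMap K[X] (coordRing K x y z) (C c) := (aeval_C zR c).symm
    rw [this]
    exact isIntegral_algebraMap
  | add a b _ _ ha hb => exact ha.add hb
  | mul a b _ _ ha hb => exact ha.mul hb

/-- The equations read y = y^(q²) - z^m and x = y^(q+1) - x^q, so both y and x are p-th powers plus
polynomials in elements already treated. This is the form in which the separability of R over K[z]
is used. -/
theorem isFrobSum_coordRing (hF : IsGGK q n K x y z) {p k : ℕ} (hp : p.Prime) (hk : 0 < k)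
    (hq : q = p ^ k) [CharP K p] [CharP F p] (r : coordRing K x y z) :
    IsFrobSum p ⟨z, z_mem x y z⟩ r := by
  have : Fact p.Prime := ⟨hp⟩
  have := hF.finite
  have : CharP (coordRing K x y z) p :=
    charP_of_injective_algebraMap (algebraMap K (coordRing K x y z)).injective p
  set zR : coordRing K x y z := ⟨z, z_mem x y z⟩
  have hpq : q = q / p * p := (Nat.div_mul_cancel (hq ▸ dvd_pow_self p hk.ne')).symm
  have hneg : IsFrobSum p zR (-1) := by
    have := isFrobSum_pow hp.pos zR (-1)
    rwa [← frobenius_def, map_neg, map_one] at this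
  have hpow : ∀ {r : coordRing K x y z} (t : ℕ), IsFrobSum p zR r → IsFrobSum p zR (r ^ t) := by
    intro r t hr
    induction t with
    | zero => simpa using isFrobSum_pow hp.pos zR (1 : coordRing K x y z)
    | succ t ih => rw [pow_succ]; exact ih.mul hp.pos hr
  have hz := isFrobSum_self hp.pos zR
  have hy : IsFrobSum p zR (⟨y, y_mem x y z⟩ : coordRing K x y z) := by
    have e : (⟨y, y_mem x y z⟩ : coordRing K x y z) =
        ((⟨y, y_mem x y z⟩ : coordRing K x y z) ^ (q * (q / p))) ^ p + -1 * zR ^ m q n := by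
      refine Subtype.ext ?_
      have : q * (q / p) * p = q ^ 2 := by rw [mul_assoc, ← hpq, sq]
      simp [zR, hF.kummer, ← pow_mul, this]
    rw [e]
    exact (isFrobSum_pow hp.pos _ _).add (hneg.mul hp.pos (hpow _ hz))
  have hx : IsFrobSum p zR (⟨x, x_mem x y z⟩ : coordRing K x y z) := by
    have e : (⟨x, x_mem x y z⟩ : coordRing K x y z) = (⟨y, y_mem x y z⟩ : coordRing K x y z) ^ (q + 1)
        + -1 * ((⟨x, x_mem x y z⟩ : coordRing K x y z) ^ (q / p)) ^ p := by
      refine Subtype.ext ?_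
      simp [← hF.hermitian, ← pow_mul, ← hpq]
    rw [e]
    exact (hpow _ hy).add (hneg.mul hp.pos (isFrobSum_pow hp.pos _ _))
  obtain ⟨r, hr⟩ := r
  induction hr using Algebra.adjoin_induction with
  | mem w hw =>
    rcases hw with rfl | rfl | rfl
    exacts [hx, hy, hz]
  | algebraMap c =>
    obtain ⟨c', rfl⟩ := surjective_frobenius K p c
    have : (⟨algebraMap K F (frobenius K p c'), Subalgebra.algebraMap_mem _ _⟩ :
      coordRing K x y z) = algebraMap K _ c' ^ p := by
      refine Subtype.ext ?_
      simp [frobenius_def]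
    rw [this]
    exact isFrobSum_pow hp.pos _ _
  | add a b _ _ ha hb => exact ha.add hb
  | mul a b _ _ ha hb => exact ha.mul hp.pos hb

/-- If z were a p-th power, then so would be every element of R and hence every quotient, in
particular the uniformizer τ, which is impossible. -/
theorem pow_ne_z (hF : IsGGK q n K x y z) {p k : ℕ} (hp : p.Prime) (hk : 0 < k) (hq : q = p ^ k)
    [CharP K p] [CharP F p] {P : ValuationSubring F} (hP : IsPlace K P) (hzP : z ∉ P) (w : F) :
    w ^ p ≠ z := by
  have : Fact p.Prime := ⟨hp⟩
  intro hw
  have hR : ∀ r ∈ coordRing K x y z, ∃ s : F, s ^ p = r := by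
    intro r hr
    obtain ⟨h, hh⟩ := isFrobSum_coordRing hF hp hk hq ⟨r, hr⟩
    refine ⟨∑ i ∈ Finset.range p, (h i : F) * w ^ i, ?_⟩
    rw [sum_pow_char]
    have := congrArg Subtype.val hh
    simp only [AddSubmonoidClass.coe_finsetSum, MulMemClass.coe_mul, SubmonoidClass.coe_pow]
      at this
    rw [this]
    refine Finset.sum_congr rfl fun i _ => ?_
    have e : (w ^ i) ^ p = z ^ i := by rw [← hw]; ring
    rw [mul_pow, e]
  obtain ⟨a, ha, b, hb, hab⟩ := exists_eq_div hF (tau q n x y z)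
  obtain ⟨s, rfl⟩ := hR a ha
  obtain ⟨t, rfl⟩ := hR b hb
  rw [← div_pow] at hab
  obtain ⟨h0, h1, h2⟩ := isUniformizer_tau hF hP hzP
  have hlt : P.valuation (s / t) < 1 := by
    by_contra h
    rw [hab, map_pow] at h1
    exact absurd h1 (not_lt.2 (one_le_pow₀ (not_lt.1 h)))
  have hle := h2 _ hlt
  have hne : 0 < P.valuation (s / t) := by
    rw [zero_lt_iff]
    intro h
    rw [hab, map_pow, h, zero_pow hp.ne_zero] at hle
    rw [hab] at h0
    exact h0 (by rw [(map_eq_zero _).1 h, zero_pow hp.ne_zero])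
  rw [hab, map_pow] at hle
  exact absurd hle (not_le.2 (pow_lt_self_of_lt_one₀ hne hlt hp.one_lt))

theorem isFractionRing_coordRing (hF : IsGGK q n K x y z) :
    IsFractionRing (coordRing K x y z) F :=
  IsFractionRing.of_field _ _ fun f => by
    obtain ⟨a, ha, b, hb, h⟩ := exists_eq_div hF f
    exact ⟨⟨a, ha⟩, ⟨b, hb⟩, h⟩

open Polynomial in
/-- The ring `K[x, y, z]` is integrally closed. -/
theorem mem_coordRing_of_isIntegral (hF : IsGGK q n K x y z) {P : ValuationSubring F}
    (hP : IsPlace K P) (hzP : z ∉ P) {f : F} (hf : IsIntegral (coordRing K x y z) f) :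
    f ∈ coordRing K x y z := by
  obtain ⟨p, k, hp, hk, hq, _, _⟩ := hF.exists_charP
  have : Fact p.Prime := ⟨hp⟩
  have := hF.finite
  have := isFractionRing_coordRing hF
  set R := coordRing K x y z with hR
  let zR : R := ⟨z, z_mem x y z⟩
  -- A conductor: the polynomials in z that are common denominators for all powers of f. The aim is
  -- 1 ∈ I.
  let I : Ideal K[X] :=
    { carrier := {D | ∀ j : ℕ, aeval z D * f ^ j ∈ R}
      add_mem' := fun {a b} ha hb j => by rw [map_add, add_mul]; exact add_mem (ha j) (hb j)
      zero_mem' := fun j => by simp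
      smul_mem' := fun c D hD j => by
        rw [smul_eq_mul, map_mul, mul_assoc]
        have h1 : aeval z c ∈ R := by
          have : aeval z c = ((aeval zR c : R) : F) := by
            rw [← Subalgebra.val_apply, ← aeval_algHom_apply]; rfl
          rw [this]; exact Subtype.mem _
        exact mul_mem h1 (hD j) }
  -- Integrality of f gives a common denominator in R, and every nonzero element of R divides a
  -- nonzero polynomial in z.
  have hI : I ≠ ⊥ := by
    obtain ⟨a, ha0, ha⟩ := FractionalIdeal.isFractional_adjoin_integral (nonZeroDivisors R) f hf
    let _ : Algebra K[X] R := (aeval zR : K[X] →ₐ[K] _).toRingHom.toAlgebra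
    have halg : IsAlgebraic K[X] a := by
      have : IsIntegral K[X] a := isIntegral_aeval hF a
      exact this.isAlgebraic
    obtain ⟨D, hD0, b, hb⟩ := halg.exists_nonzero_dvd ha0
    refine fun hbot => hD0 ?_
    have hmem : D ∈ I := by
      intro j
      obtain ⟨s, hs⟩ := ha (f ^ j) (pow_mem (Algebra.self_mem_adjoin_singleton R f) j)
      have e : aeval z D = (b : F) * (a : F) := by
        have : aeval z D = ((aeval zR D : R) : F) := by
          rw [← Subalgebra.val_apply, ← aeval_algHom_apply]; rfl
        rw [this, mul_comm]
        exact congrArg Subtype.val hb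
      have hs' : (s : F) = (a : F) * f ^ j := hs
      rw [e, mul_assoc, ← hs']
      exact mul_mem b.2 s.2
    rw [hbot] at hmem
    exact hmem
  let D := Submodule.IsPrincipal.generator I
  have hDI : D ∈ I := Submodule.IsPrincipal.generator_mem I
  have hD0 : D ≠ 0 := fun h => hI ((Submodule.IsPrincipal.eq_bot_iff_generator_eq_zero I).2 h)
  obtain ⟨h, hh⟩ := isFrobSum_X hp D
  -- D(z) f^(jp) has two expansions in 1, z, …, z^(p-1) with p-th powers as coefficients: one from D
  -- = ∑ h_i^p X^i, one from its membership in R. Uniqueness identifies h_i(z) f^j with an element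
  -- of R.
  have hmem : ∀ i < p, h i ∈ I := by
    intro i hi j
    obtain ⟨r, hr⟩ := isFrobSum_coordRing hF hp hk hq ⟨_, hDI (j * p)⟩
    have hr' := congrArg Subtype.val hr
    simp only [AddSubmonoidClass.coe_finsetSum, MulMemClass.coe_mul, SubmonoidClass.coe_pow]
      at hr'
    have hsum : ∑ i ∈ Finset.range p, (aeval z (h i) * f ^ j - r i) ^ p * z ^ i = 0 := by
      have h1 : aeval z D * f ^ (j * p) =
          ∑ i ∈ Finset.range p, (aeval z (h i) * f ^ j) ^ p * z ^ i := by
        conv_lhs => rw [hh]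
        rw [map_sum, Finset.sum_mul]
        refine Finset.sum_congr rfl fun i _ => ?_
        rw [map_mul, map_pow, map_pow, aeval_X]
        ring
      rw [← sub_eq_zero.2 (h1.symm.trans hr'), ← Finset.sum_sub_distrib]
      refine Finset.sum_congr rfl fun i _ => ?_
      rw [sub_pow_char, sub_mul]
    have := eq_zero_of_frobSum_eq_zero hp (pow_ne_z hF hp hk hq hP hzP) hsum hi
    rw [sub_eq_zero.1 this]
    exact (r i).2
  have hdvd : ∀ i, ∃ e, i < p → h i = D * e := by
    intro i
    by_cases hi : i < p
    · obtain ⟨e, he⟩ := (Submodule.IsPrincipal.mem_iff_generator_dvd I).1 (hmem i hi)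
      exact ⟨e, fun _ => he⟩
    · exact ⟨0, fun h => absurd h hi⟩
  choose e he using hdvd
  -- Now D divides every h_i, so D^p divides ∑ h_i^p X^i = D, which makes D a unit.
  have h1 : (1 : K[X]) ∈ I := by
    have : (1 : K[X]) = D ^ (p - 2) * (∑ i ∈ Finset.range p, e i ^ p * X ^ i) * D := by
      refine mul_left_cancel₀ hD0 ?_
      have hpp : D * D ^ (p - 2) * D = D ^ p := by
        rw [← pow_succ', ← pow_succ]; congr 1; have := hp.two_le; omega
      calc D * 1 = ∑ i ∈ Finset.range p, h i ^ p * X ^ i := by rw [mul_one]; exact hh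
        _ = D ^ p * ∑ i ∈ Finset.range p, e i ^ p * X ^ i := by
          rw [Finset.mul_sum]
          refine Finset.sum_congr rfl fun i hi => ?_
          rw [he i (Finset.mem_range.1 hi)]; ring
        _ = _ := by rw [← hpp]; ring
    rw [this]
    exact I.mul_mem_left _ hDI
  have := h1 1
  rwa [map_one, one_mul, pow_one] at this

end GGK

/-! ### The stabilizer of the pole acts on K[x, y, z] -/

namespace GGK

open Pointwise

variable {K F : Type*} [Field K] [Field F] [Algebra K F] {q n : ℕ} {x y z : F}

theorem valuation_le_one_of_pow_add_mul {P : ValuationSubring F} {t e u : F} {N : ℕ} (hN : 1 < N)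
    (he : P.valuation e ≤ 1) (hu : P.valuation u ≤ 1) (h : t ^ N + e * t = u) :
    P.valuation t ≤ 1 := by
  by_contra ht
  rw [not_le] at ht
  have h1 : P.valuation (e * t) < P.valuation (t ^ N) := by
    rw [map_mul, map_pow]
    exact (mul_le_of_le_one_left zero_le he).trans_lt (lt_self_pow₀ ht hN)
  rw [← h, P.valuation.map_add_eq_of_lt_left h1, map_pow] at hu
  exact absurd hu (not_le.2 (one_lt_pow₀ ht (by omega)))

theorem coordRing_subset (hF : IsGGK q n K x y z) {P : ValuationSubring F}
    (hP : ∀ c : K, algebraMap K F c ∈ P) (hz : z ∈ P) {r : F} (hr : r ∈ coordRing K x y z) :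
    r ∈ P := by
  have hq := hF.one_lt
  have hy : y ∈ P := by
    rw [← P.valuation_le_one_iff]
    refine valuation_le_one_of_pow_add_mul (e := -1) (u := z ^ m q n)
      (Nat.one_lt_pow two_ne_zero hq) (by simp) ?_ (by rw [hF.kummer]; ring)
    exact (P.valuation_le_one_iff _).2 (pow_mem hz _)
  have hx : x ∈ P := by
    rw [← P.valuation_le_one_iff]
    refine valuation_le_one_of_pow_add_mul (e := 1) (u := y ^ (q + 1)) hq (by simp) ?_
      (by rw [← hF.hermitian]; ring)
    exact (P.valuation_le_one_iff _).2 (pow_mem hy _)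
  induction hr using Algebra.adjoin_induction with
  | mem w hw => rcases hw with rfl | rfl | rfl <;> assumption
  | algebraMap c => exact hP c
  | add a b _ _ ha hb => exact add_mem ha hb
  | mul a b _ _ ha hb => exact mul_mem ha hb

theorem isPlace_smul {P : ValuationSubring F} (hP : IsPlace K P) (g : F ≃ₐ[K] F) :
    IsPlace K (g • P) := by
  refine ⟨fun c => ?_, fun h => hP.2 ?_⟩
  · rw [ValuationSubring.mem_pointwise_smul_iff_inv_smul_mem]
    have : g⁻¹ • algebraMap K F c = algebraMap K F c := (g⁻¹).commutes c
    rw [this]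
    exact hP.1 c
  · ext f
    rw [← ValuationSubring.smul_mem_pointwise_smul_iff (g := g), h]
    simp

theorem map_mem_iff {Q : ValuationSubring F} {g : F ≃ₐ[K] F} (hg : g ∈ Q.decompositionSubgroup K)
    (f : F) : g f ∈ Q ↔ f ∈ Q := by
  rw [MulAction.mem_stabilizer_iff] at hg
  rw [← ValuationSubring.smul_mem_pointwise_smul_iff (g := g) (x := f), hg]
  rfl

theorem valuation_le_iff {P : ValuationSubring F} (a : F) {b : F} (hb : b ≠ 0) :
    P.valuation a ≤ P.valuation b ↔ a / b ∈ P := by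
  rw [← P.valuation_le_one_iff, map_div₀, div_le_one₀]
  exact zero_lt_iff.2 ((Valuation.ne_zero_iff _).2 hb)

theorem valuation_map_le_iff {Q : ValuationSubring F} {g : F ≃ₐ[K] F}
    (hg : g ∈ Q.decompositionSubgroup K) (a b : F) :
    Q.valuation (g a) ≤ Q.valuation (g b) ↔ Q.valuation a ≤ Q.valuation b := by
  by_cases hb : b = 0
  · simp [hb]
  · rw [valuation_le_iff _ hb, valuation_le_iff _ (by simpa using hb), ← map_div₀, map_mem_iff hg]

/-- An automorphism fixing the valuation ring sends τ to another uniformizer, and the value of τ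
generates the value group. -/
theorem valuation_map (hF : IsGGK q n K x y z) {Q : ValuationSubring F} (hQ : IsPlace K Q)
    (hz : z ∉ Q) {g : F ≃ₐ[K] F} (hg : g ∈ Q.decompositionSubgroup K) (f : F) :
    Q.valuation (g f) = Q.valuation f := by
  have hle := valuation_map_le_iff hg
  have heq : ∀ a b, Q.valuation a = Q.valuation b → Q.valuation (g a) = Q.valuation (g b) :=
    fun a b h => le_antisymm ((hle a b).2 h.le) ((hle b a).2 h.ge)
  obtain ⟨hτ0, hτ1, hτ⟩ := isUniformizer_tau hF hQ hz
  set τ := tau q n x y z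
  have hlt : ∀ a, Q.valuation (g a) < 1 ↔ Q.valuation a < 1 := by
    intro a
    have := hle 1 a
    rw [map_one, map_one] at this
    rw [← not_le, ← not_le, this]
  have hgτ : Q.valuation (g τ) = Q.valuation τ := by
    refine le_antisymm (hτ _ ((hlt τ).2 hτ1)) ?_
    have h2 := hτ (g.symm τ) ((hlt _).1 (by simpa using hτ1))
    simpa using (hle _ _).2 h2
  by_cases hf : f = 0
  · simp [hf]
  obtain ⟨k, hk⟩ := exists_valuation_eq_zpow hF hf hQ hz
  have hk' := hk Q hQ hz
  rw [← map_zpow₀] at hk'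
  rw [heq _ _ hk', hk', map_zpow₀, map_zpow₀, map_zpow₀, hgτ]

/-- R is the intersection of the valuation rings V containing it. For nontrivial V, the ring g⁻¹ V
still contains z: otherwise it would be Q by uniqueness of the pole, and then V = Q. Thus g⁻¹ V
contains R, and V contains g r. -/
theorem map_mem_coordRing (hF : IsGGK q n K x y z) {Q : ValuationSubring F} (hQ : IsPlace K Q)
    (hz : z ∉ Q) {g : F ≃ₐ[K] F} (hg : g ∈ Q.decompositionSubgroup K) {r : F}
    (hr : r ∈ coordRing K x y z) : g r ∈ coordRing K x y z := by
  refine mem_coordRing_of_isIntegral hF hQ hz ?_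
  have h1 : g r ∈ (⨅ V : {V : ValuationSubring F // (coordRing K x y z : Set F) ⊆ V.toSubring},
      V.1.toSubring : Subring F) := by
    rw [Subring.mem_iInf]
    rintro ⟨V, hV⟩
    change g r ∈ V
    have hK : ∀ c : K, algebraMap K F c ∈ V := fun c => hV (Subalgebra.algebraMap_mem _ c)
    have hzV : z ∈ V := hV (z_mem x y z)
    by_cases hVt : V = ⊤
    · rw [hVt]; trivial
    have hW := isPlace_smul (⟨hK, hVt⟩ : IsPlace K V) g⁻¹
    have hzW : z ∈ g⁻¹ • V := by
      by_contra hzW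
      have hWQ := eq_of_notMem hF hW hzW hQ hz
      have hVQ : V = Q := by
        rw [MulAction.mem_stabilizer_iff] at hg
        rw [← hg, ← hWQ, smul_inv_smul]
      exact hz (hVQ ▸ hzV)
    have := coordRing_subset hF hW.1 hzW hr
    exact ValuationSubring.mem_inv_pointwise_smul_iff.1 this
  rw [iInf_valuationSubring_superset] at h1
  have hcl : Subring.closure (coordRing K x y z : Set F) = (coordRing K x y z).toSubring :=
    Subring.closure_eq (coordRing K x y z).toSubring
  obtain ⟨Q, hQm, hQ0⟩ := h1
  have hle : Subring.closure (coordRing K x y z : Set F) ≤ (coordRing K x y z).toSubring := hcl.le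
  refine ⟨Q.map (Subring.inclusion hle), hQm.map _, ?_⟩
  rw [Polynomial.eval₂_map]
  exact hQ0

end GGK

/-! ### Elements of K[x, y, z] of small pole order -/

namespace GGK

open Polynomial

variable {K F : Type*} [Field K] [Field F] [Algebra K F] {q n : ℕ} {x y z : F}

section Independence

variable {P : ValuationSubring F}

/-- Independence of the monomials over K, with the powers of z collected into polynomial
coefficients. -/
theorem eq_zero_of_sum_mul_eq_zero (hF : IsGGK q n K x y z) (hP : IsPlace K P) (hz : z ∉ P)
    {C : Fin (q ^ 2) × Fin q → K[X]}
    (h : ∑ s, aeval z (C s) * (y ^ (s.1 : ℕ) * x ^ (s.2 : ℕ)) = 0) (s : Fin (q ^ 2) × Fin q) :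
    C s = 0 := by
  have hli := linearIndependent_mono hF hP hz
  rw [linearIndependent_iff'] at hli
  set N := (Finset.univ.sup fun s => (C s).natDegree) + 1
  have hN : ∀ s, (C s).natDegree < N := fun s =>
    Nat.lt_succ_of_le (Finset.le_sup (f := fun s => (C s).natDegree) (Finset.mem_univ s))
  have h0 := hli (Finset.range N ×ˢ Finset.univ) (fun t => (C t.2).coeff t.1) (by
    rw [← h, Finset.sum_product_right]
    refine Finset.sum_congr rfl fun s _ => ?_
    rw [aeval_eq_sum_range' (hN s), Finset.sum_mul]
    refine Finset.sum_congr rfl fun i _ => ?_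
    rw [mono, smul_mul_assoc, mul_assoc])
  ext i
  by_cases hi : i < N
  · exact h0 (i, s) (by simp [hi])
  · rw [coeff_eq_zero_of_natDegree_lt ((hN s).trans_le (not_lt.1 hi)), coeff_zero]

/-- `x` and the powers `y ^ j` with `j < q ^ 2` are linearly independent over `K[z]`. -/
theorem eq_zero_of_eval₂_add_eq_zero (hF : IsGGK q n K x y z) (hP : IsPlace K P) (hz : z ∉ P)
    {H : K[X][X]} {D : K[X]} (hH : H.natDegree < q ^ 2)
    (h : H.eval₂ (aeval z : K[X] →ₐ[K] F).toRingHom y + aeval z D * x = 0) : H = 0 ∧ D = 0 := by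
  have hq := hF.one_lt
  have hq2 : 0 < q ^ 2 := pow_pos (by omega) 2
  obtain ⟨k, hk⟩ : ∃ k, q = k + 2 := ⟨q - 2, by omega⟩
  let f : ℕ → ℕ → K[X] := fun j k => if k = 0 then H.coeff j else if k = 1 ∧ j = 0 then D else 0
  have key := eq_zero_of_sum_mul_eq_zero hF hP hz
    (C := fun s => f s.1 s.2) (by
      rw [Fintype.sum_prod_type_right]
      have e : ∀ g : ℕ → F, (∀ i, 1 < i → g i = 0) → ∑ i : Fin q, g i = g 0 + g 1 := by
        intro g hg
        rw [Fin.sum_univ_eq_sum_range, hk, Finset.sum_range_succ', Finset.sum_range_succ',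
          Finset.sum_eq_zero (fun i _ => hg _ (by omega))]
        ring
      have e0 : ∑ j : Fin (q ^ 2), aeval z (f j 0) * (y ^ (j : ℕ) * x ^ 0) =
          H.eval₂ (aeval z : K[X] →ₐ[K] F).toRingHom y := by
        rw [eval₂_eq_sum_range' _ hH, Fin.sum_univ_eq_sum_range
          (fun j => aeval z (f j 0) * (y ^ j * x ^ 0))]
        exact Finset.sum_congr rfl fun j _ => by simp [f]
      have e1 : ∑ j : Fin (q ^ 2), aeval z (f j 1) * (y ^ (j : ℕ) * x ^ 1) = aeval z D * x := by
        rw [Finset.sum_eq_single_of_mem (⟨0, hq2⟩ : Fin (q ^ 2)) (Finset.mem_univ _)]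
        · simp [f]
        · intro j _ hj
          have : (j : ℕ) ≠ 0 := fun h => hj (Fin.ext h)
          simp [f, this]
      rw [e (fun k => ∑ j : Fin (q ^ 2), aeval z (f j k) * (y ^ (j : ℕ) * x ^ k)), e0, e1, h]
      intro i hi
      refine Finset.sum_eq_zero fun j _ => ?_
      have h0 : i ≠ 0 := by omega
      have h1 : i ≠ 1 := by omega
      simp [f, h0, h1])
  constructor
  · ext1 j
    by_cases hj : j < q ^ 2
    · simpa [f] using key (⟨j, hj⟩, ⟨0, by omega⟩)
    · rw [coeff_eq_zero_of_natDegree_lt (hH.trans_le (not_lt.1 hj)), coeff_zero]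
  · simpa [f] using key (⟨0, hq2⟩, ⟨1, hq⟩)

/-- An element of `K[x, y, z]` with pole order at most `N` is a combination of monomials with pole
order at most `N`. -/
theorem mem_span_of_valuation_le (hF : IsGGK q n K x y z) (hP : IsPlace K P)
    {δ : P.ValueGroup} (hδ : 1 < δ) (hy : P.valuation y = δ ^ (q * m q n))
    (hx : P.valuation x = δ ^ ((q + 1) * m q n)) (hz : P.valuation z = δ ^ (q ^ 3)) {r : F}
    (hr : r ∈ coordRing K x y z) {N : ℕ} (hN : P.valuation r ≤ δ ^ N) :
    r ∈ Submodule.span K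
      {f : F | ∃ i j k : ℕ, wt q n i j k ≤ N ∧ f = z ^ i * y ^ j * x ^ k} := by
  obtain ⟨c, rfl⟩ := exists_linearCombination hF hr
  by_cases hc : c = 0
  · simp [hc]
  obtain ⟨t, -, ht, hmax⟩ := exists_valuation_linearCombination hF hP hδ hy hx hz hc
  rw [ht, pow_le_pow_iff_right₀ hδ] at hN
  rw [Finsupp.linearCombination_apply]
  refine Submodule.sum_mem _ fun s hs => Submodule.smul_mem _ _ (Submodule.subset_span ?_)
  exact ⟨s.1, s.2.1, s.2.2, (hmax s hs).trans hN, rfl⟩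

end Independence

section Forms

theorem lt_sq_mul_sub {q n : ℕ} (hq : 1 < q) (hn : Odd n) (hn1 : n ≠ 1) :
    q ^ 3 < (q + 1) * m q n ∧ q ^ 2 < 2 * m q n ∧ (5 ≤ n → q ^ 2 < m q n) := by
  have h := succ_mul_m (q := q) hn
  have hn3 : 3 ≤ n := by rcases hn with ⟨k, rfl⟩; omega
  have h3 : q ^ 3 ≤ q ^ n := Nat.pow_le_pow_right (by omega) hn3
  refine ⟨by omega, ?_, fun h5 => ?_⟩
  · by_contra hcon
    rw [not_lt] at hcon
    nlinarith [pow_pos (show 0 < q by omega) 2, pow_pos (show 0 < q by omega) 3]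
  · have h5 : q ^ 5 ≤ q ^ n := Nat.pow_le_pow_right (by omega) h5
    by_contra hcon
    rw [not_lt] at hcon
    have h6 : q ^ 3 + q ^ 2 ≤ q ^ 5 := by
      have : q ^ 2 ≤ q ^ 3 := Nat.pow_le_pow_right (by omega) (by norm_num)
      have : 2 * q ^ 3 ≤ q * q ^ 3 := Nat.mul_le_mul_right _ hq
      have : q ^ 4 ≤ q ^ 5 := Nat.pow_le_pow_right (by omega) (by norm_num)
      have : q * q ^ 3 = q ^ 4 := by ring
      omega
    nlinarith

/-- Only 1, z and possibly y have weight at most q³; the weight qm of y exceeds q³ as soon as n ≥ 5.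
-/
theorem exists_form_z (hF : IsGGK q n K x y z) (hn : n ≠ 1) {r : F}
    (hr : r ∈ Submodule.span K
      {f : F | ∃ i j k : ℕ, wt q n i j k ≤ q ^ 3 ∧ f = z ^ i * y ^ j * x ^ k}) :
    ∃ d e f : K, (5 ≤ n → e = 0) ∧
      r = algebraMap K F d * z + algebraMap K F e * y + algebraMap K F f := by
  have hq := hF.one_lt
  obtain ⟨h1, h2, h3⟩ := lt_sq_mul_sub hq hF.odd hn
  have hq3 : 0 < q ^ 3 := pow_pos (by omega) 3
  induction hr using Submodule.span_induction with
  | zero => exact ⟨0, 0, 0, fun _ => rfl, by simp⟩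
  | add a b _ _ ha hb =>
    obtain ⟨d, e, f, h5, rfl⟩ := ha
    obtain ⟨d', e', f', h5', rfl⟩ := hb
    exact ⟨d + d', e + e', f + f', fun h => by rw [h5 h, h5' h, add_zero],
      by simp only [map_add]; ring⟩
  | smul c a _ ha =>
    obtain ⟨d, e, f, h5, rfl⟩ := ha
    exact ⟨c * d, c * e, c * f, fun h => by rw [h5 h, mul_zero],
      by simp only [map_mul, Algebra.smul_def]; ring⟩
  | mem w hw =>
    obtain ⟨i, j, k, hle, rfl⟩ := hw
    rw [wt] at hle
    have hk : k = 0 := by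
      by_contra hk
      have : (q + 1) * m q n ≤ k * ((q + 1) * m q n) := Nat.le_mul_of_pos_left _ (by omega)
      omega
    subst hk
    have hj : j < 2 := by
      by_contra hj
      have : 2 * (q * m q n) ≤ j * (q * m q n) := Nat.mul_le_mul_right _ (by omega)
      have h4 : q * q ^ 2 < q * (2 * m q n) := Nat.mul_lt_mul_of_pos_left h2 (by omega)
      have e1 : q * q ^ 2 = q ^ 3 := by ring
      have e2 : q * (2 * m q n) = 2 * (q * m q n) := by ring
      omega
    have hm := m_pos (q := q) hF.odd
    have hqm : 0 < q * m q n := Nat.mul_pos (by omega) hm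
    interval_cases j
    · have hi : i < 2 := by
        by_contra hi
        have : 2 * q ^ 3 ≤ i * q ^ 3 := Nat.mul_le_mul_right _ (by omega)
        omega
      interval_cases i
      · exact ⟨0, 0, 1, fun _ => rfl, by simp⟩
      · exact ⟨1, 0, 0, fun _ => rfl, by simp⟩
    · have hi : i = 0 := by
        by_contra hi
        have : q ^ 3 ≤ i * q ^ 3 := Nat.le_mul_of_pos_left _ (by omega)
        omega
      subst hi
      refine ⟨0, 1, 0, fun h5 => ?_, by simp⟩
      have h4 : q * q ^ 2 < q * m q n := Nat.mul_lt_mul_of_pos_left (h3 h5) (by omega)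
      have e1 : q * q ^ 2 = q ^ 3 := by ring
      omega

/-- Besides y, only the z^i with i q³ ≤ qm qualify, whence the degree bound. -/
theorem exists_form_y (hF : IsGGK q n K x y z) {r : F}
    (hr : r ∈ Submodule.span K
      {f : F | ∃ i j k : ℕ, wt q n i j k ≤ q * m q n ∧ f = z ^ i * y ^ j * x ^ k}) :
    ∃ (a : K) (A : K[X]), A.natDegree ≤ m q n / q ^ 2 ∧
      r = algebraMap K F a * y + aeval z A := by
  have hq := hF.one_lt
  have hm := m_pos (q := q) hF.odd
  have hqm : 0 < q * m q n := Nat.mul_pos (by omega) hm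
  induction hr using Submodule.span_induction with
  | zero => exact ⟨0, 0, by simp, by simp⟩
  | add a b _ _ ha hb =>
    obtain ⟨a, A, hA, rfl⟩ := ha
    obtain ⟨b, B, hB, rfl⟩ := hb
    exact ⟨a + b, A + B, natDegree_add_le_of_degree_le hA hB, by simp only [map_add]; ring⟩
  | smul c a _ ha =>
    obtain ⟨a, A, hA, rfl⟩ := ha
    exact ⟨c * a, C c * A, (natDegree_C_mul_le c A).trans hA,
      by simp only [map_mul, Algebra.smul_def, aeval_C]; ring⟩
  | mem w hw =>
    obtain ⟨i, j, k, hle, rfl⟩ := hw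
    rw [wt] at hle
    have hk : k = 0 := by
      by_contra hk
      have : (q + 1) * m q n ≤ k * ((q + 1) * m q n) := Nat.le_mul_of_pos_left _ (by omega)
      have : (q + 1) * m q n = q * m q n + m q n := by ring
      omega
    subst hk
    have hj : j < 2 := by
      by_contra hj
      have : 2 * (q * m q n) ≤ j * (q * m q n) := Nat.mul_le_mul_right _ (by omega)
      omega
    interval_cases j
    · refine ⟨0, X ^ i, ?_, by simp⟩
      rw [natDegree_X_pow, Nat.le_div_iff_mul_le (pow_pos (by omega) 2)]
      refine le_of_mul_le_mul_left (a := q) ?_ (by omega)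
      calc q * (i * q ^ 2) = i * q ^ 3 := by ring
        _ ≤ _ := by omega
    · have hi : i = 0 := by
        by_contra hi
        have : q ^ 3 ≤ i * q ^ 3 := Nat.le_mul_of_pos_left _ (by omega)
        have : 0 < q ^ 3 := pow_pos (by omega) 3
        omega
      subst hi
      exact ⟨1, 0, by simp, by simp⟩

theorem exists_form_x (hF : IsGGK q n K x y z) {r : F}
    (hr : r ∈ Submodule.span K
      {f : F | ∃ i j k : ℕ, wt q n i j k ≤ (q + 1) * m q n ∧ f = z ^ i * y ^ j * x ^ k}) :
    ∃ (e : K) (A B : K[X]), r = algebraMap K F e * x + aeval z A * y + aeval z B := by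
  have hq := hF.one_lt
  have hm := m_pos (q := q) hF.odd
  have hqm : 2 * m q n ≤ q * m q n := Nat.mul_le_mul_right _ (by omega)
  induction hr using Submodule.span_induction with
  | zero => exact ⟨0, 0, 0, by simp⟩
  | add a b _ _ ha hb =>
    obtain ⟨e, A, B, rfl⟩ := ha
    obtain ⟨e', A', B', rfl⟩ := hb
    exact ⟨e + e', A + A', B + B', by simp only [map_add]; ring⟩
  | smul c a _ ha =>
    obtain ⟨e, A, B, rfl⟩ := ha
    exact ⟨c * e, C c * A, C c * B, by simp only [map_mul, Algebra.smul_def, aeval_C]; ring⟩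
  | mem w hw =>
    obtain ⟨i, j, k, hle, rfl⟩ := hw
    rw [wt] at hle
    have hk : k < 2 := by
      by_contra hk
      have : 2 * ((q + 1) * m q n) ≤ k * ((q + 1) * m q n) := Nat.mul_le_mul_right _ (by omega)
      rw [add_mul] at this hle
      omega
    interval_cases k
    · have hj : j < 2 := by
        by_contra hj
        have : 2 * (q * m q n) ≤ j * (q * m q n) := Nat.mul_le_mul_right _ (by omega)
        rw [add_mul] at hle
        omega
      interval_cases j
      · exact ⟨0, 0, X ^ i, by simp⟩
      · exact ⟨0, X ^ i, 0, by simp⟩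
    · have hi : i = 0 := by
        by_contra hi
        have : q ^ 3 ≤ i * q ^ 3 := Nat.le_mul_of_pos_left _ (by omega)
        have : 0 < q ^ 3 := pow_pos (by omega) 3
        omega
      have hj : j = 0 := by
        by_contra hj
        have : q * m q n ≤ j * (q * m q n) := Nat.le_mul_of_pos_left _ (by omega)
        omega
      subst hi hj
      exact ⟨1, 0, 0, by simp⟩

end Forms

end GGK

/-! ### Automorphisms fixing the pole have the form [a, b, c, d] -/

namespace GGK

open Polynomial

variable {K F : Type*} [Field K] [Field F] [Algebra K F] {q n : ℕ} {x y z : F}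

/-- Divisibility gives M = -1 in K, hence M ≠ 0 there. The last bound keeps the derivative of a
polynomial of degree at most m / q² below degree q(M-1). -/
theorem m_div_lt {q n M : ℕ} (hq : 1 < q) (hn : Odd n) (hn1 : n ≠ 1) (hM : m q n = q * M + 1)
    (hM' : (q + 1) * M + 1 = q ^ (n - 1)) :
    0 < M ∧ q ∣ M + 1 ∧ m q n / q ^ 2 < q * (M - 1) + 1 := by
  have hn3 : 3 ≤ n := by rcases hn with ⟨k, rfl⟩; omega
  obtain ⟨s, rfl⟩ : ∃ s, n = s + 3 := ⟨n - 3, by omega⟩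
  have e : s + 3 - 1 = s + 2 := rfl
  rw [e] at hM'
  have hs : 0 < q ^ s := pow_pos (by omega) s
  have hsq : q ^ (s + 2) = q ^ s * q ^ 2 := pow_add _ _ _
  have hle : q ^ 2 ≤ q ^ (s + 2) := by rw [hsq]; exact Nat.le_mul_of_pos_left _ hs
  have hM0 : 0 < M := by
    rcases Nat.eq_zero_or_pos M with h | h
    · subst h; have := Nat.one_lt_pow two_ne_zero hq; omega
    · exact h
  refine ⟨hM0, ?_, ?_⟩
  · have h1 : q ∣ q * M + (M + 1) := ⟨q ^ (s + 1), by rw [← pow_succ']; linarith⟩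
    exact (Nat.dvd_add_right (dvd_mul_right q M)).1 h1
  · rw [Nat.div_lt_iff_lt_mul (pow_pos (by omega) 2), hM]
    obtain ⟨M, rfl⟩ : ∃ t, M = t + 1 := ⟨M - 1, by omega⟩
    rw [Nat.add_sub_cancel]
    have h4 : 2 * 2 ≤ q ^ 2 := by rw [sq]; exact Nat.mul_le_mul hq hq
    have h5 : q ^ 2 ≤ q * M + q + M + 2 := by linarith
    rcases Nat.eq_zero_or_pos M with h0 | h0
    · subst h0
      have : q ^ 2 ≤ q + 2 := by linarith
      have hq2 : q = 2 := by nlinarith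
      subst hq2
      norm_num
    · have hqM : q ≤ q * M := Nat.le_mul_of_pos_right _ h0
      nlinarith

theorem natCast_eq_zero {A : Type*} [CommRing A] {p k : ℕ} (hk : 0 < k) (hq : q = p ^ k)
    [CharP A p] : (q : A) = 0 :=
  (CharP.cast_eq_zero_iff A p q).2 (hq ▸ dvd_pow_self p hk.ne')

theorem add_pow_q {A : Type*} [CommRing A] {p k : ℕ} (hp : p.Prime) (hq : q = p ^ k)
    [CharP A p] (a b : A) : (a + b) ^ q = a ^ q + b ^ q := by
  have : Fact p.Prime := ⟨hp⟩
  rw [hq, add_pow_char_pow]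

theorem sub_pow_q {A : Type*} [CommRing A] {p k : ℕ} (hp : p.Prime) (hq : q = p ^ k)
    [CharP A p] (a b : A) : (a - b) ^ q = a ^ q - b ^ q := by
  have : Fact p.Prime := ⟨hp⟩
  rw [hq, sub_pow_char_pow]

theorem add_pow_q_sq {A : Type*} [CommRing A] {p k : ℕ} (hp : p.Prime) (hq : q = p ^ k)
    [CharP A p] (a b : A) : (a + b) ^ q ^ 2 = a ^ q ^ 2 + b ^ q ^ 2 := by
  rw [sq, pow_mul, pow_mul, pow_mul, add_pow_q hp hq, add_pow_q hp hq]

theorem pow_q_injective {A : Type*} [Field A] {p k : ℕ} (hp : p.Prime) (hq : q = p ^ k)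
    [CharP A p] {a b : A} (h : a ^ q = b ^ q) : a = b := by
  have h0 : (a - b) ^ q = 0 := by rw [sub_pow_q hp hq, h, sub_self]
  exact sub_eq_zero.1 (pow_eq_zero_iff (hq ▸ pow_ne_zero _ hp.ne_zero) |>.1 h0)

theorem eq_C_of_pow_eq {t : ℕ} (ht : 1 < t) {A B : K[X]} (h : A ^ t = B)
    (hB : B.natDegree ≤ A.natDegree) : ∃ b, A = C b := by
  have h1 : t * A.natDegree ≤ A.natDegree := by rwa [← natDegree_pow, h]
  have h0 : A.natDegree = 0 := by
    by_contra h0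
    have : 2 * A.natDegree ≤ t * A.natDegree := Nat.mul_le_mul_right _ ht
    omega
  exact ⟨_, eq_C_of_natDegree_eq_zero h0⟩

/-- The polynomial identity that forces `g z = d z` and `g y = a y + b`. -/
theorem eq_zero_of_pow_eq {p k : ℕ} (hp : p.Prime) (hk : 0 < k) (hq : q = p ^ k) [CharP K p]
    (hn : Odd n) (hn1 : n ≠ 1) {d f a : K} {A : K[X]} (hd : d ≠ 0)
    (hA : A.natDegree ≤ m q n / q ^ 2)
    (h : (C d * X + C f) ^ m q n = C a * X ^ m q n + (A ^ q ^ 2 - A)) :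
    f = 0 ∧ ∃ b, A = C b := by
  have hq1 : 1 < q := hq ▸ Nat.one_lt_pow hk.ne' hp.one_lt
  obtain ⟨M, hM, hM'⟩ := exists_m_eq hq1 hn
  obtain ⟨hM0, hdvd, hlt⟩ := m_div_lt hq1 hn hn1 hM hM'
  have hqK := natCast_eq_zero (A := K) hk hq
  have hmK : (m q n : K) = 1 := by rw [hM]; push_cast; rw [hqK]; ring
  have hMK : (M : K) ≠ 0 := by
    intro h0
    have h1 : ((M + 1 : ℕ) : K) = 0 := by
      obtain ⟨c, hc⟩ := hdvd
      rw [hc]; push_cast; rw [hqK, zero_mul]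
    push_cast at h1
    rw [h0, zero_add] at h1
    exact one_ne_zero h1
  -- Differentiation removes A^(q²), and m = 1 in K.
  have hder : C d * (C d * X + C f) ^ (q * M) = C a * X ^ (q * M) - derivative A := by
    have h1 := congrArg derivative h
    have hm1 : m q n - 1 = q * M := by omega
    simp only [derivative_pow, derivative_add, derivative_sub, derivative_mul, derivative_C,
      derivative_X, hm1, hmK, Nat.cast_pow, hqK] at h1
    simp only [C_1, one_mul, zero_mul, mul_one, zero_add, add_zero, ne_eq, OfNat.ofNat_ne_zero,
      not_false_eq_true, zero_pow, C_0, zero_sub] at h1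
    rw [mul_comm, h1]
    ring
  have hcoA : ∀ i, q * (M - 1) ≤ i → (derivative A).coeff i = 0 := by
    intro i hi
    rw [coeff_derivative, coeff_eq_zero_of_natDegree_lt (by omega), zero_mul]
  have hexp : (C d * X + C f) ^ (q * M) = expand K q ((C (d ^ q) * X + C (f ^ q)) ^ M) := by
    rw [pow_mul, add_pow_q hp hq, map_pow, map_add, map_mul, expand_C, expand_X, expand_C, mul_pow,
      C_pow, C_pow]
  -- Compare coefficients at X^(q(M-1)). The right side has none, while the left side is a
  -- polynomial in X^q whose coefficient there is M f^q times a power of d.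
  have hf : f = 0 := by
    have h1 := congrArg (fun B : K[X] => B.coeff ((M - 1) * q)) hder
    rw [coeff_C_mul, hexp, coeff_expand_mul (by omega), coeff_sub, coeff_C_mul, coeff_X_pow,
      hcoA _ (by rw [mul_comm]), if_neg, mul_zero, sub_zero] at h1
    · have h2 : (C (d ^ q) * X + C (f ^ q)) ^ M =
          C ((d ^ q) ^ M) * (X + C (f ^ q / d ^ q)) ^ M := by
        rw [map_pow C (d ^ q) M, ← mul_pow, mul_add, ← C_mul, mul_div_cancel₀ _ (pow_ne_zero _ hd)]
      rw [h2, coeff_C_mul, coeff_X_add_C_pow] at h1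
      have h3 : M - (M - 1) = 1 := by omega
      have h4 : M.choose (M - 1) = M := by
        rw [Nat.choose_symm_of_eq_add (by omega : M = M - 1 + 1), Nat.choose_one_right]
      rw [h3, h4, pow_one] at h1
      have hdq : d ^ q ≠ 0 := pow_ne_zero _ hd
      exact (show f = 0 ∧ ¬q = 0 by simpa [hd, hMK] using h1).1
    · intro hcon
      have : q * (M - 1) < q * M := Nat.mul_lt_mul_of_pos_left (by omega) (by omega)
      rw [mul_comm] at hcon
      omega
  refine ⟨hf, ?_⟩
  have hda : d ^ m q n = a := by
    have h1 := congrArg (fun B : K[X] => B.coeff (q * M)) hder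
    rw [hf, C_0, add_zero, mul_pow, coeff_sub, hcoA _ (Nat.mul_le_mul_left _ (by omega)), ← C_pow,
      coeff_C_mul, coeff_C_mul, coeff_C_mul, coeff_X_pow, if_pos rfl, mul_one, mul_one,
      sub_zero] at h1
    rw [← h1, hM, pow_succ']
  refine eq_C_of_pow_eq (t := q ^ 2) (B := A) (Nat.one_lt_pow two_ne_zero hq1) ?_ le_rfl
  rw [hf, C_0, add_zero, mul_pow, ← C_pow, hda] at h
  exact sub_eq_zero.1 (left_eq_add.1 h)

/-- `g y = a y + b` and, unless `n = 1`, `g z = d z`. -/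
theorem exists_map_y_z (hF : IsGGK q n K x y z) {Q : ValuationSubring F} (hQ : IsPlace K Q)
    (hz : z ∉ Q) {g : F ≃ₐ[K] F} (hg : g ∈ Q.decompositionSubgroup K) :
    ∃ a b : K, g y = algebraMap K F a * y + algebraMap K F b ∧
      (n ≠ 1 → ∃ d : K, g z = algebraMap K F d * z) := by
  obtain ⟨p, k, hp, hk, hq, _, _⟩ := hF.exists_charP
  have hq1 := hF.one_lt
  obtain ⟨δ, hδ, -, hvy, hvx, hvz⟩ := exists_delta hF hz
  have hval := valuation_map hF hQ hz hg
  have hmem := fun r hr => map_mem_coordRing hF hQ hz hg (r := r) hr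
  obtain ⟨a, A, hA, hgy⟩ := exists_form_y hF (mem_span_of_valuation_le hF hQ hδ hvy hvx hvz
    (hmem y (y_mem x y z)) (by rw [hval, hvy]))
  by_cases hn1 : n = 1
  · subst hn1
    have : m q 1 = 1 := by simp [m]
    rw [this, Nat.div_eq_of_lt (Nat.one_lt_pow two_ne_zero hq1)] at hA
    have hA' := eq_C_of_natDegree_le_zero hA
    refine ⟨a, A.coeff 0, ?_, fun h => absurd rfl h⟩
    rw [hgy, hA', aeval_C, coeff_C_zero]
  obtain ⟨d, e, f, he5, hgz⟩ := exists_form_z hF hn1 (mem_span_of_valuation_le hF hQ hδ hvy hvx hvz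
    (hmem z (z_mem x y z)) (by rw [hval, hvz]))
  have hm : 1 < m q n := by
    have h2 := (lt_sq_mul_sub hq1 hF.odd hn1).2.1
    have : 2 * 2 ≤ q ^ 2 := by rw [sq]; exact Nat.mul_le_mul hq1 hq1
    omega
  have heq : (algebraMap K F d * z + algebraMap K F e * y + algebraMap K F f) ^ m q n =
      algebraMap K F (a ^ q ^ 2 - a) * y +
        aeval z (C (a ^ q ^ 2) * X ^ m q n + (A ^ q ^ 2 - A)) := by
    have h1 := congrArg g hF.kummer
    rw [map_pow, map_sub, map_pow, hgz, hgy] at h1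
    rw [h1, add_pow_q_sq hp hq, mul_pow, sub_eq_iff_eq_add.1 hF.kummer.symm]
    simp only [map_add, map_sub, map_mul, map_pow, aeval_C, aeval_X]
    ring
  -- Only n = 3 needs an argument: then m < q², so both sides are in normal form as polynomials in y
  -- over K[z], and the coefficient of y^m is e^m.
  have he : e = 0 := by
    by_cases h5 : 5 ≤ n
    · exact he5 h5
    have hn3 : n = 3 := by rcases hF.odd with ⟨k, rfl⟩; omega
    have hm2 : m q n < q ^ 2 := by
      have h := succ_mul_m (q := q) hF.odd
      rw [hn3] at h ⊢
      by_contra hcon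
      rw [not_lt] at hcon
      have h1 : (q + 1) * q ^ 2 ≤ (q + 1) * m q 3 := Nat.mul_le_mul_left _ hcon
      have h4 : 2 * 2 ≤ q ^ 2 := by rw [sq]; exact Nat.mul_le_mul hq1 hq1
      have h5 : (q + 1) * q ^ 2 = q ^ 3 + q ^ 2 := by ring
      omega
    let L : K[X][X] := C (C e) * X + C (C d * X + C f)
    have hL : L.natDegree ≤ 1 := natDegree_linear_le
    let H : K[X][X] := L ^ m q n - (C (C (a ^ q ^ 2 - a)) * X +
      C (C (a ^ q ^ 2) * X ^ m q n + (A ^ q ^ 2 - A)))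
    have hH : H.natDegree < q ^ 2 := by
      refine (natDegree_sub_le _ _).trans_lt (max_lt ?_ ?_)
      · exact ((natDegree_pow_le_of_le _ hL).trans (by rw [mul_one])).trans_lt hm2
      · exact natDegree_linear_le.trans_lt (by omega)
    have hH0 := (eq_zero_of_eval₂_add_eq_zero hF hQ hz (D := 0) hH (by
      simp only [H, L, eval₂_sub, eval₂_add, eval₂_mul, eval₂_pow, eval₂_X, eval₂_C, map_zero,
        zero_mul, add_zero, AlgHom.toRingHom_eq_coe, RingHom.coe_coe]
      rw [sub_eq_zero, aeval_C, aeval_C, ← heq]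
      simp only [map_add, map_mul, aeval_X, aeval_C]
      ring)).1
    have hco := congrArg (fun B : K[X][X] => B.coeff (m q n)) hH0
    simp only [H] at hco
    have h1 : (L ^ m q n).coeff (m q n) = C e ^ m q n := by
      have := coeff_pow_of_natDegree_le (m := m q n) hL
      rw [mul_one] at this
      rw [this]
      simp [L, coeff_C]
    rw [coeff_sub, h1, coeff_eq_zero_of_natDegree_lt (natDegree_linear_le.trans_lt hm), sub_zero,
      coeff_zero, ← C_pow, C_eq_zero] at hco
    exact pow_eq_zero_iff (by omega) |>.1 hco
  subst he
  rw [map_zero, zero_mul, add_zero] at hgz heq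
  have hd : d ≠ 0 := by
    rintro rfl
    have h1 := hval z
    rw [hgz, map_zero, zero_mul, zero_add] at h1
    exact hz ((Q.valuation_le_one_iff z).1 (h1 ▸ valuation_algebraMap_le hQ f))
  -- The transformed Kummer equation is linear in y over K[z]: its y-coefficient gives a^(q²) = a,
  -- its constant term the polynomial identity of `eq_zero_of_pow_eq`.
  have hH := (eq_zero_of_eval₂_add_eq_zero hF hQ hz (D := 0)
    (H := C (C (a ^ q ^ 2 - a)) * X + C (C (a ^ q ^ 2) * X ^ m q n + (A ^ q ^ 2 - A) -
      (C d * X + C f) ^ m q n))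
    (natDegree_linear_le.trans_lt (Nat.one_lt_pow two_ne_zero hq1)) (by
      simp only [eval₂_add, eval₂_mul, eval₂_X, eval₂_C, map_zero,
        zero_mul, add_zero, AlgHom.toRingHom_eq_coe, RingHom.coe_coe]
      rw [map_sub (aeval (R := K) z) (C (a ^ q ^ 2) * X ^ m q n + (A ^ q ^ 2 - A)), aeval_C,
        ← add_sub_assoc, ← heq]
      simp)).1
  have h0 := congrArg (fun B : K[X][X] => B.coeff 0) hH
  have h1 := congrArg (fun B : K[X][X] => B.coeff 1) hH
  simp only [coeff_add, coeff_C_mul, coeff_X_zero, coeff_X_one, coeff_C_zero, coeff_zero, mul_zero,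
    zero_add, coeff_C_succ, mul_one, add_zero, C_eq_zero] at h0 h1
  have ha : a ^ q ^ 2 = a := sub_eq_zero.1 h1
  rw [ha] at h0
  obtain ⟨rfl, b, rfl⟩ := eq_zero_of_pow_eq hp hk hq hF.odd hn1 hd hA (sub_eq_zero.1 h0).symm
  exact ⟨a, b, by rw [hgy, aeval_C], fun _ => ⟨d, by rw [hgz, map_zero, add_zero]⟩⟩

theorem coeff_eq_zero_of_eq_zero {A : Type*} [CommRing A] (hq : 1 < q) {s t u v : A}
    (h : C s * X ^ (q + 1) + C t * X ^ q + C u * X + C v = 0) :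
    s = 0 ∧ t = 0 ∧ u = 0 ∧ v = 0 := by
  have hcoeff := fun i => congrArg (fun B : A[X] => B.coeff i) h
  have hq0 : q ≠ 0 := by omega
  have hq1 : q ≠ 1 := by omega
  have c0 := hcoeff 0
  have c1 := hcoeff 1
  have cq := hcoeff q
  have cq1 := hcoeff (q + 1)
  simp only [coeff_add, coeff_C_mul, coeff_X_pow, coeff_X, coeff_C, coeff_zero] at c0 c1 cq cq1
  simp [hq0, hq0.symm, hq1.symm] at c0 c1 cq cq1
  exact ⟨cq1, cq, c1, c0⟩

/-- Every element of the stabilizer of `Q_∞` is of the form `[a, b, c, d]`. -/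
theorem exists_hasCoords (hF : IsGGK q n K x y z) {Q : ValuationSubring F} (hQ : IsPlace K Q)
    (hz : z ∉ Q) {g : F ≃ₐ[K] F} (hg : g ∈ Q.decompositionSubgroup K) :
    ∃ a b c d : K, HasCoords q n x y z g a b c d := by
  obtain ⟨p, k, hp, hk, hq, _, _⟩ := hF.exists_charP
  have hq1 := hF.one_lt
  obtain ⟨δ, hδ, -, hvy, hvx, hvz⟩ := exists_delta hF hz
  have hval := valuation_map hF hQ hz hg
  obtain ⟨a, b, hgy, hgz⟩ := exists_map_y_z hF hQ hz hg
  obtain ⟨e, A, B, hgx⟩ := exists_form_x hF (mem_span_of_valuation_le hF hQ hδ hvy hvx hvz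
    (map_mem_coordRing hF hQ hz hg (x_mem x y z)) (by rw [hval, hvx]))
  have ha : a ≠ 0 := by
    rintro rfl
    have h1 := hval y
    rw [hgy, map_zero, zero_mul, zero_add, hvy] at h1
    have h2 := valuation_algebraMap_le hQ b
    rw [h1] at h2
    have h3 : q * m q n ≠ 0 := Nat.mul_ne_zero (by omega) (m_pos hF.odd).ne'
    exact absurd h2 (not_le.2 (one_lt_pow₀ hδ h3))
  have hq2 : q + 1 < q ^ 2 := by nlinarith
  -- Replacing x^q by y^(q+1) - x puts the transformed Hermitian equation in normal form, since q +
  -- 1 < q². The coefficients of y^(q+1), y^q, y, 1 and x must all vanish.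
  have hH := eq_zero_of_eval₂_add_eq_zero hF hQ hz (D := C (e - e ^ q))
    (H := C (C (e ^ q - a ^ (q + 1))) * X ^ (q + 1) + C (A ^ q - C (a ^ q * b)) * X ^ q +
      C (A - C (a * b ^ q)) * X + C (B ^ q + B - C (b ^ (q + 1)))) (by
      refine lt_of_le_of_lt ?_ hq2
      refine natDegree_add_le_of_degree_le (natDegree_add_le_of_degree_le
        (natDegree_add_le_of_degree_le (natDegree_C_mul_X_pow_le _ _)
        ((natDegree_C_mul_X_pow_le _ _).trans (by omega)))
        ((natDegree_C_mul_le _ _).trans (natDegree_X_le.trans (by omega)))) ?_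
      rw [natDegree_C]
      omega) (by
      have h1 := congrArg g hF.hermitian
      rw [map_pow, map_add, map_pow, hgx, hgy, add_pow_q hp hq, add_pow_q hp hq, mul_pow, mul_pow,
        eq_sub_of_add_eq hF.hermitian,
        pow_succ (algebraMap K F a * y + algebraMap K F b) q,
        add_pow_q hp hq (algebraMap K F a * y), mul_pow] at h1
      rw [← sub_eq_zero] at h1
      rw [← h1]
      simp only [eval₂_add, eval₂_mul, eval₂_X, eval₂_C, eval₂_pow, AlgHom.toRingHom_eq_coe,
        RingHom.coe_coe]
      simp only [map_sub, map_add, map_mul, map_pow, aeval_C]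
      ring)
  obtain ⟨hH, he⟩ := hH
  obtain ⟨cq1, cq, c1, c0⟩ := coeff_eq_zero_of_eq_zero hq1 hH
  have hA : A = C (a * b ^ q) := sub_eq_zero.1 c1
  have heq : e ^ q = a ^ (q + 1) := by
    exact sub_eq_zero.1 (C_eq_zero.1 cq1)
  have hee : e = e ^ q := sub_eq_zero.1 (C_eq_zero.1 he)
  have hea : e = a ^ (q + 1) := hee.trans heq
  have hb2 : b ^ q ^ 2 = b := by
    have h1 : (a * b ^ q) ^ q = a ^ q * b := by
      rw [hA, ← C_pow] at cq
      exact C_injective (sub_eq_zero.1 cq)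
    rw [mul_pow, ← pow_mul, ← sq] at h1
    exact mul_left_cancel₀ (pow_ne_zero _ ha) h1
  have ha2 : a ^ q ^ 2 = a := by
    have h1 : (a ^ (q + 1)) ^ q = a ^ (q + 1) := by rw [← hea, ← hee]
    have h2 : a ^ q * a ^ q ^ 2 = a ^ q * a := by
      rw [← pow_succ, ← h1, ← pow_mul, ← pow_add]
      congr 1
      ring
    exact mul_left_cancel₀ (pow_ne_zero _ ha) h2
  have hB : B ^ q = C (b ^ (q + 1)) - B := by
    exact eq_sub_of_add_eq (sub_eq_zero.1 c0)
  obtain ⟨c, rfl⟩ := eq_C_of_pow_eq hq1 hB (by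
    refine (natDegree_sub_le _ _).trans ?_
    rw [natDegree_C]
    simp)
  have hc : c ^ q + c = b ^ (q + 1) := by
    refine C_injective ?_
    rw [map_add, C_pow, hB]
    ring
  have hc2 : c ^ q ^ 2 = c := by
    have h1 : (c ^ q + c) ^ q = c ^ q + c := by
      rw [hc, ← pow_mul, add_mul, pow_add, ← sq, hb2, one_mul, pow_succ, mul_comm]
    rw [add_pow_q hp hq, ← pow_mul, ← sq, add_comm (c ^ q)] at h1
    exact add_right_cancel h1
  -- For n = 1 the exponent m is 1, so z = y^(q²) - y and d = a.
  have hgz' : ∃ d : K, g z = algebraMap K F d * z := by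
    by_cases hn1 : n = 1
    · refine ⟨a, ?_⟩
      subst hn1
      have hm1 : m q 1 = 1 := by simp [m]
      have hk1 := hF.kummer
      rw [hm1, pow_one] at hk1
      rw [hk1, map_sub, map_pow, hgy, add_pow_q_sq hp hq, mul_pow, ← map_pow, ← map_pow, ha2, hb2]
      ring
    · exact hgz hn1
  obtain ⟨d, hgz⟩ := hgz'
  have hz0 : z ≠ 0 := by
    rintro rfl
    exact hz Q.zero_mem
  have hd : d ^ m q n = a := by
    have h1 := congrArg g hF.kummer
    rw [map_pow, map_sub, map_pow, hgz, hgy, add_pow_q_sq hp hq, mul_pow, mul_pow, ← map_pow,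
      ← map_pow, ← map_pow, ha2, hb2] at h1
    have h2 : algebraMap K F (d ^ m q n) * z ^ m q n = algebraMap K F a * z ^ m q n := by
      rw [h1, hF.kummer]; ring
    exact (algebraMap K F).injective (mul_right_cancel₀ (pow_ne_zero _ hz0) h2)
  refine ⟨a, b, c, d, ha, ha2, hb2, hc2, hc, hd, ?_, hgy, hgz⟩
  rw [hgx, hea, hA, aeval_C, aeval_C]

end GGK

/-! ### The order of g τ - τ at the pole -/

namespace GGK

variable {K F : Type*} [Field K] [Field F] [Algebra K F] {q n : ℕ} {x y z : F}

section Order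

variable {Q : ValuationSubring F} {δ : Q.ValueGroup}

theorem ord_div_eq (hF : IsGGK q n K x y z) (hQ : IsPlace K Q) (hz : z ∉ Q) (hδ : 1 < δ)
    (hτ : Q.valuation (tau q n x y z) = δ⁻¹) {f g : F} {i j : ℕ} (hf : Q.valuation f = δ ^ i)
    (hg : Q.valuation g = δ ^ j) : ord Q (f / g) = ((j - i : ℤ) : WithTop ℤ) := by
  refine ord_eq (isUniformizer_tau hF hQ hz) ?_
  have h0 := (zero_lt_one.trans hδ).ne'
  rw [hτ, map_div₀, hf, hg, inv_zpow', neg_sub, zpow_sub₀ h0, zpow_natCast, zpow_natCast]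

theorem valuation_smul_add (hQ : IsPlace K Q) {c : K} (hc : c ≠ 0) {f r : F}
    (h : Q.valuation r < Q.valuation f) :
    Q.valuation (algebraMap K F c * f + r) = Q.valuation f := by
  have h1 : Q.valuation (algebraMap K F c * f) = Q.valuation f := by
    rw [map_mul, valuation_algebraMap hQ hc, one_mul]
  rw [Q.valuation.map_add_eq_of_lt_left (by rwa [h1]), h1]

theorem valuation_smul_lt (hQ : IsPlace K Q) (c : K) {f : F} {i j : ℕ} (hδ : 1 < δ)
    (h : Q.valuation f = δ ^ i) (hij : i < j) : Q.valuation (algebraMap K F c * f) < δ ^ j := by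
  rw [map_mul, h]
  exact (mul_le_of_le_one_left zero_le (valuation_algebraMap_le hQ c)).trans_lt
    (pow_lt_pow_right₀ hδ hij)

/-- The norm a^(q+1) lies in 𝔽_q, hence so does d. Then d = a^(q+1) = d^(q^n+1) = d². This shows
that the leading coefficient of the numerator of g τ - τ vanishes only for d = 1. -/
theorem eq_one_of_pow_eq {p k : ℕ} (hp : p.Prime) (hq : q = p ^ k) [CharP K p] (hn : Odd n)
    {a d : K} (ha0 : a ≠ 0) (ha : a ^ q ^ 2 = a) (hd : d ^ m q n = a) {t : ℕ}
    (h : d ^ q ^ t = a ^ (q + 1)) : d = 1 := by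
  have hinj : ∀ (t : ℕ) (u v : K), u ^ q ^ t = v ^ q ^ t → u = v := by
    intro t
    induction t with
    | zero => intro u v h; simpa using h
    | succ t ih =>
      intro u v h
      rw [pow_succ, pow_mul, pow_mul] at h
      exact ih _ _ (pow_q_injective hp hq h)
  have hdq : d ^ q = d := by
    refine hinj t _ _ ?_
    rw [pow_right_comm, h, ← pow_mul, add_mul, pow_add, ← sq, ha, one_mul, pow_succ', mul_comm]
  have hdt : ∀ t, d ^ q ^ t = d := by
    intro t
    induction t with
    | zero => simp
    | succ t ih => rw [pow_succ, pow_mul, ih, hdq]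
  have hd0 : d ≠ 0 := by
    rintro rfl
    rw [zero_pow (m_pos hn).ne'] at hd
    exact ha0 hd.symm
  rw [hdt, ← hd, ← pow_mul, mul_comm, succ_mul_m hn, pow_succ, hdt] at h
  exact (mul_left_cancel₀ hd0 (h.symm.trans (mul_one d).symm))

theorem x_ne_zero (hF : IsGGK q n K x y z) : x ≠ 0 := fun h => hF.transcendental (h ▸ isAlgebraic_zero)

/-- The denominator x · g x has pole order 2(q^n + 1). The numerator is z^(q^(n-3)) times a
K-combination of x, y, 1 for n ≥ 3, and a K-combination of xy, y², x, y for n = 1; its first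
surviving term dominates. -/
theorem ord_map_tau_sub (hF : IsGGK q n K x y z) (hQ : IsPlace K Q) (hz : z ∉ Q)
    {g : F ≃ₐ[K] F} (hg : g ∈ Q.decompositionSubgroup K) {a b c d : K}
    (h : HasCoords q n x y z g a b c d) :
    (d ≠ 1 → ord Q (g (tau q n x y z) - tau q n x y z) = ((1 : ℤ) : WithTop ℤ)) ∧
    (d = 1 → b ≠ 0 →
      ord Q (g (tau q n x y z) - tau q n x y z) = ((m q n + 1 : ℤ) : WithTop ℤ)) ∧
    (d = 1 → b = 0 → c ≠ 0 →
      ord Q (g (tau q n x y z) - tau q n x y z) = ((q ^ n + 2 : ℤ) : WithTop ℤ)) := by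
  obtain ⟨p, k, hp, hk, hq, _, _⟩ := hF.exists_charP
  have hq1 := hF.one_lt
  obtain ⟨δ, hδ, hτ, hvy, hvx, hvz⟩ := exists_delta hF hz
  have hgx : Q.valuation (g x) = δ ^ ((q + 1) * m q n) := by rw [valuation_map hF hQ hz hg, hvx]
  have hx0 := x_ne_zero hF
  have hgx0 : g x ≠ 0 := by simpa using hx0
  have hm := m_pos (q := q) hF.odd
  have hmq := succ_mul_m (q := q) hF.odd
  have hmqZ : ((q : ℤ) + 1) * m q n = q ^ n + 1 := by exact_mod_cast hmq
  have hden : Q.valuation (x * g x) = δ ^ (2 * ((q + 1) * m q n)) := by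
    rw [map_mul, hvx, hgx, ← pow_add, two_mul]
  have ha1 : d = 1 → a = 1 := fun hd => by rw [← h.d_pow, hd, one_pow]
  by_cases hn : n = 1
  · subst hn
    have hm1 : m q 1 = 1 := by simp [m]
    have had : a = d := by rw [← h.d_pow, hm1, pow_one]
    have hτg : g (tau q 1 x y z) - tau q 1 x y z = (algebraMap K F (a - a ^ (q + 1)) * (x * y) +
        (algebraMap K F (-(a * b ^ q)) * y ^ 2 +
          (algebraMap K F b * x + algebraMap K F (-c) * y))) / (x * g x) := by
      rw [tau, if_pos rfl, map_div₀, div_sub_div _ _ hgx0 hx0, mul_comm (g x) x]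
      congr 1
      rw [h.map_x, h.map_y]
      simp only [map_sub, map_neg, map_mul, map_pow]
      ring
    rw [hm1, mul_one] at hvy hvx
    have hxy : Q.valuation (x * y) = δ ^ (2 * q + 1) := by
      rw [map_mul, hvx, hvy, ← pow_add]; congr 1; ring
    have hyy : Q.valuation (y ^ 2) = δ ^ (2 * q) := by
      rw [map_pow, hvy, ← pow_mul, mul_comm]
    rw [hτg]
    refine ⟨fun hd => ?_, fun hd hb => ?_, fun hd hb hc => ?_⟩
    · rw [ord_div_eq hF hQ hz hδ hτ (i := 2 * q + 1) ?_ hden]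
      · rw [hm1]; rw [WithTop.coe_inj]; push_cast; ring
      rw [valuation_smul_add hQ, hxy]
      · rw [pow_succ', sub_ne_zero]
        intro hcon
        refine hd (had ▸ ?_)
        have : a ^ q = 1 ^ q := by
          rw [one_pow]
          exact mul_left_cancel₀ h.a_ne_zero (hcon.symm.trans (mul_one a).symm)
        exact pow_q_injective hp hq this
      · rw [hxy]
        refine Q.valuation.map_add_lt (valuation_smul_lt hQ _ hδ hyy (by omega)) ?_
        exact Q.valuation.map_add_lt (valuation_smul_lt hQ _ hδ hvx (by omega))
          (valuation_smul_lt hQ _ hδ hvy (by omega))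
    · rw [ha1 hd, one_pow, sub_self, map_zero, zero_mul, zero_add, one_mul]
      rw [ord_div_eq hF hQ hz hδ hτ (i := 2 * q) ?_ hden]
      · rw [hm1]; rw [WithTop.coe_inj]; push_cast; ring
      rw [valuation_smul_add hQ (neg_ne_zero.2 (pow_ne_zero _ hb)), hyy]
      rw [hyy]
      exact Q.valuation.map_add_lt (valuation_smul_lt hQ _ hδ hvx (by omega))
          (valuation_smul_lt hQ _ hδ hvy (by omega))
    · rw [ha1 hd, one_pow, sub_self, map_zero, zero_mul, zero_add, one_mul, hb,
        zero_pow (by omega), neg_zero, map_zero, zero_mul, zero_mul, zero_add, zero_add]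
      rw [ord_div_eq hF hQ hz hδ hτ (i := q) ?_ hden]
      · rw [hm1]; rw [WithTop.coe_inj]; push_cast; ring
      rw [map_mul, valuation_algebraMap hQ (neg_ne_zero.2 hc), one_mul, hvy]
  · have hn3 : n - 3 + 3 = n := by
      have := hF.odd
      rcases this with ⟨k, rfl⟩
      omega
    have hτg : g (tau q n x y z) - tau q n x y z = z ^ q ^ (n - 3) *
        (algebraMap K F (d ^ q ^ (n - 3) - a ^ (q + 1)) * x +
        (algebraMap K F (-(a * b ^ q)) * y + algebraMap K F (-c) * 1)) / (x * g x) := by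
      rw [tau, if_neg hn, map_div₀, div_sub_div _ _ hgx0 hx0, mul_comm (g x) x, map_pow]
      congr 1
      rw [h.map_x, h.map_z]
      simp only [map_sub, map_neg, map_mul, map_pow]
      ring
    have hze : Q.valuation (z ^ q ^ (n - 3)) = δ ^ q ^ n := by
      rw [map_pow, hvz, ← pow_mul, ← pow_add, add_comm, hn3]
    have hv1 : Q.valuation (1 : F) = δ ^ 0 := by simp
    have hqm : 0 < q * m q n := Nat.mul_pos (by omega) hm
    have hqm1 : q * m q n < (q + 1) * m q n := by rw [add_mul]; omega
    rw [hτg]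
    refine ⟨fun hd => ?_, fun hd hb => ?_, fun hd hb hc => ?_⟩
    · rw [ord_div_eq hF hQ hz hδ hτ (i := q ^ n + (q + 1) * m q n) ?_ hden]
      · rw [WithTop.coe_inj]; push_cast; linarith
      rw [map_mul, hze, valuation_smul_add hQ, hvx, pow_add]
      · rw [sub_ne_zero]
        exact fun hcon => hd (eq_one_of_pow_eq hp hq hF.odd h.a_ne_zero h.a_mem h.d_pow hcon)
      · rw [hvx]
        exact Q.valuation.map_add_lt (valuation_smul_lt hQ _ hδ hvy hqm1)
          (valuation_smul_lt hQ _ hδ hv1 (by omega))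
    · rw [ha1 hd, hd, one_pow, one_pow, sub_self, map_zero, zero_mul, zero_add, one_mul]
      rw [ord_div_eq hF hQ hz hδ hτ (i := q ^ n + q * m q n) ?_ hden]
      · rw [WithTop.coe_inj]; push_cast; linarith
      rw [map_mul, hze, valuation_smul_add hQ (neg_ne_zero.2 (pow_ne_zero _ hb)), hvy, pow_add]
      rw [hvy]
      exact valuation_smul_lt hQ _ hδ hv1 hqm
    · rw [ha1 hd, hd, one_pow, one_pow, sub_self, map_zero, zero_mul, zero_add, one_mul, hb,
        zero_pow (by omega), neg_zero, map_zero, zero_mul, zero_add]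
      rw [ord_div_eq hF hQ hz hδ hτ (i := q ^ n) ?_ hden]
      · rw [WithTop.coe_inj]; push_cast; linarith
      rw [map_mul, hze, map_mul, valuation_algebraMap hQ (neg_ne_zero.2 hc), one_mul, map_one,
        mul_one]

end Order

end GGK

/-! ### The zeros of z: z as a local parameter, the places Q_{αβ} -/

namespace GGK

open Polynomial Pointwise

variable {K F : Type*} [Field K] [Field F] [Algebra K F] {q n : ℕ} {x y z : F}

/-- R is integral over K[z], and a nonzero algebraic element of a domain divides a nonzero element
of the base, playing the role of a norm. -/
theorem exists_mul_eq_aeval (hF : IsGGK q n K x y z) {r : coordRing K x y z} (hr : r ≠ 0) :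
    ∃ (D : K[X]) (s : coordRing K x y z), D ≠ 0 ∧
      r * s = aeval (⟨z, z_mem x y z⟩ : coordRing K x y z) D := by
  let _ : Algebra K[X] (coordRing K x y z) :=
    (aeval (⟨z, z_mem x y z⟩ : coordRing K x y z) : K[X] →ₐ[K] _).toRingHom.toAlgebra
  have halg : IsAlgebraic K[X] r := by
    have : IsIntegral K[X] r := isIntegral_aeval hF r
    exact this.isAlgebraic
  obtain ⟨D, hD0, s, hs⟩ := halg.exists_nonzero_dvd (mem_nonZeroDivisors_of_ne_zero hr)
  exact ⟨D, s, hD0, hs.symm⟩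

section Center

variable {φ : coordRing K x y z →ₐ[K] K}

/-- Near a zero of `z`, every element of `K[x, y, z]` that vanishes there is a multiple
of `z`. -/
theorem exists_mul_eq_z_mul (hF : IsGGK q n K x y z) (hz : φ ⟨z, z_mem x y z⟩ = 0)
    (r : coordRing K x y z) :
    ∃ w s : coordRing K x y z, φ w ≠ 0 ∧ w * (r - algebraMap K _ (φ r)) = ⟨z, z_mem x y z⟩ * s := by
  have hq := hF.one_lt
  have hq2 := Nat.one_lt_pow two_ne_zero hq
  obtain ⟨p, k, hp, hk, hqp, _, _⟩ := hF.exists_charP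
  have : CharP (coordRing K x y z) p :=
    charP_of_injective_algebraMap (algebraMap K (coordRing K x y z)).injective p
  set zR : coordRing K x y z := ⟨z, z_mem x y z⟩
  set xR : coordRing K x y z := ⟨x, x_mem x y z⟩
  set yR : coordRing K x y z := ⟨y, y_mem x y z⟩
  have hher : xR ^ q + xR = yR ^ (q + 1) := Subtype.ext hF.hermitian
  have hkum : zR ^ m q n = yR ^ q ^ 2 - yR := Subtype.ext hF.kummer
  have hm := m_pos (q := q) hF.odd
  -- As β^(q²) = β, the Kummer equation factors as (y - β)((y - β)^(q²-1) - 1) = z^m, and the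
  -- cofactor takes the value -1.
  have hy : ∃ w s, φ w ≠ 0 ∧ w * (yR - algebraMap K _ (φ yR)) = zR * s := by
    set β := φ yR with hβ
    have hβ2 : β ^ q ^ 2 = β := by
      have := congrArg φ hkum
      rw [map_pow, hz, zero_pow hm.ne', map_sub, map_pow] at this
      exact (sub_eq_zero.1 this.symm)
    refine ⟨(yR - algebraMap K _ β) ^ (q ^ 2 - 1) - 1, zR ^ (m q n - 1), ?_, ?_⟩
    · have : φ (yR - algebraMap K _ β) = 0 := by
        rw [map_sub, AlgHom.commutes, ← hβ]; exact sub_self _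
      rw [map_sub, map_pow, this, map_one, zero_pow (by omega)]
      simp
    · rw [mul_pow_sub_one hm.ne', hkum, sub_mul, ← pow_succ, Nat.sub_add_cancel hq2.le, one_mul,
        sq, pow_mul, sub_pow_q hp hqp, sub_pow_q hp hqp, ← pow_mul, ← pow_mul, ← sq, ← map_pow, hβ2]
      ring
  -- Here (x - α)((x - α)^(q-1) + 1) = y^(q+1) - β^(q+1) is a multiple of y - β, which reduces x to
  -- y.
  have hx : ∃ w s, φ w ≠ 0 ∧ w * (xR - algebraMap K _ (φ xR)) = zR * s := by
    obtain ⟨w, s, hw, hws⟩ := hy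
    set α := φ xR with hα
    set β := φ yR with hβ
    have hαβ : α ^ q + α = β ^ (q + 1) := by
      have := congrArg φ hher
      rwa [map_add, map_pow, map_pow] at this
    refine ⟨w * ((xR - algebraMap K _ α) ^ (q - 1) + 1),
      s * (yR ^ q + algebraMap K _ β * (yR - algebraMap K _ β) ^ (q - 1)), ?_, ?_⟩
    · have : φ (xR - algebraMap K _ α) = 0 := by
        rw [map_sub, AlgHom.commutes, ← hα]; exact sub_self _
      rw [map_mul, map_add, map_pow, this, map_one, zero_pow (by omega)]
      simpa using hw
    · have e1 : ((xR - algebraMap K _ α) ^ (q - 1) + 1) * (xR - algebraMap K _ α) =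
          yR ^ (q + 1) - algebraMap K _ (β ^ (q + 1)) := by
        rw [add_mul, ← pow_succ, Nat.sub_add_cancel hq.le, sub_pow_q hp hqp, one_mul, ← hher,
          ← hαβ, map_add, map_pow]
        ring
      have e2 : (yR - algebraMap K _ β) * (yR ^ q + algebraMap K _ β *
          (yR - algebraMap K _ β) ^ (q - 1)) = yR ^ (q + 1) - algebraMap K _ (β ^ (q + 1)) := by
        have : (yR - algebraMap K _ β) * (yR - algebraMap K _ β) ^ (q - 1) =
            yR ^ q - algebraMap K _ β ^ q := by
          rw [← pow_succ', Nat.sub_add_cancel hq.le, sub_pow_q hp hqp]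
        rw [mul_add, mul_left_comm, this, map_pow]
        ring
      rw [mul_assoc, e1, ← e2, ← mul_assoc, hws, mul_assoc]
  obtain ⟨r, hr⟩ := r
  induction hr using Algebra.adjoin_induction with
  | mem w hw =>
    rcases hw with rfl | rfl | rfl
    · exact hx
    · exact hy
    · exact ⟨1, 1, by simp, by rw [hz, map_zero, sub_zero, one_mul, mul_one]⟩
  | algebraMap c =>
    refine ⟨1, 0, by simp, ?_⟩
    have : (⟨algebraMap K F c, Subalgebra.algebraMap_mem _ c⟩ : coordRing K x y z) =
      algebraMap K _ c := rfl
    rw [this, AlgHom.commutes]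
    simp
  | add a b ha hb iha ihb =>
    obtain ⟨w, s, hw, hws⟩ := iha
    obtain ⟨w', s', hw', hws'⟩ := ihb
    refine ⟨w * w', s * w' + s' * w, by rw [map_mul]; exact mul_ne_zero hw hw', ?_⟩
    have : (⟨a + b, add_mem ha hb⟩ : coordRing K x y z) = ⟨a, ha⟩ + ⟨b, hb⟩ := rfl
    rw [this, map_add, map_add]
    linear_combination w' * hws + w * hws'
  | mul a b ha hb iha ihb =>
    obtain ⟨w, s, hw, hws⟩ := iha
    obtain ⟨w', s', hw', hws'⟩ := ihb
    have : (⟨a * b, mul_mem ha hb⟩ : coordRing K x y z) = ⟨a, ha⟩ * ⟨b, hb⟩ := rfl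
    rw [this, map_mul, map_mul]
    refine ⟨w * w', s * w' * ⟨b, hb⟩ + s' * w * algebraMap K _ (φ ⟨a, ha⟩),
      by rw [map_mul]; exact mul_ne_zero hw hw', ?_⟩
    linear_combination w' * ⟨b, hb⟩ * hws + w * algebraMap K _ (φ ⟨a, ha⟩) * hws'

/-- Near a zero of `z`, every nonzero element of `K[x, y, z]` is a unit times a power of `z`. -/
theorem exists_mul_eq_z_pow_mul (hF : IsGGK q n K x y z) (hz : φ ⟨z, z_mem x y z⟩ = 0)
    (hz0 : z ≠ 0) {r : coordRing K x y z} (hr : r ≠ 0) :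
    ∃ (j : ℕ) (w u : coordRing K x y z), φ w ≠ 0 ∧ φ u ≠ 0 ∧
      w * r = ⟨z, z_mem x y z⟩ ^ j * u := by
  set zR : coordRing K x y z := ⟨z, z_mem x y z⟩
  have hzR : zR ≠ 0 := fun h => hz0 (congrArg Subtype.val h)
  -- Each time r vanishes at the point, a factor z can be split off; as r divides z^k times a local
  -- unit, this stops after at most k steps.
  have key : ∀ (k : ℕ) (r s D : coordRing K x y z), φ D ≠ 0 → r * s = zR ^ k * D →
      ∃ (j : ℕ) (w u : coordRing K x y z), φ w ≠ 0 ∧ φ u ≠ 0 ∧ w * r = zR ^ j * u := by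
    intro k
    induction k with
    | zero =>
      intro r s D hD h
      refine ⟨0, 1, r, by simp, fun h0 => hD ?_, by simp⟩
      have := congrArg φ h
      rw [pow_zero, one_mul, map_mul, h0, zero_mul] at this
      exact this.symm
    | succ k ih =>
      intro r s D hD h
      by_cases hr0 : φ r = 0
      · obtain ⟨w, t, hw, hwt⟩ := exists_mul_eq_z_mul hF hz r
        rw [hr0, map_zero, sub_zero] at hwt
        have h1 : t * s = zR ^ k * (w * D) := by
          refine mul_left_cancel₀ hzR ?_
          linear_combination w * h - s * hwt
        obtain ⟨j, w', u, hw', hu, e⟩ := ih t s (w * D) (by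
          rw [map_mul]; exact mul_ne_zero hw hD) h1
        refine ⟨j + 1, w' * w, u, by rw [map_mul]; exact mul_ne_zero hw' hw, hu, ?_⟩
        linear_combination w' * hwt + zR * e
      · exact ⟨0, 1, r, by simp, hr0, by simp⟩
  obtain ⟨D, s, hD0, hs⟩ := exists_mul_eq_aeval hF hr
  obtain ⟨D', hD, hdvd⟩ := exists_eq_pow_rootMultiplicity_mul_and_not_dvd D hD0 0
  rw [C_0, sub_zero] at hD hdvd
  refine key (rootMultiplicity 0 D) r s (aeval zR D') ?_ ?_
  · rw [← aeval_algHom_apply, hz]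
    intro h0
    refine hdvd ?_
    rw [X_dvd_iff, ← coeff_zero_eq_aeval_zero] at *
    exact h0
  · rw [hs]
    conv_lhs => rw [hD]
    rw [map_mul, map_pow, aeval_X]

end Center

section Place

variable {P P' : ValuationSubring F} {α β : K}

theorem valuation_z_lt_one (hF : IsGGK q n K x y z) (hβ : β ^ q ^ 2 = β)
    (hy : P.valuation (y - algebraMap K F β) < 1) : P.valuation z < 1 := by
  obtain ⟨p, k, hp, hk, hqp, _, _⟩ := hF.exists_charP
  have hq2 := Nat.one_lt_pow two_ne_zero hF.one_lt
  have e : z ^ m q n = (y - algebraMap K F β) ^ q ^ 2 - (y - algebraMap K F β) := by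
    rw [sq, pow_mul, sub_pow_q hp hqp, sub_pow_q hp hqp, ← pow_mul, ← pow_mul, ← sq, ← map_pow, hβ,
      hF.kummer]
    ring
  have h1 : P.valuation (z ^ m q n) < 1 := by
    rw [e]
    refine P.valuation.map_sub_lt ?_ hy
    rw [map_pow]
    exact pow_lt_one₀ zero_le hy (by omega)
  rw [map_pow] at h1
  by_contra h
  exact absurd h1 (not_lt.2 (one_le_pow₀ (not_lt.1 h)))

theorem exists_center (hF : IsGGK q n K x y z) {Q : ValuationSubring F} (hQ : IsPlace K Q)
    (hzQ : z ∉ Q) (hβ : β ^ q ^ 2 = β) (hαβ : α ^ q + α = β ^ (q + 1)) :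
    ∃ φ : coordRing K x y z →ₐ[K] K, φ ⟨x, x_mem x y z⟩ = α ∧ φ ⟨y, y_mem x y z⟩ = β ∧
      φ ⟨z, z_mem x y z⟩ = 0 :=
  exists_algHom_coordRing hF.one_lt hF.hermitian hF.kummer (linearIndependent_mono hF hQ hzQ) hαβ
    (by rw [hβ, sub_self, zero_pow (m_pos hF.odd).ne'])

/-- Existence of the place `Q_{αβ}`. -/
theorem exists_place (hF : IsGGK q n K x y z) {Q : ValuationSubring F} (hQ : IsPlace K Q)
    (hzQ : z ∉ Q) (hβ : β ^ q ^ 2 = β) (hαβ : α ^ q + α = β ^ (q + 1)) :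
    ∃ P : ValuationSubring F, IsPlace K P ∧ P.valuation (x - algebraMap K F α) < 1 ∧
      P.valuation (y - algebraMap K F β) < 1 := by
  obtain ⟨φ, hx, hy, hz⟩ := exists_center hF hQ hzQ hβ hαβ
  obtain ⟨P, hP, hI⟩ := Ideal.image_subset_nonunits_valuationSubring
    (A := (coordRing K x y z).toSubring) (RingHom.ker φ.toRingHom) (RingHom.ker_ne_top _)
  have hlt : ∀ r : coordRing K x y z, φ r = 0 → P.valuation (r : F) < 1 := by
    intro r hr
    exact (ValuationSubring.mem_nonunits_iff P).1 (hI ⟨r, hr, rfl⟩)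
  refine ⟨P, ⟨fun c => hP (Subalgebra.algebraMap_mem (coordRing K x y z) c), ?_⟩, ?_, ?_⟩
  -- The trivial valuation ring is excluded because z is nonzero and has value less than 1.
  · rintro rfl
    have h1 := hlt ⟨z, z_mem x y z⟩ hz
    have h2 : (⊤ : ValuationSubring F).valuation z⁻¹ ≤ 1 :=
      (ValuationSubring.valuation_le_one_iff _ _).2 trivial
    have hz0 : z ≠ 0 := by rintro rfl; exact hzQ Q.zero_mem
    rw [map_inv₀] at h2
    have h0 : (⊤ : ValuationSubring F).valuation z ≠ 0 := (Valuation.ne_zero_iff _).2 hz0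
    exact absurd h1 (not_lt.2 ((inv_le_one₀ (zero_lt_iff.2 h0)).1 h2))
  · refine hlt (⟨x, x_mem x y z⟩ - algebraMap K _ α) ?_
    rw [map_sub, hx, AlgHom.commutes]; exact sub_self _
  · refine hlt (⟨y, y_mem x y z⟩ - algebraMap K _ β) ?_
    rw [map_sub, hy, AlgHom.commutes]; exact sub_self _

/-- The value of `r ∈ K[x, y, z]` at the place `Q_{αβ}`. -/
theorem valuation_sub_lt_one (hF : IsGGK q n K x y z) {φ : coordRing K x y z →ₐ[K] K}
    (hP : IsPlace K P) (hβ : β ^ q ^ 2 = β) (hφx : φ ⟨x, x_mem x y z⟩ = α)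
    (hφy : φ ⟨y, y_mem x y z⟩ = β) (hφz : φ ⟨z, z_mem x y z⟩ = 0)
    (hx : P.valuation (x - algebraMap K F α) < 1) (hy : P.valuation (y - algebraMap K F β) < 1)
    (r : coordRing K x y z) : P.valuation ((r : F) - algebraMap K F (φ r)) < 1 := by
  have hz := valuation_z_lt_one hF hβ hy
  have hR : ∀ r ∈ coordRing K x y z, r ∈ P := fun r hr =>
    coordRing_subset hF hP.1 ((P.valuation_le_one_iff z).1 hz.le) hr
  obtain ⟨r, hr⟩ := r
  induction hr using Algebra.adjoin_induction with
  | mem w hw =>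
    rcases hw with rfl | rfl | rfl
    · rwa [hφx]
    · rwa [hφy]
    · rwa [hφz, map_zero, sub_zero]
  | algebraMap c =>
    have : (⟨algebraMap K F c, Subalgebra.algebraMap_mem _ c⟩ : coordRing K x y z) =
      algebraMap K _ c := rfl
    rw [this, AlgHom.commutes]
    simp
  | add a b ha hb iha ihb =>
    have : (⟨a + b, add_mem ha hb⟩ : coordRing K x y z) = ⟨a, ha⟩ + ⟨b, hb⟩ := rfl
    rw [this, map_add, map_add]
    have e : ((⟨a, ha⟩ + ⟨b, hb⟩ : coordRing K x y z) : F) -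
      (algebraMap K F (φ ⟨a, ha⟩) + algebraMap K F (φ ⟨b, hb⟩)) =
      (a - algebraMap K F (φ ⟨a, ha⟩)) + (b - algebraMap K F (φ ⟨b, hb⟩)) := by
      rw [← this]; ring
    rw [e]
    exact P.valuation.map_add_lt iha ihb
  | mul a b ha hb iha ihb =>
    have : (⟨a * b, mul_mem ha hb⟩ : coordRing K x y z) = ⟨a, ha⟩ * ⟨b, hb⟩ := rfl
    rw [this, map_mul, map_mul]
    have e : ((⟨a, ha⟩ * ⟨b, hb⟩ : coordRing K x y z) : F) -
      (algebraMap K F (φ ⟨a, ha⟩) * algebraMap K F (φ ⟨b, hb⟩)) =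
      b * (a - algebraMap K F (φ ⟨a, ha⟩)) +
        algebraMap K F (φ ⟨a, ha⟩) * (b - algebraMap K F (φ ⟨b, hb⟩)) := by
      rw [← this]; ring
    rw [e]
    refine P.valuation.map_add_lt ?_ ?_
    · rw [map_mul]
      exact (mul_le_of_le_one_left zero_le ((P.valuation_le_one_iff _).2 (hR b hb))).trans_lt iha
    · rw [map_mul]
      exact (mul_le_of_le_one_left zero_le (valuation_algebraMap_le hP _)).trans_lt ihb

/-- Uniqueness of the place `Q_{αβ}`. -/
theorem place_le (hF : IsGGK q n K x y z) {Q : ValuationSubring F} (hQ : IsPlace K Q)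
    (hzQ : z ∉ Q) (hβ : β ^ q ^ 2 = β) (hαβ : α ^ q + α = β ^ (q + 1))
    (hP : IsPlace K P) (hx : P.valuation (x - algebraMap K F α) < 1)
    (hy : P.valuation (y - algebraMap K F β) < 1)
    (hP' : IsPlace K P') (hx' : P'.valuation (x - algebraMap K F α) < 1)
    (hy' : P'.valuation (y - algebraMap K F β) < 1) : P ≤ P' := by
  obtain ⟨φ, hφx, hφy, hφz⟩ := exists_center hF hQ hzQ hβ hαβ
  have hz0 : z ≠ 0 := by rintro rfl; exact hzQ Q.zero_mem
  have hunit : ∀ P : ValuationSubring F, IsPlace K P → P.valuation (x - algebraMap K F α) < 1 →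
      P.valuation (y - algebraMap K F β) < 1 → ∀ r : coordRing K x y z, φ r ≠ 0 →
      P.valuation (r : F) = 1 := by
    intro P hP hx hy r hr
    have h1 := valuation_sub_lt_one hF hP hβ hφx hφy hφz hx hy r
    have h2 := valuation_algebraMap hP hr
    have e : (r : F) = algebraMap K F (φ r) + (r - algebraMap K F (φ r)) := by ring
    rw [e, P.valuation.map_add_eq_of_lt_left (by rwa [h2]), h2]
  have hpow : ∀ r : coordRing K x y z, r ≠ 0 → ∃ j : ℕ, ∀ P : ValuationSubring F, IsPlace K P →
      P.valuation (x - algebraMap K F α) < 1 → P.valuation (y - algebraMap K F β) < 1 →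
      P.valuation (r : F) = P.valuation z ^ j := by
    intro r hr
    obtain ⟨j, w, u, hw, hu, h⟩ := exists_mul_eq_z_pow_mul hF hφz hz0 hr
    refine ⟨j, fun P hP hx hy => ?_⟩
    have h1 := congrArg (fun s : coordRing K x y z => P.valuation (s : F)) h
    simp only [MulMemClass.coe_mul, SubmonoidClass.coe_pow, map_mul, map_pow,
      hunit P hP hx hy w hw, hunit P hP hx hy u hu, one_mul, mul_one] at h1
    exact h1
  intro f hf
  by_cases hf0 : f = 0
  · rw [hf0]; exact P'.zero_mem
  obtain ⟨a, ha, b, hb, rfl⟩ := exists_eq_div hF f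
  obtain ⟨i, hi⟩ := hpow ⟨a, ha⟩ (by rintro h; simp [show a = 0 from congrArg Subtype.val h] at hf0)
  obtain ⟨j, hj⟩ := hpow ⟨b, hb⟩ (by rintro h; simp [show b = 0 from congrArg Subtype.val h] at hf0)
  have hmem : ∀ P : ValuationSubring F, IsPlace K P → P.valuation (x - algebraMap K F α) < 1 →
      P.valuation (y - algebraMap K F β) < 1 → (a / b ∈ P ↔ j ≤ i) := by
    intro P hP hx hy
    have hzP := valuation_z_lt_one hF hβ hy
    have h0 : 0 < P.valuation z := zero_lt_iff.2 ((Valuation.ne_zero_iff _).2 hz0)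
    rw [← P.valuation_le_one_iff, map_div₀, hi P hP hx hy, hj P hP hx hy,
      div_le_one₀ (pow_pos h0 _)]
    exact pow_le_pow_iff_right_of_lt_one₀ h0 hzP
  exact (hmem P' hP' hx' hy').2 ((hmem P hP hx hy).1 hf)

end Place

end GGK

/-! ### Fixed places as fixed points of an affine map -/

namespace GGK

open Pointwise

variable {K F : Type*} [Field K] [Field F] [Algebra K F] {q n : ℕ} {x y z : F}

theorem valuation_smul_lt_one_iff (P : ValuationSubring F) (g : F ≃ₐ[K] F) (f : F) :
    (g • P).valuation (g f) < 1 ↔ P.valuation f < 1 := by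
  have key : ∀ (P : ValuationSubring F) (f : F), P.valuation f < 1 ↔ f = 0 ∨ f⁻¹ ∉ P := by
    intro P f
    by_cases hf : f = 0
    · simp [hf]
    have h0 : 0 < P.valuation f := zero_lt_iff.2 ((Valuation.ne_zero_iff _).2 hf)
    rw [← P.valuation_le_one_iff, map_inv₀, inv_le_one₀ h0, not_le]
    simp [hf]
  rw [key, key, ← map_inv₀]
  have h1 : g f = 0 ↔ f = 0 := by simp
  have h2 : g f⁻¹ ∈ g • P ↔ f⁻¹ ∈ P := ValuationSubring.smul_mem_pointwise_smul_iff
  rw [h1, h2]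

theorem eq_zero_of_valuation_lt_one {P : ValuationSubring F} (hP : IsPlace K P) {c : K}
    (h : P.valuation (algebraMap K F c) < 1) : c = 0 := by
  by_contra hc
  exact absurd (valuation_algebraMap hP hc) h.ne

theorem valuation_affine_lt_one {P : ValuationSubring F} (hP : IsPlace K P) {α β : K}
    (hx : P.valuation (x - algebraMap K F α) < 1) (hy : P.valuation (y - algebraMap K F β) < 1)
    (r s : K) :
    P.valuation (algebraMap K F r * (x - algebraMap K F α) +
      algebraMap K F s * (y - algebraMap K F β)) < 1 := by
  have key : ∀ (c : K) (f : F), P.valuation f < 1 → P.valuation (algebraMap K F c * f) < 1 := by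
    intro c f hf
    rw [map_mul]
    exact (mul_le_of_le_one_left zero_le (valuation_algebraMap_le hP c)).trans_lt hf
  exact P.valuation.map_add_lt (key _ _ hx) (key _ _ hy)

theorem pow_q_sq_eq_of_trace {p k : ℕ} (hp : p.Prime) (hq : q = p ^ k) [CharP K p] {α β : K}
    (hβ : β ^ q ^ 2 = β) (h : α ^ q + α = β ^ (q + 1)) : α ^ q ^ 2 = α := by
  have h1 : (α ^ q + α) ^ q = α ^ q + α := by
    rw [h, ← pow_mul, add_mul, pow_add, ← sq, hβ, one_mul, pow_succ, mul_comm]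
  rw [add_pow_q hp hq, ← pow_mul, ← sq, add_comm (α ^ q)] at h1
  exact add_right_cancel h1

/-- The pairs `(α, β)` such that the place `Q_{αβ}` is fixed by `[a, b, c, d]`. -/
def fixedPoints (q : ℕ) (a b c : K) : Set (K × K) :=
  {s | s.2 ^ q ^ 2 = s.2 ∧ s.1 ^ q + s.1 = s.2 ^ (q + 1) ∧ a * s.2 + b = s.2 ∧
    a ^ (q + 1) * s.1 + a * b ^ q * s.2 + c = s.1}

/-- Places Q_{αβ} correspond to pairs (α, β), and the action on x and y is affine, so a place is
fixed exactly when its pair is. -/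
theorem N_eq_ncard (hF : IsGGK q n K x y z) {Q : ValuationSubring F} (hQ : IsPlace K Q)
    (hzQ : z ∉ Q) {g : F ≃ₐ[K] F} {a b c d : K} (h : HasCoords q n x y z g a b c d) :
    N q x y g = (fixedPoints q a b c).ncard := by
  obtain ⟨p, k, hp, hk, hqp, _, _⟩ := hF.exists_charP
  have hex : ∀ s ∈ fixedPoints q a b c, ∃ P : ValuationSubring F, IsPlace K P ∧
      P.valuation (x - algebraMap K F s.1) < 1 ∧ P.valuation (y - algebraMap K F s.2) < 1 :=
    fun s hs => exists_place hF hQ hzQ hs.1 hs.2.1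
  have huniq : ∀ s ∈ fixedPoints q a b c, ∀ P P' : ValuationSubring F, IsPlace K P →
      P.valuation (x - algebraMap K F s.1) < 1 → P.valuation (y - algebraMap K F s.2) < 1 →
      IsPlace K P' → P'.valuation (x - algebraMap K F s.1) < 1 →
      P'.valuation (y - algebraMap K F s.2) < 1 → P = P' :=
    fun s hs P P' hP hx hy hP' hx' hy' => le_antisymm
      (place_le hF hQ hzQ hs.1 hs.2.1 hP hx hy hP' hx' hy')
      (place_le hF hQ hzQ hs.1 hs.2.1 hP' hx' hy' hP hx hy)
  choose! f hfP hfx hfy using hex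
  symm
  refine Set.ncard_congr (fun s _ => f s) ?_ ?_ ?_
  · intro s hs
    refine ⟨⟨hfP s hs, s.1, s.2, pow_q_sq_eq_of_trace hp hqp hs.1 hs.2.1, hs.1, hs.2.1,
      hfx s hs, hfy s hs⟩, ?_⟩
    -- At a fixed pair, g x - α and g y - β are K-combinations of x - α and y - β, so g⁻¹ moves the
    -- place to one with the same values of x and y.
    have hinv : g⁻¹ • f s = f s := by
      refine huniq s hs _ _ (isPlace_smul (hfP s hs) _) ?_ ?_ (hfP s hs) (hfx s hs) (hfy s hs)
      · rw [← valuation_smul_lt_one_iff _ g, smul_inv_smul, map_sub, h.map_x, AlgEquiv.commutes]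
        convert valuation_affine_lt_one (hfP s hs) (hfx s hs) (hfy s hs) (a ^ (q + 1)) (a * b ^ q)
          using 2
        conv_lhs => rw [← hs.2.2.2]
        simp only [map_add, map_mul]
        ring
      · rw [← valuation_smul_lt_one_iff _ g, smul_inv_smul, map_sub, h.map_y, AlgEquiv.commutes]
        convert valuation_affine_lt_one (hfP s hs) (hfx s hs) (hfy s hs) 0 a using 2
        conv_lhs => rw [← hs.2.2.1]
        simp only [map_add, map_mul, map_zero]
        ring
    rw [MulAction.mem_stabilizer_iff]
    conv_lhs => rw [← hinv]
    rw [smul_inv_smul]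
  · intro s t hs ht hst
    have hst : f s = f t := hst
    have hx1 := hfx s hs
    have hy1 := hfy s hs
    rw [hst] at hx1 hy1
    have hx2 := (f t).valuation.map_sub_lt (hfx t ht) hx1
    have hy2 := (f t).valuation.map_sub_lt (hfy t ht) hy1
    rw [sub_sub_sub_cancel_left, ← map_sub] at hx2 hy2
    exact Prod.ext (sub_eq_zero.1 (eq_zero_of_valuation_lt_one (hfP t ht) hx2))
      (sub_eq_zero.1 (eq_zero_of_valuation_lt_one (hfP t ht) hy2))
  · rintro P ⟨⟨hP, α, β, hα, hβ, hαβ, hx, hy⟩, hg⟩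
    rw [MulAction.mem_stabilizer_iff] at hg
    have hgx := (valuation_smul_lt_one_iff P g _).2 hx
    have hgy := (valuation_smul_lt_one_iff P g _).2 hy
    rw [hg, map_sub, AlgEquiv.commutes] at hgx hgy
    rw [h.map_x] at hgx
    rw [h.map_y] at hgy
    have hx1 := P.valuation.map_sub_lt hgx
      (valuation_affine_lt_one hP hx hy (a ^ (q + 1)) (a * b ^ q))
    have hy1 := P.valuation.map_sub_lt hgy (valuation_affine_lt_one hP hx hy 0 a)
    have hs : (α, β) ∈ fixedPoints q a b c := by
      refine ⟨hβ, hαβ, sub_eq_zero.1 (eq_zero_of_valuation_lt_one hP ?_),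
        sub_eq_zero.1 (eq_zero_of_valuation_lt_one hP ?_)⟩
      · convert hy1 using 2
        simp only [map_add, map_sub, map_mul, map_zero]
        ring
      · convert hx1 using 2
        simp only [map_add, map_sub, map_mul, map_pow]
        ring
    exact ⟨(α, β), hs, huniq _ hs _ _ (hfP _ hs) (hfx _ hs) (hfy _ hs) hP hx hy⟩

end GGK

/-! ### Counting fixed points -/

namespace GGK

variable {K : Type*} [Field K] {q : ℕ}

section Count

theorem mem_fixedPoints {a b c : K} {s : K × K} : s ∈ fixedPoints q a b c ↔
    s.2 ^ q ^ 2 = s.2 ∧ s.1 ^ q + s.1 = s.2 ^ (q + 1) ∧ a * s.2 + b = s.2 ∧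
      a ^ (q + 1) * s.1 + a * b ^ q * s.2 + c = s.1 := Iff.rfl

/-- The group of units is cyclic and q² - 1 divides q^(2n) - 1. -/
theorem ncard_pow_q_sq_eq [Finite K] {n : ℕ} (hq : 1 < q)
    (hcard : Nat.card K = q ^ (2 * n)) : {β : K | β ^ q ^ 2 = β}.ncard = q ^ 2 := by
  have hq2 := Nat.one_lt_pow two_ne_zero hq
  have hker := IsCyclic.card_powMonoidHom_ker Kˣ (q ^ 2 - 1)
  have hdvd : q ^ 2 - 1 ∣ Nat.card Kˣ := by
    rw [Nat.card_units, hcard, pow_mul]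
    simpa using Nat.sub_dvd_pow_sub_pow (q ^ 2) 1 n
  rw [Nat.gcd_eq_right hdvd] at hker
  have hE : {β : K | β ^ q ^ 2 = β} =
      insert 0 ((fun u : Kˣ => (u : K)) '' ((powMonoidHom (q ^ 2 - 1) : Kˣ →* Kˣ).ker : Set Kˣ)) := by
    ext β
    simp only [Set.mem_ofPred_eq, Set.mem_insert_iff, Set.mem_image, SetLike.mem_coe,
      MonoidHom.mem_ker, powMonoidHom_apply]
    constructor
    · intro h
      by_cases h0 : β = 0
      · exact Or.inl h0
      refine Or.inr ⟨Units.mk0 β h0, Units.ext ?_, rfl⟩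
      rw [Units.val_pow_eq_pow_val, Units.val_mk0, Units.val_one]
      refine mul_left_cancel₀ h0 ?_
      rw [← pow_succ', Nat.sub_add_cancel hq2.le, h, mul_one]
    · rintro (rfl | ⟨u, hu, rfl⟩)
      · exact zero_pow (by omega)
      · have := congrArg (fun v : Kˣ => (v : K)) hu
        simp only [Units.val_pow_eq_pow_val, Units.val_one] at this
        calc (u : K) ^ q ^ 2 = (u : K) ^ (q ^ 2 - 1) * u := by
              rw [← pow_succ, Nat.sub_add_cancel hq2.le]
          _ = u := by rw [this, one_mul]
  rw [hE, Set.ncard_insert_of_notMem (by simp), Set.ncard_image_of_injective _ Units.val_injective,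
    ← Nat.card_coe_set_eq]
  have : Nat.card ((powMonoidHom (q ^ 2 - 1) : Kˣ →* Kˣ).ker : Set Kˣ) = q ^ 2 - 1 := hker
  omega

open Polynomial in
theorem ncard_pow_add_mul_le (hq : 1 < q) (e γ : K) : {α : K | α ^ q + e * α = γ}.ncard ≤ q := by
  classical
  have hdeg : (C e * X - C γ).degree < (q : WithBot ℕ) := by
    refine (degree_sub_le _ _).trans_lt (max_lt ?_ ?_)
    · exact lt_of_le_of_lt (degree_C_mul_X_le _) (by exact_mod_cast hq)
    · exact lt_of_le_of_lt degree_C_le (by exact_mod_cast (by omega : 0 < q))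
  have hmonic : (X ^ q + (C e * X - C γ)).Monic := monic_X_pow_add hdeg
  have hnat : (X ^ q + (C e * X - C γ)).natDegree = q := by
    refine natDegree_eq_of_degree_eq_some ?_
    rw [degree_add_eq_left_of_degree_lt (by rwa [degree_X_pow]), degree_X_pow]
  have hsub : {α : K | α ^ q + e * α = γ} ⊆ ↑(X ^ q + (C e * X - C γ)).roots.toFinset := by
    intro α hα
    have hα : α ^ q + e * α = γ := hα
    simp only [Finset.mem_coe, Multiset.mem_toFinset, mem_roots hmonic.ne_zero, IsRoot.def,
      eval_add, eval_sub, eval_mul, eval_pow, eval_X, eval_C]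
    rw [← hα]; ring
  refine (Set.ncard_le_ncard hsub (Finset.finite_toSet _)).trans ?_
  rw [Set.ncard_coe_finset]
  exact (Multiset.toFinset_card_le _).trans ((card_roots' _).trans hnat.le)

/-- Every element of `𝔽_q` is the trace of exactly `q` elements of `𝔽_{q²}`. -/
theorem ncard_pow_add_eq [Finite K] {n p k : ℕ} (hp : p.Prime) (hk : 0 < k) (hqp : q = p ^ k)
    [CharP K p] (hcard : Nat.card K = q ^ (2 * n)) {γ : K} (hγ : γ ^ q = γ) :
    {α : K | α ^ q + α = γ}.ncard = q := by
  classical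
  have := Fintype.ofFinite K
  have hq : 1 < q := hqp ▸ Nat.one_lt_pow hk.ne' hp.one_lt
  have hE := ncard_pow_q_sq_eq hq hcard
  rw [Set.ncard_eq_toFinset_card'] at hE
  set E := {β : K | β ^ q ^ 2 = β}.toFinset
  set B := {γ : K | γ ^ q = γ}.toFinset
  have hB : B.card ≤ q := by
    rw [← Set.ncard_eq_toFinset_card']
    refine le_trans (le_of_eq ?_) (ncard_pow_add_mul_le hq (-1) (0 : K))
    congr 1
    ext γ
    simp [sub_eq_zero, ← sub_eq_add_neg]
  have hmaps : ∀ α ∈ E, α ^ q + α ∈ B := by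
    intro α hα
    simp only [E, Set.mem_toFinset, Set.mem_ofPred_eq] at hα
    simp only [B, Set.mem_toFinset, Set.mem_ofPred_eq]
    rw [add_pow_q hp hqp, ← pow_mul, ← sq, hα, add_comm]
  have hle : ∀ γ : K, (E.filter fun α => α ^ q + α = γ).card ≤ {α : K | α ^ q + α = γ}.ncard := by
    intro γ
    rw [← Set.ncard_coe_finset]
    exact Set.ncard_le_ncard (fun α hα => (Finset.mem_filter.1 hα).2) (Set.toFinite _)
  have hle' : ∀ γ : K, {α : K | α ^ q + α = γ}.ncard ≤ q := by
    intro γ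
    simpa using ncard_pow_add_mul_le hq (1 : K) γ
  have hsum := Finset.card_eq_sum_card_fiberwise hmaps
  refine le_antisymm (hle' γ) ?_
  by_contra hcon
  rw [not_le] at hcon
  -- The trace sends q² elements to at most q values with fibres of size at most q; one smaller
  -- fibre would lose elements.
  have hlt : ∑ b ∈ B, (E.filter fun α => α ^ q + α = b).card < ∑ _b ∈ B, q := by
    refine Finset.sum_lt_sum (fun b _ => (hle b).trans (hle' b)) ⟨γ, ?_, (hle γ).trans_lt hcon⟩
    simpa [B] using hγ
  rw [← hsum, hE, Finset.sum_const, smul_eq_mul, sq] at hlt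
  exact absurd hlt (not_lt.2 (Nat.mul_le_mul_right _ hB))

variable {n p k : ℕ} {a b c : K}

theorem ncard_fixedPoints_one [Finite K] (hp : p.Prime) (hk : 0 < k) (hqp : q = p ^ k)
    [CharP K p] (hcard : Nat.card K = q ^ (2 * n)) :
    (fixedPoints q (1 : K) 0 0).ncard = q ^ 3 := by
  classical
  have := Fintype.ofFinite K
  have hq : 1 < q := hqp ▸ Nat.one_lt_pow hk.ne' hp.one_lt
  have hE := ncard_pow_q_sq_eq hq hcard
  rw [Set.ncard_eq_toFinset_card'] at hE
  have hmaps : ∀ s ∈ (fixedPoints q (1 : K) 0 0).toFinset,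
      s.2 ∈ {β : K | β ^ q ^ 2 = β}.toFinset := by
    intro s hs
    rw [Set.mem_toFinset] at hs ⊢
    exact hs.1
  rw [Set.ncard_eq_toFinset_card', Finset.card_eq_sum_card_fiberwise hmaps,
    Finset.sum_congr rfl (g := fun _ => q), Finset.sum_const, hE, smul_eq_mul, ← pow_succ]
  intro β hβ
  rw [Set.mem_toFinset] at hβ
  have hβ : β ^ q ^ 2 = β := hβ
  have hγ : (β ^ (q + 1)) ^ q = β ^ (q + 1) := by
    rw [← pow_mul, add_mul, pow_add, ← sq, hβ, one_mul, pow_succ, mul_comm]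
  refine Eq.trans ?_ (ncard_pow_add_eq hp hk hqp hcard hγ)
  rw [← Set.ncard_image_of_injective _ (Prod.mk_left_injective β), ← Set.ncard_coe_finset]
  congr 1
  ext ⟨α, β'⟩
  simp only [Finset.coe_filter, Set.mem_toFinset, Set.mem_ofPred_eq, mem_fixedPoints, Set.mem_image,
    Prod.mk.injEq]
  constructor
  · rintro ⟨⟨-, h2, -⟩, rfl⟩
    exact ⟨α, h2, rfl, rfl⟩
  · rintro ⟨α, h2, rfl, rfl⟩
    refine ⟨⟨hβ, h2, by simp, ?_⟩, rfl⟩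
    simp [zero_pow (show q ≠ 0 by omega)]

theorem ncard_fixedPoints_of_one (hq : 0 < q) (h : ¬(b = 0 ∧ c = 0)) :
    (fixedPoints q 1 b c).ncard = 0 := by
  have : fixedPoints q 1 b c = ∅ := by
    ext ⟨α, β⟩
    simp only [fixedPoints, Set.mem_ofPred_eq, Set.mem_empty_iff_false, iff_false]
    rintro ⟨-, -, h1, h2⟩
    have hb : b = 0 := by simpa using h1
    subst hb
    exact h ⟨rfl, by simpa [zero_pow hq.ne'] using h2⟩
  rw [this, Set.ncard_empty]

theorem eq_div_iff_fixed (ha : a ≠ 1) (β : K) : a * β + b = β ↔ β = b / (1 - a) := by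
  rw [eq_div_iff (sub_ne_zero.2 ha.symm)]
  constructor <;> intro h <;> linear_combination -h

theorem div_pow_q_sq [CharP K p] (hp : p.Prime) (hqp : q = p ^ k)
    (ha : a ^ q ^ 2 = a) (hb : b ^ q ^ 2 = b) : (b / (1 - a)) ^ q ^ 2 = b / (1 - a) := by
  rw [div_pow, hb, sq, pow_mul (1 - a), sub_pow_q hp hqp, sub_pow_q hp hqp, ← pow_mul, ← pow_mul,
    ← sq, ha, one_pow]

theorem ncard_fixedPoints_of_norm_one [Finite K] (hp : p.Prime) (hk : 0 < k) (hqp : q = p ^ k)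
    [CharP K p] (hcard : Nat.card K = q ^ (2 * n)) (ha1 : a ≠ 1)
    (haq : a ^ (q + 1) = 1) (ha : a ^ q ^ 2 = a) (hb : b ^ q ^ 2 = b) :
    (c = (b / (1 - a)) ^ q * b → (fixedPoints q a b c).ncard = q) ∧
      (c ≠ (b / (1 - a)) ^ q * b → (fixedPoints q a b c).ncard = 0) := by
  set β := b / (1 - a) with hβdef
  have hβ2 : β ^ q ^ 2 = β := div_pow_q_sq hp hqp ha hb
  have hbβ : b = (1 - a) * β := by
    rw [hβdef, mul_div_cancel₀ _ (sub_ne_zero.2 ha1.symm)]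
  -- With a^(q+1) = 1 the fixed-point equation for α loses α and becomes c = β^q b; either every α
  -- with the right trace works, or none does.
  have hkey : a * b ^ q * β = -(β ^ q * b) := by
    have : b ^ q = (1 - a ^ q) * β ^ q := by
      conv_lhs => rw [hbβ]
      rw [mul_pow, sub_pow_q hp hqp, one_pow]
    rw [this]
    conv_rhs => rw [hbβ]
    rw [pow_succ] at haq
    linear_combination (-β ^ q * β) * haq
  constructor
  · intro hc
    have hγ : (β ^ (q + 1)) ^ q = β ^ (q + 1) := by
      rw [← pow_mul, add_mul, pow_add, ← sq, hβ2, one_mul, pow_succ, mul_comm]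
    refine Eq.trans ?_ (ncard_pow_add_eq hp hk hqp hcard hγ)
    rw [← Set.ncard_image_of_injective {α : K | α ^ q + α = β ^ (q + 1)}
      (Prod.mk_left_injective β)]
    congr 1
    ext ⟨α, β'⟩
    simp only [Set.mem_ofPred_eq, fixedPoints, Set.mem_image, Prod.mk.injEq]
    constructor
    · rintro ⟨-, h2, h3, -⟩
      obtain rfl : β' = β := (eq_div_iff_fixed ha1 β').1 h3
      exact ⟨α, h2, rfl, rfl⟩
    · rintro ⟨α, h2, rfl, rfl⟩
      refine ⟨hβ2, h2, (eq_div_iff_fixed ha1 β).2 rfl, ?_⟩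
      rw [haq, one_mul, hkey, hc]
      ring
  · intro hc
    have : fixedPoints q a b c = ∅ := by
      ext ⟨α, β'⟩
      simp only [fixedPoints, Set.mem_ofPred_eq, Set.mem_empty_iff_false, iff_false]
      rintro ⟨-, -, h3, h4⟩
      obtain rfl : β' = β := (eq_div_iff_fixed ha1 β').1 h3
      rw [haq, one_mul, hkey] at h4
      exact hc (by linear_combination h4)
    rw [this, Set.ncard_empty]

theorem ncard_fixedPoints_of_norm_ne_one (hp : p.Prime) (hqp : q = p ^ k) [CharP K p]
    (haq : a ^ (q + 1) ≠ 1) (ha : a ^ q ^ 2 = a) (hb : b ^ q ^ 2 = b)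
    (hbc : c ^ q + c = b ^ (q + 1)) : (fixedPoints q a b c).ncard = 1 := by
  have ha1 : a ≠ 1 := by rintro rfl; exact haq (one_pow _)
  set β := b / (1 - a) with hβdef
  have hβ2 : β ^ q ^ 2 = β := div_pow_q_sq hp hqp ha hb
  have hbβ : b = (1 - a) * β := by
    rw [hβdef, mul_div_cancel₀ _ (sub_ne_zero.2 ha1.symm)]
  have hne : 1 - a ^ (q + 1) ≠ 0 := sub_ne_zero.2 haq.symm
  have hbq : b ^ q = (1 - a ^ q) * β ^ q := by
    conv_lhs => rw [hbβ]
    rw [mul_pow, sub_pow_q hp hqp, one_pow]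
  rw [Set.ncard_eq_one]
  refine ⟨((a * b ^ q * β + c) / (1 - a ^ (q + 1)), β), ?_⟩
  ext ⟨α, β'⟩
  simp only [fixedPoints, Set.mem_ofPred_eq, Set.mem_singleton_iff, Prod.mk.injEq]
  constructor
  · rintro ⟨-, -, h3, h4⟩
    obtain rfl : β' = β := (eq_div_iff_fixed ha1 β').1 h3
    refine ⟨?_, rfl⟩
    rw [eq_div_iff hne]
    linear_combination -h4
  · rintro ⟨rfl, rfl⟩
    refine ⟨hβ2, ?_, (eq_div_iff_fixed ha1 β).2 rfl, ?_⟩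
    -- The unique solution of the linear equation for α must still lie on the curve; this is where
    -- c^q + c = b^(q+1) enters.
    · have hA : (a ^ (q + 1)) ^ q = a ^ (q + 1) := by
        rw [← pow_mul, add_mul, pow_add, ← sq, ha, one_mul, pow_succ, mul_comm]
      have hbqq : (b ^ q) ^ q = b := by rw [← pow_mul, ← sq, hb]
      rw [div_pow, sub_pow_q hp hqp, one_pow, hA, ← add_div, div_eq_iff hne, add_pow_q hp hqp,
        mul_pow, mul_pow, hbqq]
      rw [pow_succ] at hbc
      rw [pow_succ, pow_succ]
      have : a ^ q * b * β ^ q + c ^ q + (a * b ^ q * β + c) =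
          a ^ q * b * β ^ q + a * b ^ q * β + b ^ q * b := by linear_combination hbc
      rw [this, hbq]
      linear_combination (a ^ q * β ^ q + (1 - a ^ q) * β ^ q) * hbβ
    · field_simp
      ring

end Count

end GGK

/-! ### Coordinates on G and the #K-th power -/

namespace GGK

variable {K F : Type*} [Field K] [Field F] [Algebra K F] {q n : ℕ} {x y z : F}

section Coordinates

theorem eq_zero_of_mul_y_eq (hF : IsGGK q n K x y z) {Q : ValuationSubring F} (hQ : IsPlace K Q)
    (hz : z ∉ Q) {r s : K} (h : algebraMap K F r * y = algebraMap K F s) : r = 0 := by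
  by_contra hr
  obtain ⟨δ, hδ, -, hvy, -⟩ := exists_delta hF hz
  have h1 := congrArg Q.valuation h
  rw [map_mul, valuation_algebraMap hQ hr, one_mul, hvy] at h1
  have h2 := valuation_algebraMap_le hQ s
  rw [← h1] at h2
  have h3 : q * m q n ≠ 0 :=
    Nat.mul_ne_zero (by have := hF.one_lt; omega) (m_pos hF.odd).ne'
  exact absurd h2 (not_le.2 (one_lt_pow₀ hδ h3))

theorem HasCoords.eq_of_map_y (hF : IsGGK q n K x y z) {Q : ValuationSubring F}
    (hQ : IsPlace K Q) (hz : z ∉ Q) {g : F ≃ₐ[K] F} {a b c d a' b' : K}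
    (h : HasCoords q n x y z g a b c d)
    (hy : g y = algebraMap K F a' * y + algebraMap K F b') : a = a' ∧ b = b' := by
  have h1 := h.map_y.symm.trans hy
  have ha : a = a' := by
    refine sub_eq_zero.1 (eq_zero_of_mul_y_eq hF hQ hz (s := b' - b) ?_)
    rw [map_sub, map_sub]
    linear_combination h1
  refine ⟨ha, (algebraMap K F).injective ?_⟩
  rw [ha] at h1
  exact add_left_cancel h1

theorem HasCoords.c_eq {g g' : F ≃ₐ[K] F} {a b c d c' d' : K}
    (h : HasCoords q n x y z g a b c d) (h' : HasCoords q n x y z g' a b c' d')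
    (hx : g x = g' x) : c = c' := by
  rw [h.map_x, h'.map_x] at hx
  exact (algebraMap K F).injective (add_left_cancel hx)

theorem HasCoords.d_eq (hz : z ≠ 0) {g : F ≃ₐ[K] F} {a b c d d' : K}
    (h : HasCoords q n x y z g a b c d) (hgz : g z = algebraMap K F d' * z) : d = d' := by
  rw [h.map_z] at hgz
  exact (algebraMap K F).injective (mul_right_cancel₀ hz hgz)

theorem algEquiv_ext (hF : IsGGK q n K x y z) {g g' : F ≃ₐ[K] F} (hx : g x = g' x)
    (hy : g y = g' y) (hz : g z = g' z) : g = g' := by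
  have hR : ∀ r ∈ coordRing K x y z, g r = g' r := by
    intro r hr
    induction hr using Algebra.adjoin_induction with
    | mem w hw => rcases hw with rfl | rfl | rfl <;> assumption
    | algebraMap c => rw [AlgEquiv.commutes, AlgEquiv.commutes]
    | add a b _ _ ha hb => rw [map_add, map_add, ha, hb]
    | mul a b _ _ ha hb => rw [map_mul, map_mul, ha, hb]
  ext f
  obtain ⟨a, ha, b, hb, rfl⟩ := exists_eq_div hF f
  rw [map_div₀, map_div₀, hR a ha, hR b hb]

theorem HasCoords.ext (hF : IsGGK q n K x y z) {g g' : F ≃ₐ[K] F} {a b c d : K}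
    (h : HasCoords q n x y z g a b c d) (h' : HasCoords q n x y z g' a b c d) : g = g' :=
  algEquiv_ext hF (h.map_x.trans h'.map_x.symm) (h.map_y.trans h'.map_y.symm)
    (h.map_z.trans h'.map_z.symm)

theorem hasCoords_one (hq : q ≠ 0) : HasCoords q n x y z (1 : F ≃ₐ[K] F) 1 0 0 1 where
  a_ne_zero := one_ne_zero
  a_mem := one_pow _
  b_mem := zero_pow (pow_ne_zero _ hq)
  c_mem := zero_pow (pow_ne_zero _ hq)
  trace_norm := by rw [zero_pow hq, zero_pow q.succ_ne_zero, add_zero]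
  d_pow := one_pow _
  map_x := by simp [hq]
  map_y := by simp
  map_z := by simp

/-- If `a = 1`, then the `#K`-th power of `[a, b, c, d]` is `[1, 0, 0, d]`. -/
theorem HasCoords.pow_card_of_one {p : ℕ} [CharP K p] {g : F ≃ₐ[K] F}
    {b c d : K} (h : HasCoords q n x y z g 1 b c d) {N l : ℕ} (hN : N = p * l) (hl : p ∣ l) :
    (g ^ N) x = x ∧ (g ^ N) y = y := by
  have h1 : ∀ j : ℕ, (g ^ j) y = y + algebraMap K F (j * b) ∧
      ∃ s : K, (g ^ j) x = x + algebraMap K F (j * b ^ q) * y + algebraMap K F s := by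
    intro j
    induction j with
    | zero => exact ⟨by simp, 0, by simp⟩
    | succ j ih =>
      obtain ⟨ihy, s, ihx⟩ := ih
      refine ⟨?_, s + c + j * b ^ q * b, ?_⟩
      · rw [pow_succ', AlgEquiv.mul_apply, ihy, map_add, AlgEquiv.commutes, h.map_y]
        simp only [map_add, map_mul, map_natCast, map_one, Nat.cast_add, Nat.cast_one]
        ring
      · rw [pow_succ', AlgEquiv.mul_apply, ihx, map_add, map_add, map_mul, AlgEquiv.commutes,
          AlgEquiv.commutes, h.map_y, h.map_x]
        simp only [map_add, map_mul, map_pow, map_natCast, map_one, one_pow, Nat.cast_add,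
          Nat.cast_one]
        ring
  obtain ⟨hpy, s, hpx⟩ := h1 p
  have hp0 : (p : K) = 0 := CharP.cast_eq_zero K p
  rw [hp0, zero_mul, map_zero, add_zero] at hpy
  rw [hp0, zero_mul, map_zero, zero_mul, add_zero] at hpx
  -- The p-th power fixes y but may still translate x, as for p = 2; a second factor p is needed.
  have h2 : ∀ j : ℕ, ((g ^ p) ^ j) y = y ∧ ((g ^ p) ^ j) x = x + algebraMap K F (j * s) := by
    intro j
    induction j with
    | zero => simp
    | succ j ih =>
      refine ⟨by rw [pow_succ', AlgEquiv.mul_apply, ih.1, hpy], ?_⟩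
      rw [pow_succ', AlgEquiv.mul_apply, ih.2, map_add, AlgEquiv.commutes, hpx]
      simp only [map_add, map_mul, map_natCast, map_one, Nat.cast_add, Nat.cast_one]
      ring
  rw [hN, pow_mul]
  refine ⟨?_, (h2 l).1⟩
  rw [(h2 l).2, (CharP.cast_eq_zero_iff K p l).2 hl, zero_mul, map_zero, add_zero]

/-- If `a ≠ 1` and `a ^ (q + 1) = 1`, then the `#K`-th power of `[a, b, c, d]` is
`[a, b, β ^ q b, d]` with `β = b / (1 - a)`. -/
theorem HasCoords.pow_card_of_norm_one {p k : ℕ} (hp : p.Prime) (hqp : q = p ^ k) [CharP K p]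
    {g : F ≃ₐ[K] F} {a b c d : K} (h : HasCoords q n x y z g a b c d) (ha1 : a ≠ 1)
    (haq : a ^ (q + 1) = 1) {N : ℕ} (hN : (N : K) = 0) (haN : a ^ N = a) :
    (g ^ N) y = algebraMap K F a * y + algebraMap K F b ∧
      (g ^ N) x = algebraMap K F (a ^ (q + 1)) * x + algebraMap K F (a * b ^ q) * y +
        algebraMap K F ((b / (1 - a)) ^ q * b) := by
  set β := b / (1 - a) with hβdef
  have hbβ : b = (1 - a) * β := by
    rw [hβdef, mul_div_cancel₀ _ (sub_ne_zero.2 ha1.symm)]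
  have hbq : a * b ^ q = (a - 1) * β ^ q := by
    have : b ^ q = (1 - a ^ q) * β ^ q := by
      conv_lhs => rw [hbβ]
      rw [mul_pow, sub_pow_q hp hqp, one_pow]
    rw [this]
    rw [pow_succ] at haq
    linear_combination (-β ^ q) * haq
  have hy : ∀ j : ℕ, (g ^ j) y = algebraMap K F (a ^ j) * (y - algebraMap K F β) +
      algebraMap K F β := by
    intro j
    induction j with
    | zero => simp
    | succ j ih =>
      rw [pow_succ', AlgEquiv.mul_apply, ih, map_add, map_mul, map_sub, AlgEquiv.commutes,
        AlgEquiv.commutes, h.map_y]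
      have hb' : algebraMap K F b = (1 - algebraMap K F a) * algebraMap K F β := by
        rw [hbβ]; simp
      rw [hb', pow_succ, map_mul]
      ring
  -- The function x - β^q y is merely translated by c - β^q b, so a power divisible by the
  -- characteristic fixes it.
  have hx : ∀ j : ℕ, (g ^ j) x = x - algebraMap K F (β ^ q) * y +
      algebraMap K F (j * (c - β ^ q * b)) + algebraMap K F (β ^ q) * (g ^ j) y := by
    intro j
    induction j with
    | zero => simp
    | succ j ih =>
      have e : (g ^ (j + 1)) x = g ((g ^ j) x) := by rw [pow_succ', AlgEquiv.mul_apply]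
      have e' : (g ^ (j + 1)) y = g ((g ^ j) y) := by rw [pow_succ', AlgEquiv.mul_apply]
      have hgx := h.map_x
      rw [haq, hbq] at hgx
      rw [e, ih, e']
      simp only [map_add, map_sub, map_mul, map_pow, map_natCast, map_one, Nat.cast_add,
        Nat.cast_one, AlgEquiv.commutes, hgx, h.map_y]
      ring
  have hyN : (g ^ N) y = algebraMap K F a * y + algebraMap K F b := by
    rw [hy, haN]
    have hb' : algebraMap K F b = (1 - algebraMap K F a) * algebraMap K F β := by
      rw [hbβ]; simp
    rw [hb']
    ring
  refine ⟨hyN, ?_⟩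
  rw [hx, hN, hyN, haq, hbq]
  simp only [map_sub, map_mul, map_pow, map_one, map_zero]
  ring

end Coordinates

section Family

/-- A choice of coordinates for all elements of `G`. -/
structure Coordinates (q n : ℕ) (x y z : F) (G : Subgroup (F ≃ₐ[K] F)) where
  /-- the coordinate `a` -/
  a : G → K
  /-- the coordinate `b` -/
  b : G → K
  /-- the coordinate `c` -/
  c : G → K
  /-- the coordinate `d`, as a homomorphism to the group of units -/
  d : G →* Kˣ
  hasCoords : ∀ g : G, HasCoords q n x y z (g : F ≃ₐ[K] F) (a g) (b g) (c g) (d g)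

theorem exists_coordinates (hF : IsGGK q n K x y z) {Q : ValuationSubring F} (hQ : IsPlace K Q)
    (hz : z ∉ Q) {G : Subgroup (F ≃ₐ[K] F)} (hG : G ≤ Q.decompositionSubgroup K) :
    Nonempty (Coordinates q n x y z G) := by
  have hz0 : z ≠ 0 := by rintro rfl; exact hz Q.zero_mem
  have hex : ∀ g : G, ∃ a b c d : K, HasCoords q n x y z (g : F ≃ₐ[K] F) a b c d :=
    fun g => exists_hasCoords hF hQ hz (hG g.2)
  choose a b c d h using hex
  let D : G →* K :=
    { toFun := d
      map_one' := (h 1).d_eq hz0 (by simp)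
      map_mul' := fun g g' => (h (g * g')).d_eq hz0 (by
        rw [Subgroup.coe_mul, AlgEquiv.mul_apply, (h g').map_z, map_mul, AlgEquiv.commutes,
          (h g).map_z, map_mul]
        ring) }
  exact ⟨⟨a, b, c, D.toHomUnits, h⟩⟩

variable {G : Subgroup (F ≃ₐ[K] F)}

theorem Coordinates.finite (C : Coordinates q n x y z G) (hF : IsGGK q n K x y z) : Finite G := by
  have := hF.finite
  refine Finite.of_injective (fun g : G => (C.a g, C.b g, C.c g, C.d g)) fun g g' h => ?_
  simp only [Prod.mk.injEq] at h
  obtain ⟨ha, hb, hc, hd⟩ := h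
  have h1 := C.hasCoords g
  rw [ha, hb, hc, hd] at h1
  exact Subtype.ext (h1.ext hF (C.hasCoords g'))

theorem Coordinates.a_eq (C : Coordinates q n x y z G) (g : G) :
    C.a g = ((C.d g ^ m q n : Kˣ) : K) := by
  rw [Units.val_pow_eq_pow_val, (C.hasCoords g).d_pow]

theorem Coordinates.a_eq_one_iff (C : Coordinates q n x y z G) (g : G) :
    C.a g = 1 ↔ C.d g ^ m q n = 1 := by
  rw [C.a_eq, Units.val_eq_one]

theorem Coordinates.a_pow_eq_one_iff (C : Coordinates q n x y z G) (hn : Odd n) (g : G) :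
    C.a g ^ (q + 1) = 1 ↔ C.d g ^ (q ^ n + 1) = 1 := by
  rw [C.a_eq, ← Units.val_pow_eq_pow_val, ← pow_mul, mul_comm, succ_mul_m hn, Units.val_eq_one]

theorem Coordinates.ext (C : Coordinates q n x y z G) (hF : IsGGK q n K x y z) {g g' : G}
    (hd : C.d g = C.d g') (hb : C.b g = C.b g') (hc : C.c g = C.c g') : g = g' := by
  have h1 := C.hasCoords g
  rw [C.a_eq, hb, hc, hd, ← C.a_eq] at h1
  exact Subtype.ext (h1.ext hF (C.hasCoords g'))

/-- `c = β ^ q b`, where `β` is the fixed point of `β ↦ a β + b`. -/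
def Coordinates.IsFixing (C : Coordinates q n x y z G) (g : G) : Prop :=
  C.c g = (C.b g / (1 - C.a g)) ^ q * C.b g

variable {Q : ValuationSubring F} (C : Coordinates q n x y z G)

theorem Coordinates.eq_of_hasCoords (hF : IsGGK q n K x y z) (hQ : IsPlace K Q) (hz : z ∉ Q)
    {g : G} {a b c d : K} (h : HasCoords q n x y z (g : F ≃ₐ[K] F) a b c d) :
    C.a g = a ∧ C.b g = b ∧ C.c g = c ∧ (C.d g : K) = d := by
  have h0 := C.hasCoords g
  have hz0 : z ≠ 0 := by rintro rfl; exact hz Q.zero_mem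
  obtain ⟨ha, hb⟩ := h0.eq_of_map_y hF hQ hz h.map_y
  have hd := h0.d_eq hz0 h.map_z
  rw [ha, hb] at h0
  exact ⟨ha, hb, h0.c_eq h rfl, hd⟩

theorem Coordinates.b_mul (hF : IsGGK q n K x y z) (hQ : IsPlace K Q) (hz : z ∉ Q) (g g' : G) :
    C.b (g * g') = C.a g' * C.b g + C.b g' := by
  refine ((C.hasCoords (g * g')).eq_of_map_y hF hQ hz (a' := C.a g' * C.a g) ?_).2
  rw [Subgroup.coe_mul, AlgEquiv.mul_apply, (C.hasCoords g').map_y, map_add, map_mul,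
    AlgEquiv.commutes, AlgEquiv.commutes, (C.hasCoords g).map_y]
  simp only [map_add, map_mul]
  ring

theorem Coordinates.one (hF : IsGGK q n K x y z) (hQ : IsPlace K Q) (hz : z ∉ Q) :
    C.a 1 = 1 ∧ C.b 1 = 0 ∧ C.c 1 = 0 := by
  have hq : q ≠ 0 := by have := hF.one_lt; omega
  obtain ⟨h1, h2, h3, -⟩ := C.eq_of_hasCoords hF hQ hz (g := 1) (hasCoords_one hq)
  exact ⟨h1, h2, h3⟩

theorem d_pow_card (hF : IsGGK q n K x y z) (d : Kˣ) : d ^ q ^ (2 * n) = d := by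
  have := hF.finite
  have := Fintype.ofFinite K
  ext
  rw [Units.val_pow_eq_pow_val, ← hF.card_eq, Nat.card_eq_fintype_card, FiniteField.pow_card]

/-- If `[1, b, c, d] ∈ G`, then `[1, 0, 0, d] ∈ G`. -/
theorem Coordinates.exists_semisimple_of_one (hF : IsGGK q n K x y z) (hQ : IsPlace K Q)
    (hz : z ∉ Q) {g : G} (hg : C.a g = 1) :
    ∃ h : G, (h : F ≃ₐ[K] F) x = x ∧ (h : F ≃ₐ[K] F) y = y ∧ C.d h = C.d g ∧ C.a h = 1 ∧
      C.b h = 0 ∧ C.c h = 0 := by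
  obtain ⟨p, k, hp, hk, hqp, _, _⟩ := hF.exists_charP
  have hq : q ≠ 0 := by have := hF.one_lt; omega
  have h0 := C.hasCoords g
  rw [hg] at h0
  obtain ⟨r, hr⟩ : p ∣ q := hqp ▸ dvd_pow_self p hk.ne'
  obtain ⟨t, ht⟩ : ∃ t, 2 * n = t + 2 := ⟨2 * n - 2, by have := hF.odd.pos; omega⟩
  obtain ⟨hx, hy⟩ := h0.pow_card_of_one (p := p) (N := q ^ (2 * n))
    (l := r * (q * q ^ t)) (by rw [ht, pow_add, sq]; conv_lhs => rw [hr]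
                               conv_rhs => rw [hr]
                               ring) ⟨r * r * q ^ t, by conv_lhs => rw [hr]
                                                        conv_rhs => rw [hr]
                                                        ring⟩
  -- The exponent q^(2n) = #K is divisible by p², yet it leaves d unchanged because d^(#K) = d.
  refine ⟨g ^ q ^ (2 * n), by simpa using hx, by simpa using hy, ?_, ?_⟩
  · rw [map_pow, d_pow_card hF]
  · have h1 := C.hasCoords (g ^ q ^ (2 * n))
    obtain ⟨ha, hb⟩ := h1.eq_of_map_y hF hQ hz (a' := 1) (b' := 0) (by simpa using hy)
    refine ⟨ha, hb, ?_⟩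
    rw [ha, hb] at h1
    exact h1.c_eq (hasCoords_one hq) (by simpa using hx)

/-- If `[a, b, c, d] ∈ G` with `a ≠ 1` and `a ^ (q + 1) = 1`, then `[a, b, β ^ q b, d] ∈ G`. -/
theorem Coordinates.exists_isFixing (hF : IsGGK q n K x y z) (hQ : IsPlace K Q)
    (hz : z ∉ Q) {g : G} (hg : C.a g ≠ 1) (hgq : C.a g ^ (q + 1) = 1) :
    ∃ h : G, C.d h = C.d g ∧ C.b h = C.b g ∧ C.IsFixing h := by
  obtain ⟨p, k, hp, hk, hqp, _, _⟩ := hF.exists_charP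
  have h0 := C.hasCoords g
  have hN : ((q ^ (2 * n) : ℕ) : K) = 0 := by
    push_cast
    rw [natCast_eq_zero hk hqp, zero_pow]
    have := hF.odd.pos
    omega
  have haN : C.a g ^ q ^ (2 * n) = C.a g := by
    rw [C.a_eq, ← Units.val_pow_eq_pow_val, d_pow_card hF]
  obtain ⟨hy, hx⟩ := h0.pow_card_of_norm_one hp hqp hg hgq hN haN
  have h1 := C.hasCoords (g ^ q ^ (2 * n))
  obtain ⟨ha, hb⟩ := h1.eq_of_map_y hF hQ hz hy
  refine ⟨g ^ q ^ (2 * n), by rw [map_pow, d_pow_card hF], hb, ?_⟩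
  rw [IsFixing, ha, hb]
  have hx' := h1.map_x
  rw [ha, hb] at hx'
  exact (algebraMap K F).injective (add_left_cancel (hx'.symm.trans hx))

end Family

end GGK

/-! ### Counting in G and the two sums -/

namespace GGK

variable {K F : Type*} [Field K] [Field F] [Algebra K F] {q n : ℕ} {x y z : F}

-- A finite subgroup of Kˣ is cyclic. With k = m and k = q^n + 1 this is the source of δ₁ and δ₂.
open Finset in
theorem card_filter_image_pow_eq_one {G : Type*} [Group G] [Fintype G] [DecidableEq K]
    (d : G →* Kˣ) (k : ℕ) :
    #{u ∈ univ.image d | u ^ k = 1} = Nat.gcd #(univ.image d) k := by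
  have hker := IsCyclic.card_powMonoidHom_ker d.range k
  have hR : Nat.card d.range = #(univ.image d) := by
    rw [← Set.ncard_coe_finset, coe_image, coe_univ, Set.image_univ, ← Nat.card_coe_set_eq]
    rfl
  rw [hR] at hker
  rw [← hker, ← Set.ncard_coe_finset]
  have : ((univ.image d).filter (fun u => u ^ k = 1) : Set Kˣ) =
      Subtype.val '' ((powMonoidHom k : d.range →* d.range).ker : Set d.range) := by
    ext u
    simp only [coe_filter, mem_image, mem_univ, true_and, Set.mem_ofPred_eq, Set.mem_image,
      SetLike.mem_coe, MonoidHom.mem_ker, powMonoidHom_apply]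
    constructor
    · rintro ⟨⟨g, rfl⟩, hu⟩
      exact ⟨⟨d g, g, rfl⟩, Subtype.ext hu, rfl⟩
    · rintro ⟨⟨_, g, rfl⟩, hu, rfl⟩
      exact ⟨⟨g, rfl⟩, congrArg Subtype.val hu⟩
  rw [this, Set.ncard_image_of_injective _ Subtype.val_injective, ← Nat.card_coe_set_eq]
  rfl

open Finset in
theorem card_eq_card_filter_image_mul {G A : Type*} [Fintype G] [DecidableEq A] (d : G → A)
    (S : Finset G) (P : A → Prop) [DecidablePred P] (k : ℕ) (hS : ∀ g ∈ S, P (d g))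
    (hk : ∀ g, P (d g) → #{g' ∈ S | d g' = d g} = k) :
    #S = #{u ∈ univ.image d | P u} * k := by
  have hmaps : ∀ g ∈ S, d g ∈ (univ.image d).filter P := fun g hg =>
    mem_filter.2 ⟨mem_image_of_mem d (mem_univ g), hS g hg⟩
  rw [card_eq_sum_card_fiberwise hmaps, sum_congr rfl (g := fun _ => k), sum_const, smul_eq_mul]
  intro u hu
  obtain ⟨hu, hP⟩ := mem_filter.1 hu
  obtain ⟨g, -, rfl⟩ := mem_image.1 hu
  exact hk g hP

theorem finsum_mem_subgroup {A M : Type*} [Group A] [AddCommMonoid M] (G : Subgroup A) [Fintype G]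
    [DecidableEq G] (f : A → M) :
    ∑ᶠ g ∈ {g : A | g ∈ G ∧ g ≠ 1}, f g = ∑ g ∈ Finset.univ.erase (1 : G), f g := by
  have : {g : A | g ∈ G ∧ g ≠ 1} = Subtype.val '' ((Finset.univ.erase (1 : G) : Finset G) : Set G) := by
    ext g
    simp only [Set.mem_ofPred_eq, Finset.coe_erase, Finset.coe_univ, Set.mem_image, Set.mem_sdiff,
      Set.mem_univ, true_and, Set.mem_singleton_iff]
    constructor
    · rintro ⟨hg, h1⟩
      exact ⟨⟨g, hg⟩, fun h => h1 (congrArg Subtype.val h), rfl⟩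
    · rintro ⟨g, h1, rfl⟩
      exact ⟨g.2, fun h => h1 (Subtype.ext h)⟩
  rw [this, finsum_mem_image Subtype.val_injective.injOn, finsum_mem_coe_finset]

section Invariants

open Finset

variable {G : Subgroup (F ≃ₐ[K] F)} {Q : ValuationSubring F} (C : Coordinates q n x y z G)

/-- If `[1, b, c, d] ∈ G`, then `[1, b, c, 1] ∈ G`. -/
theorem Coordinates.exists_unipotent (hF : IsGGK q n K x y z) (hQ : IsPlace K Q) (hz : z ∉ Q)
    {g : G} (hg : C.a g = 1) : ∃ w : G, C.d w = 1 ∧ C.b w = C.b g ∧ C.c w = C.c g := by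
  obtain ⟨h, hx, hy, hd, -⟩ := C.exists_semisimple_of_one hF hQ hz hg
  have hw : C.d (g * h⁻¹) = 1 := by rw [map_mul, map_inv, hd, mul_inv_cancel]
  have e : g * h⁻¹ * h = g := inv_mul_cancel_right g h
  have e' : ((g * h⁻¹ : G) : F ≃ₐ[K] F) * h = g := congrArg Subtype.val e
  have hwy : ((g * h⁻¹ : G) : F ≃ₐ[K] F) y = (g : F ≃ₐ[K] F) y := by
    conv_lhs => rw [← hy]
    rw [← AlgEquiv.mul_apply, e']
  have hwx : ((g * h⁻¹ : G) : F ≃ₐ[K] F) x = (g : F ≃ₐ[K] F) x := by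
    conv_lhs => rw [← hx]
    rw [← AlgEquiv.mul_apply, e']
  have h1 := C.hasCoords (g * h⁻¹)
  obtain ⟨ha, hb⟩ := h1.eq_of_map_y hF hQ hz (hwy.trans (C.hasCoords g).map_y)
  rw [ha, hb] at h1
  exact ⟨g * h⁻¹, hw, hb, h1.c_eq (C.hasCoords g) hwx⟩

theorem Coordinates.a_eq_one (C : Coordinates q n x y z G) {g : G} (hg : C.d g = 1) :
    C.a g = 1 := by
  rw [C.a_eq_one_iff, hg, one_pow]

theorem Coordinates.mem_G2 (hF : IsGGK q n K x y z) (hQ : IsPlace K Q) (hz : z ∉ Q) {b : K} :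
    b ∈ G2 q n x y z G ↔ ∃ w : G, C.d w = 1 ∧ C.b w = b := by
  constructor
  · rintro ⟨g, hg, c, d, h⟩
    obtain ⟨ha, rfl, -⟩ := C.eq_of_hasCoords hF hQ hz (g := ⟨g, hg⟩) h
    obtain ⟨w, hw, hb, -⟩ := C.exists_unipotent hF hQ hz ha
    exact ⟨w, hw, hb⟩
  · rintro ⟨w, hw, rfl⟩
    have := C.hasCoords w
    rw [C.a_eq_one hw] at this
    exact ⟨w, w.2, _, _, this⟩

/-- Since a = d^m, the conditions a = 1 and a^(q+1) = 1 become conditions on d alone. The three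
disjoint cases are written as a sum so that each can be added up over G separately. -/
theorem Coordinates.N_eq (hF : IsGGK q n K x y z) (hQ : IsPlace K Q) (hz : z ∉ Q) (g : G)
    [DecidableEq K] [DecidablePred C.IsFixing] :
    N q x y (g : F ≃ₐ[K] F) =
      (if C.d g ^ m q n = 1 ∧ C.b g = 0 ∧ C.c g = 0 then q ^ 3 else 0) +
      (if (C.d g ^ m q n ≠ 1 ∧ C.d g ^ (q ^ n + 1) = 1) ∧ C.IsFixing g then q else 0) +
      (if C.d g ^ (q ^ n + 1) ≠ 1 then 1 else 0) := by
  obtain ⟨p, k, hp, hk, hqp, _, _⟩ := hF.exists_charP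
  have := hF.finite
  have h := C.hasCoords g
  rw [N_eq_ncard hF hQ hz h]
  simp only [ne_eq, ← C.a_eq_one_iff, ← C.a_pow_eq_one_iff hF.odd]
  by_cases ha : C.a g = 1
  · by_cases hbc : C.b g = 0 ∧ C.c g = 0
    · rw [ha, hbc.1, hbc.2, ncard_fixedPoints_one hp hk hqp hF.card_eq]
      simp
    · rw [ha, ncard_fixedPoints_of_one hF.isPrimePow.pos hbc]
      simp [hbc]
  · by_cases haq : C.a g ^ (q + 1) = 1
    · obtain ⟨h1, h2⟩ := ncard_fixedPoints_of_norm_one (c := C.c g) hp hk hqp hF.card_eq ha haq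
        h.a_mem h.b_mem
      by_cases hfix : C.IsFixing g
      · rw [h1 hfix]; simp [ha, haq, hfix]
      · rw [h2 hfix]; simp [ha, haq, hfix]
    · rw [ncard_fixedPoints_of_norm_ne_one hp hqp haq h.a_mem h.b_mem h.trace_norm]
      simp [ha, haq]

/-- The value at `Q_∞` of `g τ - τ`. -/
def ordValue [DecidableEq K] (q n : ℕ) (d : Kˣ) (b : K) : ℤ :=
  1 + (if d = 1 then (m q n : ℤ) else 0) + if d = 1 ∧ b = 0 then (q ^ n + 1 - m q n : ℤ) else 0

theorem Coordinates.ord_eq_ordValue [DecidableEq K] (hF : IsGGK q n K x y z)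
    (hQ : IsPlace K Q) (hz : z ∉ Q) (hG : G ≤ Q.decompositionSubgroup K) {g : G} (hg : g ≠ 1) :
    ord Q ((g : F ≃ₐ[K] F) (tau q n x y z) - tau q n x y z) =
      (ordValue q n (C.d g) (C.b g) : WithTop ℤ) := by
  obtain ⟨h1, h2, h3⟩ := ord_map_tau_sub hF hQ hz (hG g.2) (C.hasCoords g)
  rw [ordValue]
  by_cases hd : C.d g = 1
  · have hd' : (C.d g : K) = 1 := by rw [hd, Units.val_one]
    by_cases hb : C.b g = 0
    · have hc : C.c g ≠ 0 := fun hc => hg (C.ext hF (by rw [hd, map_one])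
        (by rw [hb, (C.one hF hQ hz).2.1]) (by rw [hc, (C.one hF hQ hz).2.2]))
      rw [h3 hd' hb hc, if_pos hd, if_pos ⟨hd, hb⟩, WithTop.coe_inj]
      ring
    · rw [h2 hd' hb, if_pos hd, if_neg (fun h => hb h.2), WithTop.coe_inj]
      ring
  · rw [h1 (fun h => hd (Units.ext h)), if_neg hd, if_neg (fun h => hd h.1), WithTop.coe_inj]
    ring

variable [Fintype G] [DecidableEq K]

theorem Coordinates.ncard_G0 (hF : IsGGK q n K x y z) (hQ : IsPlace K Q) (hz : z ∉ Q) :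
    (G0 q n x y z G).ncard = #(univ.image C.d) := by
  have : G0 q n x y z G = (fun u : Kˣ => (u : K)) '' (univ.image C.d : Finset Kˣ) := by
    ext d
    simp only [G0, Set.mem_ofPred_eq, coe_image, coe_univ, Set.image_univ, Set.mem_image,
      Set.mem_range, exists_exists_eq_and]
    constructor
    · rintro ⟨g, hg, a, b, c, h⟩
      exact ⟨⟨g, hg⟩, (C.eq_of_hasCoords hF hQ hz h).2.2.2⟩
    · rintro ⟨g, rfl⟩
      exact ⟨g, g.2, _, _, _, C.hasCoords g⟩
  rw [this, Set.ncard_image_of_injective _ Units.val_injective, Set.ncard_coe_finset]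

theorem Coordinates.ncard_Gw (hF : IsGGK q n K x y z) (hQ : IsPlace K Q) (hz : z ∉ Q) :
    (Gw q n x y z G).ncard = #{g : G | C.d g = 1} := by
  have : Gw q n x y z G = Subtype.val '' ((univ.filter fun g : G => C.d g = 1) : Set G) := by
    ext g
    simp only [Gw, Set.mem_ofPred_eq, coe_filter, mem_univ, true_and, Set.mem_image]
    constructor
    · rintro ⟨hg, a, b, c, h⟩
      exact ⟨⟨g, hg⟩, Units.ext (C.eq_of_hasCoords hF hQ hz h).2.2.2, rfl⟩
    · rintro ⟨g, hg, rfl⟩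
      refine ⟨g.2, C.a g, C.b g, C.c g, ?_⟩
      have := C.hasCoords g
      rwa [hg, Units.val_one] at this
  rw [this, Set.ncard_image_of_injective _ Subtype.val_injective, Set.ncard_coe_finset]

/-- Each c in G₃ is realized with d = 1 by `exists_unipotent`, and then c determines the element. -/
theorem Coordinates.ncard_G3 (hF : IsGGK q n K x y z) (hQ : IsPlace K Q) (hz : z ∉ Q) :
    (G3 q n x y z G).ncard = #{g : G | C.d g = 1 ∧ C.b g = 0} := by
  have : G3 q n x y z G = C.c '' ((univ.filter fun g : G => C.d g = 1 ∧ C.b g = 0) : Set G) := by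
    ext c
    simp only [coe_filter, mem_univ, true_and, Set.mem_image, Set.mem_ofPred_eq]
    constructor
    · rintro ⟨g, hg, d, h⟩
      obtain ⟨ha, hb, rfl, -⟩ := C.eq_of_hasCoords hF hQ hz (g := ⟨g, hg⟩) h
      obtain ⟨w, hw, hbw, hcw⟩ := C.exists_unipotent hF hQ hz ha
      exact ⟨w, ⟨hw, hbw.trans hb⟩, hcw⟩
    · rintro ⟨w, ⟨hw, hb⟩, rfl⟩
      have := C.hasCoords w
      rw [C.a_eq_one hw, hb] at this
      exact ⟨w, w.2, _, this⟩
  rw [this, Set.InjOn.ncard_image, Set.ncard_coe_finset]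
  intro g hg g' hg' hc
  simp only [coe_filter, mem_univ, true_and, Set.mem_ofPred_eq] at hg hg'
  exact C.ext hF (hg.1.trans hg'.1.symm) (hg.2.trans hg'.2.symm) hc

theorem Coordinates.card_fiber (g : G) : #{g' : G | C.d g' = C.d g} = #{g' : G | C.d g' = 1} :=
  MonoidHom.card_fiber_eq_of_mem_range C.d ⟨g, rfl⟩ ⟨1, map_one _⟩

-- Over a given d the value of a is fixed and c = β^q b is a function of b, so such an element is
-- determined by b. Right translation by g⁻¹ carries the fibre into the kernel of d, where b ranges
-- over G₂. Conversely, w g can be corrected to satisfy c = β^q b without changing b or d, by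
-- `exists_isFixing`.
open Classical in
theorem Coordinates.card_isFixing_fiber (hF : IsGGK q n K x y z) (hQ : IsPlace K Q) (hz : z ∉ Q)
    {g : G} (hg : C.a g ≠ 1) (hgq : C.a g ^ (q + 1) = 1) :
    #{g' : G | C.d g' = C.d g ∧ C.IsFixing g'} = (G2 q n x y z G).ncard := by
  have ha : ∀ {g' : G}, C.d g' = C.d g → C.a g' = C.a g := fun h => by
    rw [C.a_eq, C.a_eq, h]
  have ha0 : C.a g ≠ 0 := (C.hasCoords g).a_ne_zero
  rw [← Set.ncard_coe_finset]
  refine Set.ncard_congr (fun g' _ => C.b (g' * g⁻¹)) ?_ ?_ ?_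
  · intro g' hg'
    simp only [coe_filter, mem_univ, true_and, Set.mem_ofPred_eq] at hg'
    rw [C.mem_G2 hF hQ hz]
    exact ⟨g' * g⁻¹, by rw [map_mul, map_inv, hg'.1, mul_inv_cancel], rfl⟩
  · intro g₁ g₂ h₁ h₂ hb
    simp only [coe_filter, mem_univ, true_and, Set.mem_ofPred_eq] at h₁ h₂
    have hb : C.b (g₁ * g⁻¹) = C.b (g₂ * g⁻¹) := hb
    have hb' : C.b g₁ = C.b g₂ := by
      have e₁ := C.b_mul hF hQ hz (g₁ * g⁻¹) g
      have e₂ := C.b_mul hF hQ hz (g₂ * g⁻¹) g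
      rw [inv_mul_cancel_right] at e₁ e₂
      rw [e₁, e₂, hb]
    refine C.ext hF (h₁.1.trans h₂.1.symm) hb' ?_
    have f₁ := h₁.2
    have f₂ := h₂.2
    rw [IsFixing] at f₁ f₂
    rw [f₁, f₂, ha h₁.1, ha h₂.1, hb']
  · intro b hb
    obtain ⟨w, hw, rfl⟩ := (C.mem_G2 hF hQ hz).1 hb
    have hd : C.d (w * g) = C.d g := by rw [map_mul, hw, one_mul]
    obtain ⟨h, hhd, hhb, hfix⟩ := C.exists_isFixing hF hQ hz (g := w * g)
      (by rwa [ha hd]) (by rwa [ha hd])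
    refine ⟨h, ?_, ?_⟩
    · simp only [coe_filter, mem_univ, true_and, Set.mem_ofPred_eq]
      exact ⟨hhd.trans hd, hfix⟩
    · have e₁ := C.b_mul hF hQ hz (h * g⁻¹) g
      rw [inv_mul_cancel_right, hhb, C.b_mul hF hQ hz] at e₁
      exact (mul_left_cancel₀ ha0 (add_right_cancel e₁)).symm

/-- The sum of the numbers of fixed places over all elements of `G`. -/
theorem Coordinates.sum_N (hF : IsGGK q n K x y z) (hQ : IsPlace K Q) (hz : z ∉ Q) :
    ∑ g : G, (N q x y (g : F ≃ₐ[K] F) : ℤ) =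
      q ^ 3 * Nat.gcd #(univ.image C.d) (m q n) +
      q * (Nat.gcd #(univ.image C.d) (q ^ n + 1) - Nat.gcd #(univ.image C.d) (m q n)) *
        (G2 q n x y z G).ncard +
      (#(univ.image C.d) - Nat.gcd #(univ.image C.d) (q ^ n + 1)) * #{g : G | C.d g = 1} := by
  classical
  -- Exactly one element over each d with d^m = 1, namely [1, 0, 0, d].
  have hone : #{g : G | C.d g ^ m q n = 1 ∧ C.b g = 0 ∧ C.c g = 0} =
      Nat.gcd #(univ.image C.d) (m q n) := by
    rw [card_eq_card_filter_image_mul C.d _ (fun u => u ^ m q n = 1) 1,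
      card_filter_image_pow_eq_one, mul_one]
    · intro g hg
      exact (mem_filter.1 hg).2.1
    · intro g hg
      obtain ⟨h, -, -, hd, ha, hb, hc⟩ :=
        C.exists_semisimple_of_one hF hQ hz ((C.a_eq_one_iff g).2 hg)
      rw [card_eq_one]
      refine ⟨h, ?_⟩
      ext g'
      simp only [mem_filter, mem_univ, true_and, mem_singleton]
      constructor
      · rintro ⟨⟨-, hb', hc'⟩, hd'⟩
        exact C.ext hF (hd'.trans hd.symm) (hb'.trans hb.symm) (hc'.trans hc.symm)
      · rintro rfl
        exact ⟨⟨by rw [hd]; exact hg, hb, hc⟩, hd⟩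
  have hfix : #{g : G | (C.d g ^ m q n ≠ 1 ∧ C.d g ^ (q ^ n + 1) = 1) ∧ C.IsFixing g} =
      #{u ∈ univ.image C.d | u ^ m q n ≠ 1 ∧ u ^ (q ^ n + 1) = 1} *
        (G2 q n x y z G).ncard := by
    refine card_eq_card_filter_image_mul C.d _ (fun u => u ^ m q n ≠ 1 ∧ u ^ (q ^ n + 1) = 1) _
      (fun g hg => (mem_filter.1 hg).2.1) fun g hg => ?_
    rw [← C.card_isFixing_fiber hF hQ hz (g := g) (fun h => hg.1 ((C.a_eq_one_iff g).1 h))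
      ((C.a_pow_eq_one_iff hF.odd g).2 hg.2)]
    congr 1
    ext g'
    simp only [mem_filter, mem_univ, true_and]
    constructor
    · rintro ⟨⟨-, h1⟩, h2⟩
      exact ⟨h2, h1⟩
    · rintro ⟨h2, h1⟩
      exact ⟨⟨by rw [h2]; exact hg, h1⟩, h2⟩
  -- Since m divides q^n + 1, the δ₁ solutions of u^m = 1 are among the δ₂ solutions of u^(q^n+1) =
  -- 1.
  have hsub : (#{u ∈ univ.image C.d | u ^ m q n ≠ 1 ∧ u ^ (q ^ n + 1) = 1} : ℤ) =
      Nat.gcd #(univ.image C.d) (q ^ n + 1) - Nat.gcd #(univ.image C.d) (m q n) := by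
    rw [eq_sub_iff_add_eq, ← card_filter_image_pow_eq_one, ← card_filter_image_pow_eq_one,
      ← Nat.cast_add, ← card_union_of_disjoint]
    · congr 2
      ext u
      simp only [mem_union, mem_filter]
      have : u ^ m q n = 1 → u ^ (q ^ n + 1) = 1 := fun h => by
        rw [← succ_mul_m hF.odd, mul_comm, pow_mul, h, one_pow]
      tauto
    · rw [disjoint_filter]
      exact fun u _ h => h.1
  have hrest : #{g : G | C.d g ^ (q ^ n + 1) ≠ 1} =
      #{u ∈ univ.image C.d | u ^ (q ^ n + 1) ≠ 1} * #{g : G | C.d g = 1} := by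
    refine card_eq_card_filter_image_mul C.d _ (fun u => u ^ (q ^ n + 1) ≠ 1) _
      (fun g hg => (mem_filter.1 hg).2) fun g hg => ?_
    rw [← C.card_fiber g]
    congr 1
    ext g'
    simp only [mem_filter, mem_univ, true_and, and_iff_right_iff_imp]
    intro h
    rw [h]
    exact hg
  have hsub' : (#{u ∈ univ.image C.d | u ^ (q ^ n + 1) ≠ 1} : ℤ) =
      #(univ.image C.d) - Nat.gcd #(univ.image C.d) (q ^ n + 1) := by
    rw [eq_sub_iff_add_eq, ← card_filter_image_pow_eq_one, add_comm, ← Nat.cast_add,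
      card_filter_add_card_filter_not]
  simp only [C.N_eq hF hQ hz, Nat.cast_add, sum_add_distrib, Nat.cast_ite, Nat.cast_zero,
    ← sum_filter, sum_const, hone, hfix, hrest, nsmul_eq_mul, Nat.cast_mul, hsub, hsub']
  push_cast
  ring

/-- Here the identity is included with the finite value given by the formula, although the true
order there is ∞. The summand 1 contributes #G = g₀ g_w. -/
theorem Coordinates.sum_ordValue :
    ∑ g : G, ordValue q n (C.d g) (C.b g) =
      (m q n + #(univ.image C.d)) * #{g : G | C.d g = 1} +
        (q ^ n + 1 - m q n) * #{g : G | C.d g = 1 ∧ C.b g = 0} := by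
  have hcard : Fintype.card G = #(univ.image C.d) * #{g : G | C.d g = 1} := by
    have := card_eq_card_filter_image_mul C.d univ (fun _ => True) _ (fun _ _ => trivial)
      fun g _ => C.card_fiber g
    rwa [filter_true, card_univ] at this
  simp only [ordValue, sum_add_distrib, ← sum_filter, sum_const, nsmul_eq_mul, card_univ, hcard]
  push_cast
  ring

end Invariants

end GGK

/-- `Q` is the place `Q_∞` (the pole of `z`), and `Q.decompositionSubgroup K` is its stabilizer
`B(Q_∞)` in the group of automorphisms of `F / K`. -/
theorem proposition4p4 {K F : Type*} [Field K] [Field F] [Algebra K F] (q n : ℕ) (x y z : F)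
    (hF : IsGGK q n K x y z)
    (Q : ValuationSubring F) (hQ : GGK.IsPlace K Q) (hz : z ∉ Q)
    (G : Subgroup (F ≃ₐ[K] F)) (hG : G ≤ Q.decompositionSubgroup K) :
    let m : ℕ := GGK.m q n
    let τ : F := GGK.tau q n x y z
    let g₀ : ℕ := (GGK.G0 q n x y z G).ncard
    let gw : ℕ := (GGK.Gw q n x y z G).ncard
    let c₂ : ℕ := (GGK.G2 q n x y z G).ncard
    let c₃ : ℕ := (GGK.G3 q n x y z G).ncard
    let δ₁ : ℕ := Nat.gcd g₀ m
    let δ₂ : ℕ := Nat.gcd g₀ (q ^ n + 1)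
    (G : Set (F ≃ₐ[K] F)).Finite ∧
    ∑ᶠ g ∈ {g : F ≃ₐ[K] F | g ∈ G ∧ g ≠ 1}, GGK.ord Q (g τ - τ) =
      (((m + g₀) * gw + (q ^ n + 1 - m) * c₃ - (q ^ n + 2) : ℤ) : WithTop ℤ) ∧
    ∑ᶠ g ∈ {g : F ≃ₐ[K] F | g ∈ G ∧ g ≠ 1}, (GGK.N q x y g : ℤ) =
      q * (δ₂ - δ₁) * c₂ + (g₀ - δ₂) * gw + q ^ 3 * (δ₁ - 1)
    := by
  classical
  intro m τ g₀ gw c₂ c₃ δ₁ δ₂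
  obtain ⟨C⟩ := GGK.exists_coordinates hF hQ hz hG
  have hfin := C.finite hF
  have := Fintype.ofFinite G
  have hg₀ : g₀ = (Finset.univ.image C.d).card := C.ncard_G0 hF hQ hz
  have hgw : gw = (Finset.univ.filter fun g : G => C.d g = 1).card := C.ncard_Gw hF hQ hz
  have hc₃ : c₃ = (Finset.univ.filter fun g : G => C.d g = 1 ∧ C.b g = 0).card :=
    C.ncard_G3 hF hQ hz
  obtain ⟨ha1, hb1, hc1⟩ := C.one hF hQ hz
  refine ⟨hfin, ?_, ?_⟩
  -- The identity's formal value 1 + m + (q^n + 1 - m) = q^n + 2 is removed from the sum over G.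
  · rw [GGK.finsum_mem_subgroup,
      Finset.sum_congr rfl fun g hg => C.ord_eq_ordValue hF hQ hz hG (Finset.ne_of_mem_erase hg),
      ← WithTop.coe_sum, WithTop.coe_inj, Finset.sum_erase_eq_sub (Finset.mem_univ _),
      C.sum_ordValue, hg₀, hgw, hc₃, GGK.ordValue, map_one, hb1, if_pos rfl, if_pos ⟨rfl, rfl⟩]
    ring
  -- The identity fixes all q³ places, which turns q³ δ₁ into q³ (δ₁ - 1).
  · rw [GGK.finsum_mem_subgroup, Finset.sum_erase_eq_sub (Finset.mem_univ _), C.sum_N hF hQ hz,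
      C.N_eq hF hQ hz, hb1, hc1, ← hg₀, ← hgw]
    simp only [map_one, one_pow, ne_eq, not_true_eq_false, false_and, and_self, if_true, if_false]
    push_cast
    ring
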